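/- Let $F$ be a field of characteristic $2$. For $a\in F$ and $b\in F^\times$ let $[a,b)_F$ denote the quaternion $F$-algebra generated by elements $i,j$ with $i^2+i=a$, $j^2=b$, $ji=(1+i)j$. For a central simple $F$-algebra $C$ let $\lambda_2(C)$ denote the smallest $k\in\mathbb N$ such that $C$ is Brauer equivalent to a tensor product of $k$ quaternion $F$-algebras (central simple $F$-algebras of degree $2$), with $\lambda_2(C)=\infty$ if there is no such $k$. Write $\sim$ for Brauer equivalence. Let $A$ be a central simple $F$-algebra of exponent $2$, and let $m,n\ge 0$ be integers. Assume that $A$ splits over a field $F(\alpha_1,\dots,\alpha_m,\sqrt{b_1},\dots,\sqrt{b_n})$, where $\alpha_i^2-\alpha_i\in F$ for $1\le i\le m$ and $b_1,\dots,b_n\in F^\times\setminus F^{\times 2}$. Then there exist $a_1,\dots,a_n\in F$ and a central simple $F$-algebra $B$ such that $$A\sim B\otimes_F\bigotimes_{i=1}^{n}[a_i,b_i)_F$$ and the following hold: 1. If $m=1$, then $\lambda_2(B)\le 1$ and $\lambda_2(A)\le n+1$. 2. If $m=2$, then $\lambda_2(B)\le 2^n+1$ and $\lambda_2(A)\le 2^n+n+1$.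 3. If $m=3$, then $\lambda_2(B)\le 3\cdot 2^n+1$ and $\lambda_2(A)\le 3\cdot 2^n+n+1$. -/

import Mathlib

open scoped TensorProduct

universe u v w

/-- Brauer equivalence of two (finite-dimensional central simple) `F`-algebras: some matrix algebra
over `A` is isomorphic to some matrix algebra over `B`. This is Mathlib's `IsBrauerEquivalent`
without bundling, so that `A` and `B` may live in different universes. -/
def BrauerEquiv (F : Type u) [Field F] (A : Type v) [Ring A] [Algebra F A]
    (B : Type w) [Ring B] [Algebra F B] : Prop :=
  ∃ n m : ℕ, n ≠ 0 ∧ m ≠ 0 ∧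
    Nonempty (Matrix (Fin n) (Fin n) A ≃ₐ[F] Matrix (Fin m) (Fin m) B)

theorem brauerEquiv_iff_isBrauerEquivalent {F : Type u} [Field F] (A B : CSA.{u, v} F) :
    BrauerEquiv F A B ↔ IsBrauerEquivalent A B :=
  Iff.rfl

/-- A `K`-algebra is split if it is isomorphic to a full matrix algebra over `K`. -/
def IsSplitAlgebra (K : Type u) [Field K] (A : Type v) [Ring A] [Algebra K A] : Prop :=
  ∃ n : ℕ, n ≠ 0 ∧ Nonempty (A ≃ₐ[K] Matrix (Fin n) (Fin n) K)

/-- A central simple `F`-algebra `A` has exponent `2` if its Brauer class has order exactly `2`: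
`A` is not split, but `A ⊗ A` is. -/
def HasExponentTwo (F : Type u) [Field F] (A : Type v) [Ring A] [Algebra F A] : Prop :=
  ¬ IsSplitAlgebra F A ∧ IsSplitAlgebra F (A ⊗[F] A)

/-- Over a field of characteristic `2`, the algebra `[a, b)_F`: it has basis `1, i, j, ij` with
`i ^ 2 = a + i`, `j ^ 2 = b` and `j * i = (1 - i) * j`; signs are irrelevant in
characteristic `2`. -/
abbrev SymbolAlgebra (F : Type u) [Field F] (a b : F) : Type u :=
  QuaternionAlgebra F a 1 b

/-- The defining relations `i ^ 2 + i = a`, `j ^ 2 = b`, `j i = (1 + i) j` of `[a, b)_F`, for the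
standard generators `i` and `j`. -/
theorem symbolAlgebra_relations {F : Type u} [Field F] [CharP F 2] (a b : F) :
    let i : SymbolAlgebra F a b := ⟨0, 1, 0, 0⟩
    let j : SymbolAlgebra F a b := ⟨0, 0, 1, 0⟩
    i ^ 2 + i = algebraMap F (SymbolAlgebra F a b) a ∧
      j ^ 2 = algebraMap F (SymbolAlgebra F a b) b ∧ j * i = (1 + i) * j := by
  have h2 : (1 : F) + 1 = 0 := CharTwo.add_self_eq_zero 1
  refine ⟨?_, ?_, ?_⟩ <;> ext <;> simp [pow_two, QuaternionAlgebra.algebraMap_eq, h2, CharTwo.neg_eq]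

/-- `A` is Brauer equivalent to a tensor product over `F` of `k` quaternion algebras over `F`,
a quaternion algebra being a central simple algebra of degree `2`, that is, of dimension `4`.
For `k = 0` the tensor product is `F`. -/
def IsBrauerEquivQuaternions (F : Type u) [Field F] (A : Type v) [Ring A] [Algebra F A]
    (k : ℕ) : Prop :=
  ∃ H : Fin k → CSA.{u, u} F, (∀ i, Module.finrank F (H i) = 2 ^ 2) ∧
    BrauerEquiv F A (PiTensorProduct F fun i => H i)

/-- The `2`-symbol length `λ₂(A)`: the least number `k` such that `A` is Brauer equivalent to a
tensor product of `k` quaternion algebras. It is `⊤` if there is no such `k`. -/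
noncomputable def symbolLength (F : Type u) [Field F] (A : Type v) [Ring A] [Algebra F A] : ℕ∞ :=
  ⨅ (k : ℕ) (_ : IsBrauerEquivQuaternions F A k), (k : ℕ∞)

/-! ### Central simple algebras: centralizers, tensor products, base change -/

section

variable {F : Type u} [Field F]

section
variable (F)
variable (A : Type v) [Ring A] [Algebra F A] [Algebra.IsCentral F A] [IsSimpleRing A] [FiniteDimensional F A]

/-! The argument takes place in the Brauer group `Br F`. Quaternion algebras become symbols [a,b),
additive in a, multiplicative in b, and zero if a = u² + u or if b is a norm from the quadratic
extension given by a. In characteristic 2 there is one more identity, [x(y+z), y+z) = [xy, y) + [xz,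
z) (`Br.symb_mul_add`).

Let K be F with all the square roots adjoined. A 2-torsion class over K split by the Artin–Schreier
generators is [c,g) plus r symbols, where c = α₁² + α₁ lies in F and r = 0, 1, 3 for m = 1, 2, 3.
Going back from E = F(√b) to F doubles r, keeps c, and costs one symbol [a,b)
(`Br.exists_eq_symb_add_symb_add`). After n steps B is [c,g) plus 2ⁿr symbols.

The doubling uses the squaring map ϕ : E → F. Extending a class from F to E and then applying ϕ is
the Frobenius of F, which kills 2-torsion (`Br.map_frobenius_eq_zero`). A symbol over E comes from F
once its right slot lies in F, since [z,y) = [z²,y). The identity above collects everything else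
into one symbol [Z+Cw, w), and the vanishing of its image under ϕ shows that this symbol comes from
F as well.

For the values of r, the case m = 1 is the description of classes split by a separable quadratic
extension. For m = 2 the point is `Br.exists_eq_symb_add_symb`: a 2-torsion class over F which
becomes [ρ,η) over such an extension is [a,g) + [p,q), with p = ρ if ρ lies in F. Its proof puts an
involution of the second kind on the quaternion algebra and descends that algebra to F. For m = 3,
two symbols over F(α₁) with left slots in F merge into one after correction by two symbols over F
(`Br.exists_symb_add_symb_eq_symb`), and the case of one symbol applies. -/

theorem mulLeftRight_bijective : Function.Bijective (AlgHom.mulLeftRight F A) := by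
  have hsurj : Function.Surjective (AlgHom.mulLeftRight F A) := by
    let S := (AlgHom.mulLeftRight F A).range
    have hS : ∀ a b : A, ∃ s : S, ∀ x : A, s • x = a * x * b := fun a b =>
      ⟨⟨_, a ⊗ₜ MulOpposite.op b, rfl⟩, fun x => by
        change AlgHom.mulLeftRight F A _ x = _
        simp [AlgHom.mulLeftRight_apply]⟩
    have : IsSimpleModule S A := by
      refine isSimpleModule_iff_toSpanSingleton_surjective.2 ⟨inferInstance, fun x hx => ?_⟩
      let I : Ideal A :=
        { carrier := {y | ∃ s : S, s • x = y}
          add_mem' := by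
            rintro _ _ ⟨s, rfl⟩ ⟨t, rfl⟩
            exact ⟨s + t, add_smul _ _ _⟩
          zero_mem' := ⟨0, zero_smul _ _⟩
          smul_mem' := by
            rintro c _ ⟨s, rfl⟩
            obtain ⟨r, hr⟩ := hS c 1
            exact ⟨r * s, by rw [mul_smul, hr]; simp⟩ }
      have hI : I.IsTwoSided := ⟨by
        rintro _ c ⟨s, rfl⟩
        obtain ⟨r, hr⟩ := hS 1 c
        exact ⟨r * s, by rw [mul_smul, hr]; simp⟩⟩
      rcases (isSimpleRing_iff_isTwoSided_imp.1 ‹IsSimpleRing A›).2 I hI with h | h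
      · exact absurd ((Submodule.mem_bot A).1 (h ▸ (⟨1, one_smul _ _⟩ : x ∈ I))) hx
      · intro y
        exact (h ▸ Submodule.mem_top : y ∈ I)
    intro f
    classical
    -- An `S`-endomorphism of `A` commutes with left and right multiplications, so it is
    -- multiplication by its value at 1, which is central, hence a scalar. Every `F`-linear map thus
    -- commutes with all of them, and density on a basis realizes it in `S`.
    obtain ⟨r, hr⟩ := jacobson_density (R := S) (M := A)
      { toFun := f
        map_add' := map_add f
        map_smul' := fun φ x => by
          have hφ : ∀ x, φ x = x * φ 1 := fun x => by
            obtain ⟨r, hr⟩ := hS x 1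
            have := φ.map_smul r 1
            rw [hr, hr] at this
            simpa using this
          have hφ' : ∀ x, φ x = φ 1 * x := fun x => by
            obtain ⟨r, hr⟩ := hS 1 x
            have := φ.map_smul r 1
            rw [hr, hr] at this
            simpa using this
          obtain ⟨c, hc⟩ := Algebra.IsCentral.mem_center_iff F |>.1
            (Subalgebra.mem_center_iff.2 fun b => ((hφ b).symm.trans (hφ' b)) :
              φ 1 ∈ Subalgebra.center F A)
          change f (φ x) = φ (f x)
          rw [hφ' x, hφ' (f x), hc, ← Algebra.smul_def, ← Algebra.smul_def, map_smul] } 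
      (Finset.univ.image (Module.finBasis F A))
    obtain ⟨t, ht⟩ := r.2
    refine ⟨t, (Module.finBasis F A).ext fun i => ?_⟩
    have := hr (Module.finBasis F A i) (by simp)
    exact (congr($ht _)).trans this.symm
  refine ⟨?_, hsurj⟩
  refine (LinearMap.injective_iff_surjective_of_finrank_eq_finrank
    (f := (AlgHom.mulLeftRight F A).toLinearMap) ?_).2 hsurj
  rw [Module.finrank_tensorProduct, Module.finrank_linearMap, 
    (MulOpposite.opLinearEquiv F (M := A)).finrank_eq]

end

section centralizer
variable {A : Type v} [Ring A] [Algebra F A] {M : Type w} [Ring M] [Algebra F M]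

/-- The centralizer of the image of an algebra homomorphism. -/
abbrev AlgHom.centralizer (f : A →ₐ[F] M) : Subalgebra F M :=
  Subalgebra.centralizer F (Set.range f)

theorem AlgHom.mem_centralizer {f : A →ₐ[F] M} {m : M} :
    m ∈ f.centralizer ↔ ∀ a, f a * m = m * f a := by
  simp [Subalgebra.mem_centralizer_iff]

/-- The multiplication map from the tensor product of a central simple subalgebra with its
centralizer. -/
def AlgHom.mulCentralizer (f : A →ₐ[F] M) : A ⊗[F] f.centralizer →ₐ[F] M :=
  Algebra.TensorProduct.lift f f.centralizer.val fun a m => AlgHom.mem_centralizer.1 m.2 a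

@[simp] theorem AlgHom.mulCentralizer_tmul (f : A →ₐ[F] M) (a : A) (m : f.centralizer) :
    f.mulCentralizer (a ⊗ₜ m) = f a * m := by
  rfl

variable [Algebra.IsCentral F A] [IsSimpleRing A] [FiniteDimensional F A]

/-- By `mulLeftRight_bijective`, `M` is a module over End(A), hence `A` tensored with a multiplicity
space, which is the centralizer. The rank-one maps `p i` project `M` to the centralizer and give the
coordinates of an element in the basis `e`. -/
theorem AlgHom.mulCentralizer_bijective (f : A →ₐ[F] M) :
    Function.Bijective f.mulCentralizer := by
  let e := Module.finBasis F A
  let σ := (AlgEquiv.ofBijective _ (mulLeftRight_bijective F A))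
  -- the bimodule structure on `M`
  let Λ : A ⊗[F] Aᵐᵒᵖ →ₗ[F] M →ₗ[F] M := TensorProduct.lift
    (LinearMap.mk₂ F (fun (a : A) (b : Aᵐᵒᵖ) => LinearMap.mulLeftRight F (f a, f b.unop))
      (fun a a' b => by ext; simp [add_mul]) (fun c a b => by ext; simp)
      (fun a b b' => by ext; simp [mul_add]) (fun c a b => by ext; simp))
  have hΛ : ∀ a b m, Λ (a ⊗ₜ b) m = f a * m * f b.unop := fun a b m => by simp [Λ]
  have hmul : ∀ s t m, Λ (s * t) m = Λ s (Λ t m) := by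
    intro s t m
    induction s with
    | zero => simp
    | add x y hx hy => simp [add_mul, hx, hy]
    | tmul a b =>
      induction t with
      | zero => simp
      | add x y hx hy => simp [mul_add, hx, hy]
      | tmul c d => simp [hΛ, mul_assoc]
  have hone : ∀ m, Λ 1 m = m := fun m => by rw [Algebra.TensorProduct.one_def, hΛ]; simp
  -- `p i` sends `e i` to `1` and the other basis vectors to `0`
  let p : Fin _ → A ⊗[F] Aᵐᵒᵖ := fun i =>
    σ.symm ((LinearMap.toSpanSingleton F A 1).comp (e.coord i))
  have hσ : ∀ i x, σ (p i) x = algebraMap F A (e.coord i x) := fun i x => by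
    simp [p, Algebra.algebraMap_eq_smul_one]
  have hcent : ∀ i m, Λ (p i) m ∈ f.centralizer := by
    intro i m
    refine AlgHom.mem_centralizer.2 fun a => ?_
    have h1 : (a ⊗ₜ 1) * p i = ((1 : A) ⊗ₜ[F] MulOpposite.op a) * p i := by
      apply σ.injective
      ext x
      have h2 : ∀ (c : A) (d : Aᵐᵒᵖ) y, σ (c ⊗ₜ d) y = c * y * d.unop := fun c d y => by
        simp [σ]
      rw [map_mul, map_mul, Module.End.mul_apply, Module.End.mul_apply, h2, h2, hσ]
      simp [Algebra.commutes]
    have h3 := congr(Λ $h1 m)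
    rw [hmul, hmul, hΛ, hΛ] at h3
    simpa using h3
  have hsum : ∑ i, (e i ⊗ₜ 1) * p i = (1 : A ⊗[F] Aᵐᵒᵖ) := by
    apply σ.injective
    ext x
    have h2 : ∀ (c : A) (d : Aᵐᵒᵖ) y, σ (c ⊗ₜ d) y = c * y * d.unop := fun c d y => by
      simp [σ]
    simp only [map_sum, map_mul, LinearMap.sum_apply, Module.End.mul_apply, h2, hσ, map_one]
    simp only [MulOpposite.unop_one, mul_one, Module.End.one_apply]
    conv_rhs => rw [← e.sum_repr x]
    exact Finset.sum_congr rfl fun i _ => by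
      rw [← Algebra.commutes, ← Algebra.smul_def]; rfl
  have hpΛ : ∀ i (a : A) (m : f.centralizer), Λ (p i) (f a * m) = e.coord i a • (m : M) := by
    intro i a m
    have key : ∀ t : A ⊗[F] Aᵐᵒᵖ, Λ t (f a * m) = f (σ t a) * m := by
      intro t
      induction t with
      | zero => simp
      | add x y hx hy => simp [add_mul, hx, hy]
      | tmul c d =>
        have := AlgHom.mem_centralizer.1 m.2 d.unop
        rw [hΛ]
        simp [σ, mul_assoc, this]
    rw [key, hσ, AlgHom.commutes, Algebra.smul_def]
  constructor
  · rw [injective_iff_map_eq_zero]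
    intro t ht
    obtain ⟨m, rfl⟩ : ∃ m : Fin _ → f.centralizer, t = ∑ i, e i ⊗ₜ m i := by
      clear ht
      induction t with
      | zero => exact ⟨0, by simp⟩
      | add x y hx hy =>
        obtain ⟨m, rfl⟩ := hx
        obtain ⟨m', rfl⟩ := hy
        exact ⟨m + m', by simp [TensorProduct.tmul_add, Finset.sum_add_distrib]⟩
      | tmul a n => 
        refine ⟨fun i => e.coord i a • n, ?_⟩
        simp_rw [TensorProduct.tmul_smul, TensorProduct.smul_tmul', ← TensorProduct.sum_tmul]
        congr 1
        exact (e.sum_repr a).symm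
    refine Finset.sum_eq_zero fun k _ => ?_
    have : m k = 0 := by
      have h4 : ∑ i, f (e i) * m i = 0 := by simpa using ht
      have h5 := congr(Λ (p k) $h4)
      simp only [map_sum, hpΛ, map_zero] at h5
      simpa [Finsupp.single_apply] using h5
    simp [this]
  · intro m
    refine ⟨∑ i, e i ⊗ₜ ⟨Λ (p i) m, hcent i m⟩, ?_⟩
    have h6 := congr(Λ $hsum m)
    rw [hone] at h6
    simpa [hmul, hΛ] using h6

/-- A central simple subalgebra splits off as a tensor factor. -/
noncomputable def AlgHom.tensorCentralizerEquiv (f : A →ₐ[F] M) : A ⊗[F] f.centralizer ≃ₐ[F] M :=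
  AlgEquiv.ofBijective _ f.mulCentralizer_bijective

theorem AlgHom.finrank_mul_finrank_centralizer (f : A →ₐ[F] M) :
    Module.finrank F A * Module.finrank F f.centralizer = Module.finrank F M := by
  rw [← Module.finrank_tensorProduct, f.tensorCentralizerEquiv.toLinearEquiv.finrank_eq]

/-- An ideal J of the centralizer generates A·J, which is two-sided in `M`. If A·J is everything, a
functional on `A` with value 1 at 1 retracts it to J and so puts 1 in J. -/
theorem AlgHom.isSimpleRing_centralizer [IsSimpleRing M] (f : A →ₐ[F] M) :
    IsSimpleRing f.centralizer := by
  have hnt : Nontrivial f.centralizer := inferInstance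
  refine isSimpleRing_iff_isTwoSided_imp.2 ⟨hnt, fun J hJ => ?_⟩
  let N : Submodule F M := Submodule.span F {m | ∃ a : A, ∃ c ∈ J, m = f a * c}
  have hcomm : ∀ (a : A) (c : f.centralizer), (c : M) * f a = f a * c := fun a c =>
    (AlgHom.mem_centralizer.1 c.2 a).symm
  have hl : ∀ (m : M), ∀ x ∈ N, m * x ∈ N := by
    intro m x hx
    obtain ⟨t, rfl⟩ := f.mulCentralizer_bijective.2 m
    induction hx using Submodule.span_induction with
    | zero => simp
    | add x y _ _ hx hy => rw [mul_add]; exact add_mem hx hy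
    | smul r x _ hx => rw [mul_smul_comm]; exact N.smul_mem _ hx
    | mem x hx =>
      obtain ⟨a, c, hc, rfl⟩ := hx
      induction t with
      | zero => simp
      | add x y hx hy => rw [map_add, add_mul]; exact add_mem hx hy
      | tmul a' c' =>
        refine Submodule.subset_span ⟨a' * a, c' * c, J.mul_mem_left _ hc, ?_⟩
        rw [AlgHom.mulCentralizer_tmul, mul_assoc, ← mul_assoc (c' : M), hcomm, map_mul]
        simp [mul_assoc]
  have hr : ∀ (m : M), ∀ x ∈ N, x * m ∈ N := by
    intro m x hx
    obtain ⟨t, rfl⟩ := f.mulCentralizer_bijective.2 m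
    induction hx using Submodule.span_induction with
    | zero => simp
    | add x y _ _ hx hy => rw [add_mul]; exact add_mem hx hy
    | smul r x _ hx => rw [smul_mul_assoc]; exact N.smul_mem _ hx
    | mem x hx =>
      obtain ⟨a, c, hc, rfl⟩ := hx
      induction t with
      | zero => simp
      | add x y hx hy => rw [map_add, mul_add]; exact add_mem hx hy
      | tmul a' c' =>
        refine Submodule.subset_span ⟨a * a', c * c', J.mul_mem_right _ hc, ?_⟩
        rw [AlgHom.mulCentralizer_tmul, mul_assoc, ← mul_assoc (c : M), hcomm, map_mul]
        simp [mul_assoc]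
  let I : Ideal M :=
    { carrier := N, add_mem' := N.add_mem, zero_mem' := N.zero_mem, smul_mem' := fun m x => hl m x }
  have hI : I.IsTwoSided := ⟨fun {x} m hx => hr m x hx⟩
  rcases (isSimpleRing_iff_isTwoSided_imp.1 ‹IsSimpleRing M›).2 I hI with h | h
  · left
    refine (Submodule.eq_bot_iff _).2 fun c hc => ?_
    have : (c : M) ∈ I := Submodule.subset_span ⟨1, c, hc, by simp⟩
    rw [h] at this
    exact Subtype.ext this
  · right
    obtain ⟨l, hl1⟩ := Module.Projective.exists_dual_eq_one F (one_ne_zero (α := A))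
    let R : M →ₗ[F] f.centralizer :=
      (TensorProduct.lid F _).toLinearMap ∘ₗ (TensorProduct.map l LinearMap.id) ∘ₗ
        f.tensorCentralizerEquiv.symm.toLinearMap
    have hR : ∀ a (c : f.centralizer), R (f a * c) = l a • c := fun a c => by
      have : f.tensorCentralizerEquiv.symm (f a * c) = a ⊗ₜ c := by
        rw [AlgEquiv.symm_apply_eq]; rfl
      simp [R, this]
    have hRJ : ∀ x ∈ N, R x ∈ J := by
      intro x hx
      induction hx using Submodule.span_induction with
      | zero => simp
      | add x y _ _ hx hy => rw [map_add]; exact add_mem hx hy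
      | smul r x _ hx =>
        rw [map_smul, Algebra.smul_def]; exact J.mul_mem_left _ hx
      | mem x hx =>
        obtain ⟨a, c, hc, rfl⟩ := hx
        rw [hR, Algebra.smul_def]; exact J.mul_mem_left _ hc
    have h1 : (1 : M) ∈ I := h ▸ Submodule.mem_top
    have h2 := hRJ 1 h1
    have h3 : R 1 = 1 := by
      have := hR 1 1
      simpa [hl1] using this
    rw [h3] at h2
    exact (Ideal.eq_top_iff_one _).2 h2

theorem AlgHom.isCentral_centralizer [Algebra.IsCentral F M] (f : A →ₐ[F] M) :
    Algebra.IsCentral F f.centralizer := by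
  refine ⟨fun z hz => ?_⟩
  rw [Subalgebra.mem_center_iff] at hz
  have h : (z : M) ∈ Subalgebra.center F M := by
    refine Subalgebra.mem_center_iff.2 fun m => ?_
    obtain ⟨t, rfl⟩ := f.mulCentralizer_bijective.2 m
    induction t with
    | zero => simp
    | add x y hx hy => simp [add_mul, mul_add, hx, hy]
    | tmul a n =>
      have h1 := AlgHom.mem_centralizer.1 z.2 a
      have h2 : (n : M) * z = z * n := congr(($(hz n) : M))
      rw [AlgHom.mulCentralizer_tmul, mul_assoc, h2, ← mul_assoc, h1, mul_assoc]
  obtain ⟨c, hc⟩ := Algebra.IsCentral.mem_center_iff F |>.1 h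
  exact Algebra.mem_bot.2 ⟨c, Subtype.ext hc.symm⟩

end centralizer

section tensor
variable (A : Type v) [Ring A] [Algebra F A] [Algebra.IsCentral F A] [IsSimpleRing A]
  [FiniteDimensional F A] (B : Type w) [Ring B] [Algebra F B]

/-- The decomposition of A ⊗ B as `A` tensored with the centralizer is unique, and `B` sits inside
the centralizer; slicing by a functional with value 1 at 1 recovers the element of `B`. -/
theorem centralizer_includeLeft (t : A ⊗[F] B)
    (ht : ∀ a : A, (a ⊗ₜ 1) * t = t * (a ⊗ₜ 1)) : ∃ b : B, t = 1 ⊗ₜ b := by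
  let f : A →ₐ[F] A ⊗[F] B := Algebra.TensorProduct.includeLeft
  let g : B →ₐ[F] f.centralizer := (Algebra.TensorProduct.includeRight).codRestrict _ fun b =>
    AlgHom.mem_centralizer.2 fun a => by simp [f]
  have hg : f.mulCentralizer.toLinearMap ∘ₗ (TensorProduct.map LinearMap.id g.toLinearMap) = LinearMap.id := by
    ext a b
    simp [f, g]
  obtain ⟨l, hl1⟩ := Module.Projective.exists_dual_eq_one F (one_ne_zero (α := A))
  let t' : f.centralizer := ⟨t, AlgHom.mem_centralizer.2 ht⟩
  have h1 : TensorProduct.map LinearMap.id g.toLinearMap t = 1 ⊗ₜ t' := by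
    apply f.mulCentralizer_bijective.1
    refine (congr($hg t)).trans ?_
    simp [t']
  have h2 := congr((TensorProduct.lid F _) (TensorProduct.map l LinearMap.id $h1))
  have h3 : ∀ s : A ⊗[F] B, (TensorProduct.lid F _) (TensorProduct.map l LinearMap.id
      (TensorProduct.map LinearMap.id g.toLinearMap s)) =
      g ((TensorProduct.lid F _) (TensorProduct.map l LinearMap.id s)) := by
    intro s
    induction s with
    | zero => simp
    | add x y hx hy => simp only [map_add, hx, hy]
    | tmul a b => simp
  rw [h3] at h2
  refine ⟨(TensorProduct.lid F _) (TensorProduct.map l LinearMap.id t), ?_⟩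
  have h4 := congr(($h2 : A ⊗[F] B))
  simpa [hl1, t', g] using h4.symm

/-- The map x ↦ l(x)·1 is a combination of two-sided multiplications, so an ideal is stable under
slicing by l. A nonzero tensor has a nonzero slice, which generates `B`. -/
instance isSimpleRing_tensorProduct [IsSimpleRing B] : IsSimpleRing (A ⊗[F] B) := by
  refine isSimpleRing_iff_isTwoSided_imp.2 ⟨inferInstance, fun I hI => ?_⟩
  let e := Module.finBasis F A
  let π : (A →ₗ[F] F) → A ⊗[F] B →ₗ[F] B := fun l =>
    (TensorProduct.lid F B).toLinearMap ∘ₗ TensorProduct.map l LinearMap.id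
  have hπ : ∀ l, ∀ t ∈ I, (1 : A) ⊗ₜ π l t ∈ I := by
    intro l
    obtain ⟨s, hs⟩ := (mulLeftRight_bijective F A).2 ((LinearMap.toSpanSingleton F A 1).comp l)
    have key : ∀ s : A ⊗[F] Aᵐᵒᵖ, ∀ t ∈ I,
        TensorProduct.map (AlgHom.mulLeftRight F A s) LinearMap.id t ∈ I := by
      intro s
      induction s with
      | zero => simp [TensorProduct.map_zero_left]
      | add x y hx hy =>
        intro t ht
        rw [map_add, TensorProduct.map_add_left]
        exact add_mem (hx t ht) (hy t ht)
      | tmul a b =>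
        intro t ht
        have : TensorProduct.map (AlgHom.mulLeftRight F A (a ⊗ₜ b)) LinearMap.id t =
            (a ⊗ₜ 1) * t * (b.unop ⊗ₜ 1) := by
          clear ht
          induction t with
          | zero => simp
          | add x y hx hy => simp only [map_add, hx, hy, mul_add, add_mul]
          | tmul c d => simp
        rw [this]
        exact I.mul_mem_right _ (I.mul_mem_left _ ht)
    intro t ht
    have h1 := key s t ht
    rw [hs] at h1
    convert h1 using 1
    clear ht h1
    induction t with
    | zero => simp
    | add x y hx hy => simp only [map_add, hx, hy, TensorProduct.tmul_add]
    | tmul c d => simp [π, TensorProduct.smul_tmul]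
  by_cases hbot : I = ⊥
  · exact Or.inl hbot
  right
  obtain ⟨t, ht, ht0⟩ := Submodule.exists_mem_ne_zero_of_ne_bot hbot
  have hsum : ∑ i, e i ⊗ₜ π (e.coord i) t = t := by
    clear ht ht0
    induction t with
    | zero => simp
    | add x y hx hy => simp only [map_add, TensorProduct.tmul_add, Finset.sum_add_distrib, hx, hy]
    | tmul c d =>
      simp only [π, LinearMap.comp_apply, TensorProduct.map_tmul, LinearMap.id_apply,
        LinearEquiv.coe_coe, TensorProduct.lid_tmul, TensorProduct.tmul_smul,
        TensorProduct.smul_tmul', ← TensorProduct.sum_tmul]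
      congr 1
      exact e.sum_repr c
  obtain ⟨i, hi⟩ : ∃ i, π (e.coord i) t ≠ 0 := by
    by_contra! h
    exact ht0 (by rw [← hsum]; simp [h])
  let J : Ideal B := I.comap (Algebra.TensorProduct.includeRight : B →ₐ[F] A ⊗[F] B)
  have hJ : J.IsTwoSided := ⟨fun {x} c (hx : (1 : A) ⊗ₜ[F] x ∈ I) => by
    have := I.mul_mem_right ((1 : A) ⊗ₜ[F] c) hx
    rw [Algebra.TensorProduct.tmul_mul_tmul, mul_one] at this
    exact this⟩
  rcases (isSimpleRing_iff_isTwoSided_imp.1 ‹IsSimpleRing B›).2 J hJ with h | h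
  · have : π (e.coord i) t ∈ J := hπ _ t ht
    rw [h] at this
    exact absurd this hi
  · have : (1 : B) ∈ J := h ▸ Submodule.mem_top
    exact (Ideal.eq_top_iff_one _).2 this

instance isCentral_tensorProduct [Algebra.IsCentral F B] : Algebra.IsCentral F (A ⊗[F] B) := by
  refine ⟨fun z hz => ?_⟩
  rw [Subalgebra.mem_center_iff] at hz
  obtain ⟨b, rfl⟩ := centralizer_includeLeft A B z fun a => hz _
  have hb : b ∈ Subalgebra.center F B := by
    refine Subalgebra.mem_center_iff.2 fun c => ?_
    have := hz (1 ⊗ₜ c)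
    rw [Algebra.TensorProduct.tmul_mul_tmul, Algebra.TensorProduct.tmul_mul_tmul, mul_one] at this
    exact Algebra.TensorProduct.includeRight_injective
      (FaithfulSMul.algebraMap_injective F A) this
  obtain ⟨c, rfl⟩ := Algebra.IsCentral.mem_center_iff F |>.1 hb
  exact Algebra.mem_bot.2 ⟨c, by
    rw [Algebra.TensorProduct.algebraMap_apply, Algebra.algebraMap_eq_smul_one,
      Algebra.algebraMap_eq_smul_one, TensorProduct.smul_tmul]⟩

end tensor

section baseChange
variable (E : Type v) [Field E] [Algebra F E] (A : Type w) [Ring A] [Algebra F A]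
  [Algebra.IsCentral F A] [IsSimpleRing A] [FiniteDimensional F A]

instance isSimpleRing_baseChange : IsSimpleRing (E ⊗[F] A) :=
  IsSimpleRing.of_ringEquiv (Algebra.TensorProduct.comm F A E).toRingEquiv inferInstance

instance isCentral_baseChange : Algebra.IsCentral E (E ⊗[F] A) := by
  refine ⟨fun z hz => ?_⟩
  rw [Subalgebra.mem_center_iff] at hz
  obtain ⟨b, hb⟩ := centralizer_includeLeft A E (Algebra.TensorProduct.comm F E A z) fun a => by
    have := congr(Algebra.TensorProduct.comm F E A $(hz (1 ⊗ₜ a)))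
    simpa using this
  refine Algebra.mem_bot.2 ⟨b, ?_⟩
  apply (Algebra.TensorProduct.comm F E A).injective
  rw [hb]
  simp [Algebra.TensorProduct.algebraMap_apply]

end baseChange

end

/-! ### Brauer equivalence and the Brauer group -/

section

variable {F : Type u} [Field F]

theorem AlgHom.bijective_of_finrank_eq {A : Type v} [Ring A] [Algebra F A] [IsSimpleRing A]
    {B : Type w} [Ring B] [Algebra F B] [Nontrivial B] [FiniteDimensional F A]
    [FiniteDimensional F B] (f : A →ₐ[F] B) (h : Module.finrank F A = Module.finrank F B) :
    Function.Bijective f := by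
  have hinj : Function.Injective f := f.toRingHom.injective
  have hs : Function.Surjective f.toLinearMap :=
    (LinearMap.injective_iff_surjective_of_finrank_eq_finrank h).1 hinj
  exact ⟨hinj, hs⟩

theorem BrauerEquiv.of_algEquiv {A : Type v} [Ring A] [Algebra F A] {B : Type w} [Ring B]
    [Algebra F B] (e : A ≃ₐ[F] B) : BrauerEquiv F A B :=
  ⟨1, 1, one_ne_zero, one_ne_zero, ⟨e.mapMatrix⟩⟩

open Matrix in
theorem BrauerEquiv.trans {A B C : Type*} [Ring A] [Algebra F A] [Ring B] [Algebra F B]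
    [Ring C] [Algebra F C] (hAB : BrauerEquiv F A B) (hBC : BrauerEquiv F B C) :
    BrauerEquiv F A C := by
  obtain ⟨n, m, hn, hm, ⟨iso1⟩⟩ := hAB
  obtain ⟨p, q, hp, hq, ⟨iso2⟩⟩ := hBC
  exact ⟨p * n, m * q, by simp_all, by simp_all,
    ⟨reindexAlgEquiv _ _ finProdFinEquiv |>.symm.trans <| compAlgEquiv _ _ _ _|>.symm.trans <|
    iso1.mapMatrix (m := Fin p)|>.trans <| compAlgEquiv _ _ _ _|>.trans <|
    reindexAlgEquiv F B (.prodComm (Fin p) (Fin m))|>.trans <| compAlgEquiv _ _ _ _|>.symm.trans <|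
    iso2.mapMatrix.trans <| compAlgEquiv _ _ _ _|>.trans <| reindexAlgEquiv _ _ finProdFinEquiv⟩⟩

/-- `1 × 1` matrices over `A` are `A`. -/
def matrixOneAlgEquiv (F : Type u) [Field F] (A : Type v) [Ring A] [Algebra F A] :
    Matrix (Fin 1) (Fin 1) A ≃ₐ[F] A where
  toFun M := M 0 0
  invFun a := Matrix.of fun _ _ => a
  left_inv M := by ext i j; simp [Subsingleton.elim i 0, Subsingleton.elim j 0]
  right_inv a := rfl
  map_mul' M N := by simp [Matrix.mul_apply]
  map_add' M N := rfl
  commutes' r := by simp [Matrix.algebraMap_matrix_apply]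

theorem brauerEquiv_matrix {A : Type v} [Ring A] [Algebra F A] {n : ℕ} (hn : n ≠ 0) :
    BrauerEquiv F (Matrix (Fin n) (Fin n) A) A :=
  ⟨1, n, one_ne_zero, hn, ⟨matrixOneAlgEquiv F _⟩⟩

open Matrix in
theorem BrauerEquiv.tensorProduct {A B C D : Type*} [Ring A] [Algebra F A] [Ring B] [Algebra F B]
    [Ring C] [Algebra F C] [Ring D] [Algebra F D] (hAB : BrauerEquiv F A B)
    (hCD : BrauerEquiv F C D) : BrauerEquiv F (A ⊗[F] C) (B ⊗[F] D) := by
  obtain ⟨n, m, hn, hm, ⟨iso1⟩⟩ := hAB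
  obtain ⟨p, q, hp, hq, ⟨iso2⟩⟩ := hCD
  refine ⟨n * p, m * q, by simp_all, by simp_all, ⟨?_⟩⟩
  exact (reindexAlgEquiv _ _ finProdFinEquiv).symm.trans <|
    (kroneckerTMulAlgEquiv (Fin n) (Fin p) F F A C).symm.trans <|
    (Algebra.TensorProduct.congr iso1 iso2).trans <|
    (kroneckerTMulAlgEquiv (Fin m) (Fin q) F F B D).trans <|
    reindexAlgEquiv _ _ finProdFinEquiv

open Matrix in
theorem BrauerEquiv.op {A B : Type*} [Ring A] [Algebra F A] [Ring B] [Algebra F B]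
    (hAB : BrauerEquiv F A B) : BrauerEquiv F Aᵐᵒᵖ Bᵐᵒᵖ := by
  obtain ⟨n, m, hn, hm, ⟨iso1⟩⟩ := hAB
  exact ⟨n, m, hn, hm, ⟨AlgEquiv.mopMatrix.trans (iso1.op.trans AlgEquiv.mopMatrix.symm)⟩⟩

open Matrix in
/-- Base change commutes with the formation of matrix algebras. -/
noncomputable def baseChangeMatrixAlgEquiv (E : Type w) [Field E] [Algebra F E] (k : ℕ) (A : Type v) [Ring A]
    [Algebra F A] :
    E ⊗[F] Matrix (Fin k) (Fin k) A ≃ₐ[E] Matrix (Fin k) (Fin k) (E ⊗[F] A) :=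
  (Algebra.TensorProduct.congr (S := E) (matrixOneAlgEquiv E E).symm
    (AlgEquiv.refl (R := F))).trans <|
  (kroneckerTMulAlgEquiv (Fin 1) (Fin k) F E E A).trans <|
  reindexAlgEquiv _ _ (Equiv.uniqueProd (Fin k) (Fin 1))

theorem BrauerEquiv.baseChange (E : Type*) [Field E] [Algebra F E] {A B : Type*} [Ring A]
    [Algebra F A] [Ring B] [Algebra F B]
    (hAB : BrauerEquiv F A B) : BrauerEquiv E (E ⊗[F] A) (E ⊗[F] B) := by
  obtain ⟨n, m, hn, hm, ⟨iso1⟩⟩ := hAB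
  exact ⟨n, m, hn, hm, ⟨(baseChangeMatrixAlgEquiv E n A).symm.trans
    ((Algebra.TensorProduct.congr AlgEquiv.refl iso1).trans (baseChangeMatrixAlgEquiv E m B))⟩⟩

theorem brauerEquiv_end (V : Type v) [AddCommGroup V] [Module F V] [FiniteDimensional F V]
    [Nontrivial V] : BrauerEquiv F (Module.End F V) F :=
  (BrauerEquiv.of_algEquiv (algEquivMatrix (Module.finBasis F V))).trans
    (brauerEquiv_matrix Module.finrank_pos.ne')

section split
variable {A : Type v} [Ring A] [Algebra F A] [IsSimpleRing A]

open Matrix in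
/-- A simple algebra which is Brauer equivalent to the base field is a matrix algebra. -/
theorem isSplitAlgebra_of_brauerEquiv (h : BrauerEquiv F A F) : IsSplitAlgebra F A := by
  obtain ⟨k, l, hk, hl, ⟨e⟩⟩ := h
  have : NeZero k := ⟨hk⟩
  have : NeZero l := ⟨hl⟩
  let V := Fin l → F
  let φ : Matrix (Fin k) (Fin k) A ≃ₐ[F] Module.End F V := e.trans Matrix.toLinAlgEquiv'
  have hfr : k * k * Module.finrank F A = l * l := by
    have := e.toLinearEquiv.finrank_eq
    rw [Module.finrank_matrix, Module.finrank_matrix] at this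
    simpa using this
  have hfin : FiniteDimensional F A := by
    refine FiniteDimensional.of_finrank_pos (Nat.pos_of_ne_zero fun h0 => ?_)
    rw [h0] at hfr
    simp [hl] at hfr
  -- The matrix units cut V = F^l into k copies of `W`, on which `A` acts through a corner.
  -- Comparison of dimensions then makes `A` all of End(W).
  let W : Submodule F V := LinearMap.range (φ (single 0 0 1))
  have hW : ∀ w ∈ W, φ (single 0 0 1) w = w := by
    rintro _ ⟨v, rfl⟩
    rw [← Module.End.mul_apply, ← map_mul]
    simp
  let E : V ≃ₗ[F] (Fin k → W) :=
    { toFun := fun v i => ⟨φ (single 0 i 1) v, φ (single 0 i 1) v, by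
        rw [← Module.End.mul_apply, ← map_mul]; simp⟩
      map_add' := fun v w => by ext; simp
      map_smul' := fun c v => by ext; simp
      invFun := fun w => ∑ i, φ (single i 0 1) (w i)
      left_inv := fun v => by
        have h1 : ∀ i, φ (single i 0 1) (φ (single 0 i 1) v) = φ (single i i 1) v := fun i => by
          rw [← Module.End.mul_apply, ← map_mul]; simp
        simp only [h1]
        rw [← LinearMap.sum_apply, ← map_sum]
        have : ∑ i : Fin k, single i i (1 : A) = 1 := by
          ext a b
          rw [Matrix.sum_apply, Finset.sum_eq_single a]
          · simp [single_apply, Matrix.one_apply]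
          · intro c _ hc
            simp [hc]
          · simp
        rw [this, map_one, Module.End.one_apply]
      right_inv := fun w => by
        ext1 i
        ext1
        simp only [map_sum]
        rw [Finset.sum_eq_single i]
        · rw [← Module.End.mul_apply, ← map_mul]
          simpa using hW _ (w i).2
        · intro j _ hj
          rw [← Module.End.mul_apply, ← map_mul]
          simp [hj.symm]
        · simp }
  have hdim : l = k * Module.finrank F W := by
    have h1 := E.finrank_eq
    have h2 : Module.finrank F (Fin k → W) = k * Module.finrank F W := by
      rw [Module.finrank_pi_fintype]; simp
    rw [h2] at h1
    simpa [V] using h1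
  have hact : ∀ a : A, ∀ w ∈ W, φ (single 0 0 a) w ∈ W := by
    intro a w _
    refine ⟨φ (single 0 0 a) w, ?_⟩
    rw [← Module.End.mul_apply, ← map_mul]
    simp
  let ρ : A →ₐ[F] Module.End F W :=
    { toFun := fun a => (φ (single 0 0 a)).restrict (hact a)
      map_one' := by
        ext w : 2
        exact hW _ w.2
      map_mul' := fun a b => by
        ext w : 2
        change φ (single 0 0 (a * b)) w = φ (single 0 0 a) (φ (single 0 0 b) w)
        rw [← Module.End.mul_apply, ← map_mul]
        simp
      map_zero' := by
        ext w : 2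
        change φ (single 0 0 0) (w : V) = 0
        simp
      map_add' := fun a b => by
        ext w : 2
        change φ (single 0 0 (a + b)) (w : V) = φ (single 0 0 a) w + φ (single 0 0 b) w
        rw [single_add]; simp
      commutes' := fun r => by
        ext w : 2
        change φ (single 0 0 (algebraMap F A r)) (w : V) = r • w
        rw [Algebra.algebraMap_eq_smul_one, ← smul_single, map_smul, LinearMap.smul_apply, hW _ w.2] }
  have hdimA : Module.finrank F A = Module.finrank F W * Module.finrank F W := by
    rw [hdim] at hfr
    have hkk : 0 < k * k := by positivity
    apply Nat.eq_of_mul_eq_mul_left hkk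
    rw [hfr]; ring
  have hW0 : Module.finrank F W ≠ 0 := fun h0 => by simp [h0] at hdim; exact hl hdim
  have hnt : Nontrivial W := Module.nontrivial_of_finrank_pos (Nat.pos_of_ne_zero hW0)
  have hd : Module.finrank F A = Module.finrank F (Module.End F W) := by
    rw [Module.finrank_linearMap, hdimA]
  have hbij : Function.Bijective ρ :=
    AlgHom.bijective_of_finrank_eq (A := A) (B := Module.End F W) ρ hd
  exact ⟨Module.finrank F W, hW0,
    ⟨(AlgEquiv.ofBijective ρ hbij).trans (algEquivMatrix (Module.finBasis F W))⟩⟩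

theorem IsSplitAlgebra.brauerEquiv {A : Type v} [Ring A] [Algebra F A] (h : IsSplitAlgebra F A) :
    BrauerEquiv F A F :=
  let ⟨_, hn, ⟨e⟩⟩ := h
  (BrauerEquiv.of_algEquiv e).trans (brauerEquiv_matrix hn)

end split

/-- The Brauer group of `F`, on finite-dimensional central simple algebras in the universe of
`F`. -/
def Br (F : Type u) [Field F] : Type (u + 1) := Quotient (Brauer.CSA_Setoid.{u, u} F)

/-- An unbundled finite-dimensional central simple algebra, bundled. -/
def CSA.of (F : Type u) [Field F] (A : Type u) [Ring A] [Algebra F A] [Algebra.IsCentral F A]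
    [IsSimpleRing A] [FiniteDimensional F A] : CSA.{u, u} F :=
  { AlgCat.of F A with
    isCentral := ‹_›
    isSimple := ‹_›
    fin_dim := ‹_› }

namespace Br

section mk
variable (F : Type u) [Field F] (A B : Type u) [Ring A] [Algebra F A] [Algebra.IsCentral F A]
  [IsSimpleRing A] [FiniteDimensional F A] [Ring B] [Algebra F B] [Algebra.IsCentral F B]
  [IsSimpleRing B] [FiniteDimensional F B]

/-- The Brauer class of a central simple algebra. -/
def mk : Br F := Quotient.mk _ (CSA.of F A)

variable {F A B}

theorem mk_eq_iff : mk F A = mk F B ↔ BrauerEquiv F A B := Quotient.eq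

theorem mk_eq_of_algEquiv (e : A ≃ₐ[F] B) : mk F A = mk F B :=
  mk_eq_iff.2 (BrauerEquiv.of_algEquiv e)

theorem ind {P : Br F → Prop} (h : ∀ (A : Type u) [Ring A] [Algebra F A] [Algebra.IsCentral F A]
    [IsSimpleRing A] [FiniteDimensional F A], P (mk F A)) (x : Br F) : P x := by
  induction x using Quotient.ind with
  | _ A => exact h A
end mk

variable {F : Type u} [Field F]

instance : Zero (Br F) := ⟨mk F F⟩

instance : Neg (Br F) := ⟨Quotient.map (fun A => CSA.of F Aᵐᵒᵖ) fun _ _ h => BrauerEquiv.op h⟩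

instance : Add (Br F) := ⟨Quotient.map₂ (fun A B => CSA.of F (A ⊗[F] B))
  fun _ _ h _ _ h' => BrauerEquiv.tensorProduct h h'⟩

section
variable (A B : Type u) [Ring A] [Algebra F A] [Algebra.IsCentral F A]
  [IsSimpleRing A] [FiniteDimensional F A] [Ring B] [Algebra F B] [Algebra.IsCentral F B]
  [IsSimpleRing B] [FiniteDimensional F B]

theorem zero_def : (0 : Br F) = mk F F := rfl
theorem mk_add_mk : mk F A + mk F B = mk F (A ⊗[F] B) := rfl
theorem neg_mk : -mk F A = mk F Aᵐᵒᵖ := rfl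

theorem mk_end (V : Type u) [AddCommGroup V] [Module F V] [FiniteDimensional F V]
    [Nontrivial V] [IsSimpleRing (Module.End F V)] : mk F (Module.End F V) = 0 :=
  mk_eq_iff.2 (brauerEquiv_end V)
end

instance isSimpleRing_end (V : Type v) [AddCommGroup V] [Module F V] [FiniteDimensional F V]
    [Nontrivial V] : IsSimpleRing (Module.End F V) := by
  have : NeZero (Module.finrank F V) := ⟨Module.finrank_pos.ne'⟩
  exact IsSimpleRing.of_ringEquiv (algEquivMatrix (Module.finBasis F V)).symm.toRingEquiv
    inferInstance

instance : AddCommGroup (Br F) where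
  add_assoc := by
    refine ind fun A _ _ _ _ _ => ind fun B _ _ _ _ _ => ind fun C _ _ _ _ _ => ?_
    exact mk_eq_of_algEquiv (Algebra.TensorProduct.assoc F F F A B C)
  zero_add := by
    refine ind fun A _ _ _ _ _ => ?_
    exact mk_eq_of_algEquiv (Algebra.TensorProduct.lid F A)
  add_zero := by
    refine ind fun A _ _ _ _ _ => ?_
    exact mk_eq_of_algEquiv (Algebra.TensorProduct.rid F F A)
  add_comm := by
    refine ind fun A _ _ _ _ _ => ind fun B _ _ _ _ _ => ?_
    exact mk_eq_of_algEquiv (Algebra.TensorProduct.comm F A B)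
  neg_add_cancel := by
    refine ind fun A _ _ _ _ _ => ?_
    rw [neg_mk, mk_add_mk, ← mk_end A]
    exact mk_eq_of_algEquiv ((Algebra.TensorProduct.comm F _ _).trans
      (AlgEquiv.ofBijective _ (mulLeftRight_bijective F A)))
  nsmul := nsmulRec
  zsmul := zsmulRec

section
variable {A : Type u} [Ring A] [Algebra F A] [Algebra.IsCentral F A]
  [IsSimpleRing A] [FiniteDimensional F A]

theorem mk_eq_zero_iff : mk F A = 0 ↔ IsSplitAlgebra F A :=
  mk_eq_iff.trans ⟨isSplitAlgebra_of_brauerEquiv, IsSplitAlgebra.brauerEquiv⟩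

variable {M : Type u} [Ring M] [Algebra F M] [Algebra.IsCentral F M]
  [IsSimpleRing M] [FiniteDimensional F M]

instance (f : A →ₐ[F] M) : IsSimpleRing f.centralizer := f.isSimpleRing_centralizer
instance (f : A →ₐ[F] M) : Algebra.IsCentral F f.centralizer := f.isCentral_centralizer

theorem mk_add_mk_centralizer (f : A →ₐ[F] M) : mk F A + mk F f.centralizer = mk F M :=
  mk_eq_of_algEquiv f.tensorCentralizerEquiv

end

/-- Functoriality of the Brauer group: base change along `f`. -/
def mapFun {E : Type u} [Field E] (f : F →+* E) : Br F → Br E :=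
  letI := f.toAlgebra
  Quotient.map (fun A => CSA.of E (E ⊗[F] A)) fun _ _ h => BrauerEquiv.baseChange E h

section
variable {E : Type u} [Field E] [Algebra F E] (A : Type u) [Ring A] [Algebra F A]
  [Algebra.IsCentral F A] [IsSimpleRing A] [FiniteDimensional F A]

theorem mapFun_mk : mapFun (algebraMap F E) (mk F A) = mk E (E ⊗[F] A) := by
  -- The algebra structure rebuilt from `algebraMap F E` is only propositionally equal to the given
  -- one, so the class is transported along that equality.
  have key : ∀ i₁ i₂ : Algebra F E, i₁ = i₂ →
      (letI := i₁; mk E (E ⊗[F] A)) = (letI := i₂; mk E (E ⊗[F] A)) := by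
    rintro i₁ _ rfl
    rfl
  exact key (algebraMap F E).toAlgebra _ (Algebra.algebra_ext _ _ fun _ => rfl)

end

section map
variable {E : Type u} [Field E]

theorem mapFun_add (f : F →+* E) (x y : Br F) : mapFun f (x + y) = mapFun f x + mapFun f y := by
  let _ := f.toAlgebra
  induction x using ind with | _ A
  induction y using ind with | _ B
  change mapFun (algebraMap F E) _ = mapFun (algebraMap F E) _ + mapFun (algebraMap F E) _
  rw [mk_add_mk, mapFun_mk, mapFun_mk, mapFun_mk, mk_add_mk]
  let φ : (E ⊗[F] A) ⊗[E] (E ⊗[F] B) →ₐ[E] E ⊗[F] (A ⊗[F] B) :=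
    Algebra.TensorProduct.lift
      (Algebra.TensorProduct.map (AlgHom.id E E) Algebra.TensorProduct.includeLeft)
      (Algebra.TensorProduct.map (AlgHom.id E E) Algebra.TensorProduct.includeRight)
      fun x y => by
        induction x with
        | zero => simp
        | add x x' hx hx' => rw [map_add]; exact hx.add_left hx'
        | tmul c a =>
          induction y with
          | zero => simp
          | add x x' hx hx' => rw [map_add]; exact hx.add_right hx'
          | tmul d b => simp [Commute, SemiconjBy, mul_comm c d]
  exact (mk_eq_of_algEquiv (AlgEquiv.ofBijective φ (φ.bijective_of_finrank_eq
    (by simp [Module.finrank_tensorProduct])))).symm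

/-- Base change along `f`, as a homomorphism of Brauer groups. -/
def map (f : F →+* E) : Br F →+ Br E := AddMonoidHom.mk' (mapFun f) (mapFun_add f)

theorem map_mk [Algebra F E] (A : Type u) [Ring A] [Algebra F A] [Algebra.IsCentral F A]
    [IsSimpleRing A] [FiniteDimensional F A] :
    map (algebraMap F E) (mk F A) = mk E (E ⊗[F] A) := mapFun_mk A

theorem map_id (x : Br F) : map (RingHom.id F) x = x := by
  induction x using ind with | _ A
  rw [← Algebra.algebraMap_self, map_mk]
  exact mk_eq_of_algEquiv (Algebra.TensorProduct.lid F A)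

theorem map_map {L : Type u} [Field L] (g : E →+* L) (f : F →+* E) (x : Br F) :
    map g (map f x) = map (g.comp f) x := by
  let _ := f.toAlgebra
  let _ := g.toAlgebra
  let _ := (g.comp f).toAlgebra
  have : IsScalarTower F E L := IsScalarTower.of_algebraMap_eq fun _ => rfl
  induction x using ind with | _ A
  change map (algebraMap E L) (map (algebraMap F E) _) = map (algebraMap F L) _
  rw [map_mk, map_mk, map_mk]
  let φ : L ⊗[E] (E ⊗[F] A) →ₐ[L] L ⊗[F] A :=
    Algebra.TensorProduct.lift (Algebra.ofId L _)
      (Algebra.TensorProduct.lift (Algebra.ofId E _)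
        (Algebra.TensorProduct.includeRight) (fun c a => Algebra.commutes c _))
      (fun c a => Algebra.commutes c _)
  exact mk_eq_of_algEquiv (AlgEquiv.ofBijective φ (φ.bijective_of_finrank_eq (by simp)))

end map

/-- If `x` becomes the class of `D` over `K`, then `x` is represented by an algebra containing `D`
whose dimension is as small as this allows. -/
theorem exists_algHom_of_map_eq {K : Type u} [Field K] [Algebra F K] [FiniteDimensional F K]
    (D : Type u) [Ring D] [Algebra K D] [Algebra F D] [IsScalarTower F K D] [Algebra.IsCentral K D]
    [IsSimpleRing D] [FiniteDimensional K D] (x : Br F) (hx : map (algebraMap F K) x = mk K D) :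
    ∃ (B : Type u) (_ : Ring B) (_ : Algebra F B) (_ : Algebra.IsCentral F B) (_ : IsSimpleRing B)
      (_ : FiniteDimensional F B), mk F B = x ∧ Nonempty (D →ₐ[F] B) ∧
        Module.finrank F B = Module.finrank F K ^ 2 * Module.finrank K D := by
  induction x using ind with | _ A
  rw [map_mk] at hx
  have h0 : mk K ((K ⊗[F] A) ⊗[K] Dᵐᵒᵖ) = 0 := by
    rw [← mk_add_mk, ← neg_mk, hx, add_neg_cancel]
  obtain ⟨N, hN, ⟨e⟩⟩ := mk_eq_zero_iff.1 h0
  have : NeZero N := ⟨hN⟩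
  let W := Fin N → K
  let ε : (K ⊗[F] A) ⊗[K] Dᵐᵒᵖ ≃ₐ[K] Module.End K W := e.trans Matrix.toLinAlgEquiv'
  let r : Module.End K W →ₐ[F] Module.End F W :=
    { toFun := fun f => f.restrictScalars F
      map_one' := rfl
      map_mul' := fun _ _ => rfl
      map_zero' := rfl
      map_add' := fun _ _ => rfl
      commutes' := fun c => by
        refine LinearMap.ext fun v => ?_
        change algebraMap F (Module.End K W) c v = _
        rw [IsScalarTower.algebraMap_apply F K, Module.algebraMap_end_apply,
          Module.algebraMap_end_apply, algebraMap_smul] }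
  -- Over `F`, the space `W` carries commuting actions of `A` and of the opposite of `D`. The
  -- centralizer of `A` has class minus that of `A` and contains the opposite of `D`, so its own
  -- opposite is the algebra sought.
  let f : A →ₐ[F] Module.End F W :=
    r.comp ((ε.restrictScalars F).toAlgHom.comp
      ((Algebra.TensorProduct.includeLeft (R := K) (S := F)).comp Algebra.TensorProduct.includeRight))
  let g : Dᵐᵒᵖ →ₐ[F] Module.End F W :=
    r.comp ((ε.restrictScalars F).toAlgHom.comp
      ((Algebra.TensorProduct.includeRight (R := K)).restrictScalars F))
  have hfg : ∀ d, g d ∈ f.centralizer := by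
    intro d
    refine AlgHom.mem_centralizer.2 fun a => ?_
    change r (ε _) * r (ε _) = r (ε _) * r (ε _)
    rw [← map_mul, ← map_mul, ← map_mul, ← map_mul]
    simp
  have hfr : Module.finrank F W = Module.finrank F K * N := by
    rw [← Module.finrank_mul_finrank F K W]; simp [W]
  have hd : Module.finrank F A * Module.finrank K D = N * N := by
    have := ε.toLinearEquiv.finrank_eq
    rw [Module.finrank_tensorProduct, Module.finrank_baseChange, Module.finrank_linearMap,
      ← (MulOpposite.opLinearEquiv K (M := D)).finrank_eq] at this
    simpa [W] using this
  have : FiniteDimensional F W := inferInstance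
  have key : ∀ (C : Type u) [Ring C] [Algebra F C] [Algebra.IsCentral F C] [IsSimpleRing C]
      [FiniteDimensional F C], mk F A + mk F C = 0 → (Dᵐᵒᵖ →ₐ[F] C) →
      Module.finrank F A * Module.finrank F C = Module.finrank F W * Module.finrank F W →
      ∃ (B : Type u) (_ : Ring B) (_ : Algebra F B) (_ : Algebra.IsCentral F B)
        (_ : IsSimpleRing B) (_ : FiniteDimensional F B), mk F B = mk F A ∧ Nonempty (D →ₐ[F] B) ∧
        Module.finrank F B = Module.finrank F K ^ 2 * Module.finrank K D := by
    intro C _ _ _ _ _ h1 g h2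
    refine ⟨Cᵐᵒᵖ, inferInstance, inferInstance, inferInstance, inferInstance,
      inferInstance, ?_, ⟨AlgHom.opComm.symm g⟩, ?_⟩
    · rw [← neg_mk, neg_eq_iff_add_eq_zero, add_comm, h1]
    · rw [← (MulOpposite.opLinearEquiv F).finrank_eq]
      have hA : 0 < Module.finrank F A := Module.finrank_pos
      apply Nat.eq_of_mul_eq_mul_left hA
      rw [h2, hfr]
      calc _ = Module.finrank F K ^ 2 * (N * N) := by ring
        _ = _ := by rw [← hd]; ring
  refine key f.centralizer ?_ (g.codRestrict _ hfg) ?_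
  · rw [mk_add_mk_centralizer, mk_end]
  · rw [f.finrank_mul_finrank_centralizer, Module.finrank_linearMap]

end Br

end

/-! ### Symbol algebras and the calculus of symbols -/

section

section charTwo
variable {F : Type u} [Field F] [CharP F 2]

theorem charP_two_of_algebra (F : Type u) [Field F] [CharP F 2] (B : Type v) [Ring B] [Algebra F B]
    [Nontrivial B] : CharP B 2 :=
  charP_of_injective_algebraMap (algebraMap F B).injective 2

theorem add_self_of_algebra (F : Type u) [Field F] [CharP F 2] {B : Type v} [Ring B] [Algebra F B]
    (x : B) : x + x = 0 := by
  rw [← two_smul F, CharTwo.two_eq_zero, zero_smul]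

/-- The homomorphism from a symbol algebra given by elements satisfying its relations. -/
def symbolHom {B : Type v} [Ring B] [Algebra F B] {a b : F} {i j : B}
    (hi : i * i + i = algebraMap F B a) (hj : j * j = algebraMap F B b)
    (hji : j * i = (i + 1) * j) : SymbolAlgebra F a b →ₐ[F] B :=
  QuaternionAlgebra.Basis.liftHom
    { i := i
      j := j
      k := i * j
      i_mul_i := by
        rw [one_smul, ← Algebra.algebraMap_eq_smul_one, ← hi, add_assoc, add_self_of_algebra F,
          add_zero]
      j_mul_j := by rw [hj, Algebra.algebraMap_eq_smul_one]
      i_mul_j := rfl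
      j_mul_i := by
        rw [one_smul, hji, add_mul, one_mul, sub_eq_add_neg, add_comm,
          ← eq_neg_of_add_eq_zero_left (add_self_of_algebra F (i * j))] }

section
variable {B : Type v} [Ring B] [Algebra F B] {a b : F} {i j : B}
    (hi : i * i + i = algebraMap F B a) (hj : j * j = algebraMap F B b)
    (hji : j * i = (i + 1) * j)

theorem symbolHom_apply (x : SymbolAlgebra F a b) : symbolHom hi hj hji x =
    algebraMap F B x.re + x.imI • i + x.imJ • j + x.imK • (i * j) := rfl

theorem symbolHom_mem_centralizer {x : B} (h1 : i * x = x * i) (h2 : j * x = x * j) :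
    x ∈ (symbolHom hi hj hji).centralizer := by
  refine AlgHom.mem_centralizer.2 fun q => ?_
  rw [symbolHom_apply]
  simp only [add_mul, mul_add, smul_mul_assoc, mul_smul_comm, h1, h2, Algebra.commutes]
  rw [mul_assoc, h2, ← mul_assoc, h1, mul_assoc]
end

instance isCentral_symbolAlgebra (a b : F) : Algebra.IsCentral F (SymbolAlgebra F a b) := by
  refine ⟨fun z hz => ?_⟩
  rw [Subalgebra.mem_center_iff] at hz
  obtain ⟨x, y, z, w⟩ := z
  have h1 := hz ⟨0, 1, 0, 0⟩
  have h2 := hz ⟨0, 0, 1, 0⟩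
  simp [QuaternionAlgebra.ext_iff, CharTwo.neg_eq] at h1 h2
  refine Algebra.mem_bot.2 ⟨x, ?_⟩
  rw [QuaternionAlgebra.algebraMap_eq, QuaternionAlgebra.ext_iff]
  simp only [true_and]
  grind

/-- A nonzero element of an ideal can be cut down to a nonzero scalar: the commutator with i retains
the part in j and ij, multiplication by j⁻¹ moves this part to the span of 1 and i, and conjugation
by j sends i to i + 1. -/
theorem isSimpleRing_symbolAlgebra (a : F) {b : F} (hb : b ≠ 0) :
    IsSimpleRing (SymbolAlgebra F a b) := by
  refine isSimpleRing_iff_isTwoSided_imp.2 ⟨inferInstance, fun I hI => ?_⟩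
  by_cases hbot : I = ⊥
  · exact Or.inl hbot
  right
  obtain ⟨t, ht, ht0⟩ := Submodule.exists_mem_ne_zero_of_ne_bot hbot
  let i : SymbolAlgebra F a b := ⟨0, 1, 0, 0⟩
  let j : SymbolAlgebra F a b := ⟨0, 0, 1, 0⟩
  let j' : SymbolAlgebra F a b := ⟨0, 0, b⁻¹, 0⟩
  have hunit : ∀ c : F, c ≠ 0 → (⟨c, 0, 0, 0⟩ : SymbolAlgebra F a b) ∈ I → I = ⊤ := by
    intro c hc h
    rw [Ideal.eq_top_iff_one]
    have := I.mul_mem_left (⟨c⁻¹, 0, 0, 0⟩ : SymbolAlgebra F a b) h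
    simpa [hc, QuaternionAlgebra.ext_iff, ← QuaternionAlgebra.coe_one,
      QuaternionAlgebra.coe] using this
  have hlin : ∀ p q : F, p ≠ 0 ∨ q ≠ 0 → (⟨p, q, 0, 0⟩ : SymbolAlgebra F a b) ∈ I → I = ⊤ := by
    intro p q hpq h
    have h1 := I.add_mem (I.mul_mem_right j' (I.mul_mem_left j h)) h
    have h2 : j * ⟨p, q, 0, 0⟩ * j' + ⟨p, q, 0, 0⟩ = ⟨q, 0, 0, 0⟩ := by
      simp only [j, j', QuaternionAlgebra.ext_iff, QuaternionAlgebra.mk_mul_mk,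
        QuaternionAlgebra.mk_add_mk]
      grind
    rw [h2] at h1
    by_cases hq : q = 0
    · subst hq
      exact hunit p (by simpa using hpq) h
    · exact hunit q hq h1
  obtain ⟨p, q, r, s⟩ := t
  have h1 := I.add_mem (I.mul_mem_left i ht) (I.mul_mem_right i ht)
  have h2 : i * ⟨p, q, r, s⟩ + ⟨p, q, r, s⟩ * i = ⟨0, 0, r, s⟩ := by
    simp only [i, QuaternionAlgebra.ext_iff, QuaternionAlgebra.mk_mul_mk,
      QuaternionAlgebra.mk_add_mk]
    grind
  rw [h2] at h1
  by_cases hrs : r ≠ 0 ∨ s ≠ 0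
  · have h3 := I.mul_mem_right j' h1
    have h4 : (⟨0, 0, r, s⟩ * j' : SymbolAlgebra F a b) = ⟨r, s, 0, 0⟩ := by
      simp only [j', QuaternionAlgebra.ext_iff, QuaternionAlgebra.mk_mul_mk]
      grind
    rw [h4] at h3
    exact hlin r s hrs h3
  · push Not at hrs
    obtain ⟨rfl, rfl⟩ := hrs
    refine hlin p q ?_ ht
    by_contra! h
    obtain ⟨rfl, rfl⟩ := h
    exact ht0 rfl

omit [CharP F 2] in
theorem finrank_symbolAlgebra (a b : F) : Module.finrank F (SymbolAlgebra F a b) = 4 :=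
  QuaternionAlgebra.finrank_eq_four ..

end charTwo

namespace Br
variable {F : Type u} [Field F] [CharP F 2]

open scoped Classical in
/-- The Brauer class of the symbol algebra `[a, b)`; it is zero by convention if `b = 0`. -/
noncomputable def symb (a b : F) : Br F :=
  if hb : b = 0 then 0 else
    haveI := isSimpleRing_symbolAlgebra a hb
    mk F (SymbolAlgebra F a b)

theorem symb_of_ne_zero (a : F) {b : F} (hb : b ≠ 0) :
    haveI := isSimpleRing_symbolAlgebra a hb
    symb a b = mk F (SymbolAlgebra F a b) := dif_neg hb

@[simp] theorem symb_zero_right (a : F) : symb a 0 = 0 := dif_pos rfl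

section
variable {B : Type u} [Ring B] [Algebra F B] [Algebra.IsCentral F B] [IsSimpleRing B]
  [FiniteDimensional F B] {a b : F} {i j : B}
    
theorem mk_eq_symb_add (hb : b ≠ 0) (hi : i * i + i = algebraMap F B a)
    (hj : j * j = algebraMap F B b) (hji : j * i = (i + 1) * j) :
    haveI := isSimpleRing_symbolAlgebra a hb
    mk F B = symb a b + mk F (symbolHom hi hj hji).centralizer := by
  have := isSimpleRing_symbolAlgebra a hb
  rw [symb_of_ne_zero a hb, mk_add_mk_centralizer]

theorem mk_eq_symb (hB : Module.finrank F B = 4) (hb : b ≠ 0) (hi : i * i + i = algebraMap F B a)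
    (hj : j * j = algebraMap F B b) (hji : j * i = (i + 1) * j) : mk F B = symb a b := by
  have := isSimpleRing_symbolAlgebra a hb
  rw [symb_of_ne_zero a hb]
  exact (mk_eq_of_algEquiv (AlgEquiv.ofBijective (symbolHom hi hj hji)
    (AlgHom.bijective_of_finrank_eq _ (by rw [finrank_symbolAlgebra, hB])))).symm

theorem mk_eq_symb_add_symb {a' b' : F} {i' j' : B} (hB : Module.finrank F B = 16)
    (hb : b ≠ 0) (hi : i * i + i = algebraMap F B a)
    (hj : j * j = algebraMap F B b) (hji : j * i = (i + 1) * j)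
    (hb' : b' ≠ 0) (hi' : i' * i' + i' = algebraMap F B a')
    (hj' : j' * j' = algebraMap F B b') (hji' : j' * i' = (i' + 1) * j')
    (hii' : i * i' = i' * i) (hij' : i * j' = j' * i) (hji'' : j * i' = i' * j)
    (hjj' : j * j' = j' * j) : mk F B = symb a b + symb a' b' := by
  have := isSimpleRing_symbolAlgebra a hb
  rw [mk_eq_symb_add hb hi hj hji]
  congr 1
  have hfr := (symbolHom hi hj hji).finrank_mul_finrank_centralizer
  rw [finrank_symbolAlgebra, hB] at hfr
  refine mk_eq_symb (i := ⟨i', symbolHom_mem_centralizer hi hj hji hii' hji''⟩)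
    (j := ⟨j', symbolHom_mem_centralizer hi hj hji hij' hjj'⟩) (by omega) hb' ?_ ?_ ?_
  · exact Subtype.ext hi'
  · exact Subtype.ext hj'
  · exact Subtype.ext hji'

end

/-- `[a, b)` is split if `b` is a norm from the quadratic extension defined by `a`. -/
theorem symb_eq_zero_of_eq {a b p q : F} (h : b = p ^ 2 + p * q + a * q ^ 2) : symb a b = 0 := by
  by_cases hb : b = 0
  · simp [hb]
  have h0 : mk F (Matrix (Fin 2) (Fin 2) F) = 0 :=
    mk_eq_zero_iff.2 ⟨2, two_ne_zero, ⟨AlgEquiv.refl⟩⟩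
  rw [← h0]
  -- On F(i) with basis 1, i: the first matrix is multiplication by i, and the second is conjugation
  -- followed by multiplication by p + qi, whose square is the norm of p + qi.
  refine (mk_eq_symb (i := !![0, a; 1, 1]) (j := !![p, p + q * a; q, p]) ?_ hb ?_ ?_ ?_).symm
  · simp [Module.finrank_matrix]
  · rw [Matrix.algebraMap_eq_diagonal]
    ext i j
    fin_cases i <;> fin_cases j <;> simp <;> grind
  · rw [Matrix.algebraMap_eq_diagonal]
    ext i j
    fin_cases i <;> fin_cases j <;> simp <;> grind
  · rw [add_mul, one_mul]
    ext i j
    fin_cases i <;> fin_cases j <;> simp <;> grind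

theorem symb_sq_right (a b : F) : symb a (b ^ 2) = 0 :=
  symb_eq_zero_of_eq (p := b) (q := 0) (by ring)

@[simp] theorem symb_zero_left (b : F) : symb 0 b = 0 := by
  by_cases hb : b = 0
  · simp [hb]
  · exact symb_eq_zero_of_eq (p := 1) (q := b + 1) (by grind)

theorem symb_self (a : F) : symb a a = 0 :=
  symb_eq_zero_of_eq (p := 0) (q := 1) (by ring)

theorem symb_artinSchreier (u b : F) : symb (u ^ 2 + u) b = 0 :=
  -- For a = u² + u the norm form factors as (p + uq)(p + (u+1)q); these witnesses make the factors
  -- 1 and b.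
  symb_eq_zero_of_eq (p := 1 + u * (b + 1)) (q := b + 1) (by grind)

section tensor
variable (a a' : F) {b b' : F} (hb : b ≠ 0) (hb' : b' ≠ 0)
include hb hb'

/-- Identities in the tensor product of two symbol algebras. -/
theorem symb_add_symb_eq {c d c' d' : F} (hd : d ≠ 0) (hd' : d' ≠ 0)
    {i j i' j' : SymbolAlgebra F a b ⊗[F] SymbolAlgebra F a' b'}
    (hi : i * i + i = algebraMap F _ c)
    (hj : j * j = algebraMap F _ d) (hji : j * i = (i + 1) * j)
    (hi' : i' * i' + i' = algebraMap F _ c')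
    (hj' : j' * j' = algebraMap F _ d') (hji' : j' * i' = (i' + 1) * j')
    (hii' : i * i' = i' * i) (hij' : i * j' = j' * i) (hji'' : j * i' = i' * j)
    (hjj' : j * j' = j' * j) : symb a b + symb a' b' = symb c d + symb c' d' := by
  have := isSimpleRing_symbolAlgebra a hb
  have := isSimpleRing_symbolAlgebra a' hb'
  rw [symb_of_ne_zero a hb, symb_of_ne_zero a' hb', mk_add_mk]
  refine mk_eq_symb_add_symb ?_ hd hi hj hji hd' hi' hj' hji' hii' hij' hji'' hjj'
  rw [Module.finrank_tensorProduct, finrank_symbolAlgebra, finrank_symbolAlgebra]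

omit hb hb' in
theorem exists_generators (b b' : F) : ∃ i j i' j' : SymbolAlgebra F a b ⊗[F] SymbolAlgebra F a' b',
    i * i + i = algebraMap F _ a ∧ j * j = algebraMap F _ b ∧ j * i = (i + 1) * j ∧
    i' * i' + i' = algebraMap F _ a' ∧ j' * j' = algebraMap F _ b' ∧ j' * i' = (i' + 1) * j' ∧
    i * i' = i' * i ∧ i * j' = j' * i ∧ j * i' = i' * j ∧ j * j' = j' * j := by
  obtain ⟨h1, h2, h3⟩ := symbolAlgebra_relations a b
  obtain ⟨h4, h5, h6⟩ := symbolAlgebra_relations a' b'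
  rw [pow_two] at h1 h2 h4 h5
  let l : SymbolAlgebra F a b →ₐ[F] SymbolAlgebra F a b ⊗[F] SymbolAlgebra F a' b' :=
    Algebra.TensorProduct.includeLeft
  let r : SymbolAlgebra F a' b' →ₐ[F] SymbolAlgebra F a b ⊗[F] SymbolAlgebra F a' b' :=
    Algebra.TensorProduct.includeRight
  have hlr : ∀ x y, l x * r y = r y * l x := fun x y => by simp [l, r]
  refine ⟨l ⟨0, 1, 0, 0⟩, l ⟨0, 0, 1, 0⟩, r ⟨0, 1, 0, 0⟩, r ⟨0, 0, 1, 0⟩,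
    ?_, ?_, ?_, ?_, ?_, ?_, ?_, ?_, ?_, ?_⟩
  · rw [← map_mul, ← map_add, h1, AlgHom.commutes]
  · rw [← map_mul, h2, AlgHom.commutes]
  · rw [← map_mul, h3, map_mul, map_add, map_one, add_comm]
  · rw [← map_mul, ← map_add, h4, AlgHom.commutes]
  · rw [← map_mul, h5, AlgHom.commutes]
  · rw [← map_mul, h6, map_mul, map_add, map_one, add_comm]
  all_goals exact hlr _ _
end tensor

/-- In the tensor product, i + i' and j generate [a+a', b), while i' and jj' commute with them and
generate [a', b²), which is split. -/
theorem symb_add_left (a a' b : F) : symb (a + a') b = symb a b + symb a' b := by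
  by_cases hb : b = 0
  · simp [hb]
  obtain ⟨i, j, i', j', hi, hj, hji, hi', hj', hji', h1, h2, h3, h4⟩ :=
    exists_generators a a' b b
  have := charP_two_of_algebra F (SymbolAlgebra F a b ⊗[F] SymbolAlgebra F a' b)
  rw [symb_add_symb_eq a a' hb hb (c := a + a') (d := b) (c' := a') (d' := b ^ 2) hb
    (pow_ne_zero 2 hb) (i := i + i') (j := j) (i' := i') (j' := j * j'), symb_sq_right, add_zero]
  · rw [map_add]
    linear_combination (norm := grind) hi + hi' + h1
  · exact hj
  · linear_combination (norm := grind) hji + h3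
  · exact hi'
  · rw [pow_two, map_mul]
    linear_combination (norm := grind) j * h4 * j' + hj * (j' * j') + (algebraMap F _ b) * hj'
  · linear_combination (norm := grind) j * hji' + h3 * j' 
  · linear_combination (norm := grind) h1
  · linear_combination (norm := grind) hji * j' + j * h2 + j * hji' + h3 * j'
  · exact h3
  · linear_combination (norm := grind) j * h4

/-- In the tensor product, i and jj' generate [a, bb'), while i + i' and j' commute with them and
generate [0, b'), which is split. -/
theorem symb_mul_right (a : F) {b b' : F} (hb : b ≠ 0) (hb' : b' ≠ 0) :
    symb a (b * b') = symb a b + symb a b' := by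
  obtain ⟨i, j, i', j', hi, hj, hji, hi', hj', hji', h1, h2, h3, h4⟩ :=
    exists_generators a a b b'
  have := charP_two_of_algebra F (SymbolAlgebra F a b ⊗[F] SymbolAlgebra F a b')
  rw [symb_add_symb_eq a a hb hb' (c := a) (d := b * b') (c' := 0) (d' := b') (mul_ne_zero hb hb')
    hb' (i := i) (j := j * j') (i' := i + i') (j' := j'), symb_zero_left, add_zero]
  · exact hi
  · rw [map_mul]
    linear_combination (norm := grind) j * h4 * j' + hj * (j' * j') + (algebraMap F _ b) * hj'
  · linear_combination (norm := grind) hji * j' + j * h2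
  · rw [map_zero]
    linear_combination (norm := grind) hi + hi' + h1
  · exact hj'
  · linear_combination (norm := grind) hji' + h2
  · linear_combination (norm := grind) h1
  · exact h2
  · linear_combination (norm := grind) hji * j' + j * h2 + j * hji' + h3 * j'
  · linear_combination (norm := grind) h4 * j'

theorem map_symb {E : Type u} [Field E] [CharP E 2] (f : F →+* E) (a b : F) :
    map f (symb a b) = symb (f a) (f b) := by
  by_cases hb : b = 0
  · simp [hb]
  let _ := f.toAlgebra
  have := isSimpleRing_symbolAlgebra a hb
  rw [symb_of_ne_zero a hb]
  change map (algebraMap F E) _ = _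
  rw [map_mk]
  obtain ⟨h1, h2, h3⟩ := symbolAlgebra_relations a b
  rw [pow_two] at h1 h2
  have hc : ∀ c : F, algebraMap E (E ⊗[F] SymbolAlgebra F a b) (algebraMap F E c) =
      1 ⊗ₜ algebraMap F _ c := fun c => by
    rw [Algebra.TensorProduct.algebraMap_apply, Algebra.algebraMap_self_apply,
      Algebra.algebraMap_eq_smul_one, Algebra.algebraMap_eq_smul_one, TensorProduct.smul_tmul]
  refine mk_eq_symb (i := 1 ⊗ₜ ⟨0, 1, 0, 0⟩) (j := 1 ⊗ₜ ⟨0, 0, 1, 0⟩) ?_ 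
    ((map_ne_zero f).2 hb) ?_ ?_ ?_
  · rw [Module.finrank_baseChange, finrank_symbolAlgebra]
  · refine Eq.trans ?_ (hc a).symm
    rw [← h1, TensorProduct.tmul_add, Algebra.TensorProduct.tmul_mul_tmul, one_mul]
  · refine Eq.trans ?_ (hc b).symm
    rw [← h2, Algebra.TensorProduct.tmul_mul_tmul, one_mul]
  · rw [Algebra.TensorProduct.tmul_mul_tmul, h3, Algebra.TensorProduct.one_def,
      ← TensorProduct.tmul_add, Algebra.TensorProduct.tmul_mul_tmul, add_comm]

end Br

end

/-! ### Norm forms, and quaternion algebras containing a quadratic field -/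

section

section norm
variable {F : Type u} [Field F] [CharP F 2]

/-- An isotropic vector of the norm form of `[a, b)` makes `b` a norm. -/
theorem exists_eq_norm_of_isotropic {a b x y z w : F} (hb : b ≠ 0)
    (h0 : ¬(x = 0 ∧ y = 0 ∧ z = 0 ∧ w = 0))
    (h : x ^ 2 + x * y + a * y ^ 2 + b * (z ^ 2 + z * w + a * w ^ 2) = 0) :
    ∃ p q, b = p ^ 2 + p * q + a * q ^ 2 := by
  have iso : ∀ u v : F, ¬(u = 0 ∧ v = 0) → u ^ 2 + u * v + a * v ^ 2 = 0 →
      ∃ p q, b = p ^ 2 + p * q + a * q ^ 2 := by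
    intro u v huv h
    have hv : v ≠ 0 := by
      rintro rfl
      exact huv ⟨by simpa using h, rfl⟩
    -- Isotropy of the binary form gives a = t² + t with t = u/v, so the form factors and represents
    -- everything, as in `Br.symb_artinSchreier`.
    refine ⟨1 + u / v * (b + 1), b + 1, ?_⟩
    have ha : a = (u / v) ^ 2 + u / v := by
      field_simp
      grind
    rw [ha]
    grind
  by_cases hn : z ^ 2 + z * w + a * w ^ 2 = 0
  · by_cases hz : z = 0 ∧ w = 0
    · refine iso x y (fun hxy => h0 ⟨hxy.1, hxy.2, hz⟩) ?_
      rw [hn, mul_zero, add_zero] at h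
      exact h
    · exact iso z w hz hn
  -- Here b is N(X)/N(Z), the norm of X times the conjugate of Z divided by N(Z), where X = x + yi
  -- and Z = z + wi.
  · refine ⟨(x * z + x * w + a * y * w) / (z ^ 2 + z * w + a * w ^ 2),
      (y * z + x * w) / (z ^ 2 + z * w + a * w ^ 2), ?_⟩
    have : b = (x ^ 2 + x * y + a * y ^ 2) / (z ^ 2 + z * w + a * w ^ 2) := by
      rw [eq_div_iff hn]
      grind
    rw [this]
    field_simp
    grind

end norm

section quadratic
variable {F : Type u} [Field F] [CharP F 2] {B : Type v} [Ring B] [Algebra F B]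
  {s t : F} {w : B}

/-- By `hN` the span of 1 and w is a field, over which `B` has dimension 2; hence 1 and any z
outside it form a basis. -/
theorem exists_eq_quadratic_combination (hB : Module.finrank F B = 4)
    (hw : w * w = s • w + t • 1)
    (hN : ∀ c d : F, c * c + s * c * d + t * d * d = 0 → c = 0 ∧ d = 0)
    {z : B} (hz : ∀ c d : F, z ≠ c • 1 + d • w) (x : B) :
    ∃ c₀ c₁ c₂ c₃ : F, x = c₀ • 1 + c₁ • w + (c₂ • 1 + c₃ • w) * z := by
  have : Nontrivial B := Module.nontrivial_of_finrank_pos (R := F) (by omega)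
  have := charP_two_of_algebra F B
  have key : ∀ c d : F, (c • (1 : B) + d • w) * ((c + s * d) • (1 : B) + d • w) =
      (c * c + s * c * d + t * d * d) • 1 := by
    intro c d
    simp only [mul_add, add_mul, smul_mul_smul_comm, one_mul, mul_one, hw, smul_add, smul_smul]
    match_scalars <;> grind
  have key' : ∀ c d : F, c • (1 : B) + d • w = 0 → c = 0 ∧ d = 0 := by
    intro c d h
    apply hN
    have := key c d
    rw [h, zero_mul, eq_comm, smul_eq_zero] at this
    exact this.resolve_right one_ne_zero
  have hli : LinearIndependent F ![(1 : B), w, z, w * z] := by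
    rw [Fintype.linearIndependent_iff]
    intro g hg
    simp only [Fin.sum_univ_four, Matrix.cons_val] at hg
    have hg' : (g 0 • (1 : B) + g 1 • w) + (g 2 • 1 + g 3 • w) * z = 0 := by
      rw [← hg, add_mul, smul_mul_assoc, smul_mul_assoc, one_mul]; abel
    have h23 : g 2 = 0 ∧ g 3 = 0 := by
      apply hN
      by_contra hne
      set n := g 2 * g 2 + s * g 2 * g 3 + t * g 3 * g 3
      have h1 : n • z = ((g 2 + s * g 3) • (1 : B) + g 3 • w) * (g 0 • (1 : B) + g 1 • w) := by
        have hcomm : ((g 2 + s * g 3) • (1 : B) + g 3 • w) * (g 2 • (1 : B) + g 3 • w) = n • 1 := by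
          rw [← key]
          simp only [mul_add, add_mul, smul_mul_smul_comm, one_mul, mul_one]
          match_scalars <;> ring
        have h2 := congrArg (((g 2 + s * g 3) • (1 : B) + g 3 • w) * ·) hg'
        simp only [mul_add _ (g 0 • (1 : B) + g 1 • w), mul_zero, ← mul_assoc _ _ z, hcomm] at h2
        rw [smul_one_mul] at h2
        have h3 := add_self_of_algebra F (n • z)
        linear_combination (norm := grind) h2
      have h2 : z = n⁻¹ • (n • z) := by rw [smul_smul, inv_mul_cancel₀ hne, one_smul]
      rw [h1] at h2
      have h3 : ((g 2 + s * g 3) • (1 : B) + g 3 • w) * (g 0 • (1 : B) + g 1 • w) =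
          ((g 2 + s * g 3) * g 0 + g 3 * g 1 * t) • 1 +
          ((g 2 + s * g 3) * g 1 + g 3 * g 0 + g 3 * g 1 * s) • w := by
        simp only [mul_add, add_mul, smul_mul_smul_comm, one_mul, mul_one, hw, smul_add, smul_smul,
          add_smul]
        abel
      rw [h3, smul_add, smul_smul, smul_smul] at h2
      exact hz _ _ h2
    rw [h23.1, h23.2] at hg'
    simp only [zero_smul, add_zero, zero_mul] at hg'
    have h01 := key' _ _ hg'
    intro i
    fin_cases i
    exacts [h01.1, h01.2, h23.1, h23.2]
  have hx : x ∈ Submodule.span F (Set.range ![(1 : B), w, z, w * z]) := by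
    rw [hli.span_eq_top_of_card_eq_finrank (by simp [hB])]
    trivial
  obtain ⟨c, rfl⟩ := (Submodule.mem_span_range_iff_exists_fun F).1 hx
  refine ⟨c 0, c 1, c 2, c 3, ?_⟩
  simp only [Fin.sum_univ_four, Matrix.cons_val]
  rw [add_mul, smul_mul_assoc, smul_mul_assoc, one_mul]; abel

variable [Algebra.IsCentral F B]

/-- F(w) is its own centralizer: an element z outside it that commutes with w would, together with
w, generate `B`, and w would be a central scalar, against `hN`. -/
theorem exists_eq_of_commute_quadratic (hB : Module.finrank F B = 4)
    (hw : w * w = s • w + t • 1)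
    (hN : ∀ c d : F, c * c + s * c * d + t * d * d = 0 → c = 0 ∧ d = 0)
    {z : B} (hz : z * w = w * z) : ∃ c d : F, z = c • 1 + d • w := by
  by_contra! h
  have hc : w ∈ Subalgebra.center F B := by
    rw [Subalgebra.mem_center_iff]
    intro x
    obtain ⟨c₀, c₁, c₂, c₃, rfl⟩ := exists_eq_quadratic_combination hB hw hN h x
    simp only [mul_add, add_mul, smul_mul_assoc, mul_smul_comm, one_mul, mul_one, mul_assoc, hz]
  have : Nontrivial B := Module.nontrivial_of_finrank_pos (R := F) (by omega)
  obtain ⟨c, hc⟩ := Algebra.mem_bot.1 (Algebra.IsCentral.center_eq_bot F B ▸ hc)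
  rw [Algebra.algebraMap_eq_smul_one] at hc
  have h1 := hN c 1 ?_
  · exact one_ne_zero h1.2
  · rw [← hc, smul_mul_smul_comm, mul_one, smul_smul, ← add_smul] at hw
    have := smul_left_injective F (one_ne_zero (α := B)) hw
    grind

theorem exists_not_commute_of_quadratic [Nontrivial B] (hw : w * w = s • w + t • 1)
    (hN : ∀ c d : F, c * c + s * c * d + t * d * d = 0 → c = 0 ∧ d = 0) :
    ∃ x : B, x * w + w * x ≠ 0 := by
  by_contra! h
  have hc : w ∈ Subalgebra.center F B := by
    rw [Subalgebra.mem_center_iff]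
    intro x
    have h1 := h x
    have h2 := add_self_of_algebra F (w * x)
    exact add_right_cancel (h1.trans h2.symm)
  obtain ⟨c, hc⟩ := Algebra.mem_bot.1 (Algebra.IsCentral.center_eq_bot F B ▸ hc)
  rw [Algebra.algebraMap_eq_smul_one] at hc
  have h1 := hN c 1 ?_
  · exact one_ne_zero h1.2
  · rw [← hc, smul_mul_smul_comm, mul_one, smul_smul, ← add_smul] at hw
    have := smul_left_injective F (one_ne_zero (α := B)) hw
    grind

end quadratic

section
variable {F : Type u} [Field F] [CharP F 2]

theorem artinSchreier_norm {a : F} (ha : ∀ t : F, t * t + t ≠ a) (c d : F)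
    (h : c * c + 1 * c * d + a * d * d = 0) : c = 0 ∧ d = 0 := by
  have hd : d = 0 := by
    by_contra hd
    refine ha (c / d) ?_
    field_simp
    grind
  subst hd
  simpa using h

theorem inseparable_norm {b : F} (hb : ¬IsSquare b) (c d : F)
    (h : c * c + 0 * c * d + b * d * d = 0) : c = 0 ∧ d = 0 := by
  have hd : d = 0 := by
    by_contra hd
    refine hb ⟨c / d, ?_⟩
    field_simp
    grind
  subst hd
  simpa using h

end

namespace Br
variable {F : Type u} [Field F] [CharP F 2]

theorem _root_.star_mul_symbolAlgebra {a b : F} (z : SymbolAlgebra F a b) :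
    star z * z = algebraMap F _ (z.re ^ 2 + z.re * z.imI + a * z.imI ^ 2 +
      b * (z.imJ ^ 2 + z.imJ * z.imK + a * z.imK ^ 2)) := by
  obtain ⟨x, y, s, t⟩ := z
  rw [QuaternionAlgebra.algebraMap_eq]
  simp only [QuaternionAlgebra.star_mk, QuaternionAlgebra.mk_mul_mk, QuaternionAlgebra.ext_iff]
  grind

/-- The split algebra contains a nonzero element of square zero. Its reduced norm must vanish, so
the norm form is isotropic. -/
theorem exists_eq_norm_of_symb_eq_zero {a b : F} (hb : b ≠ 0) (h : symb a b = 0) :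
    ∃ p q, b = p ^ 2 + p * q + a * q ^ 2 := by
  have := isSimpleRing_symbolAlgebra a hb
  rw [symb_of_ne_zero a hb, mk_eq_zero_iff] at h
  obtain ⟨n, hn, ⟨e⟩⟩ := h
  have hn2 : n = 2 := by
    have := e.toLinearEquiv.finrank_eq
    rw [finrank_symbolAlgebra, Module.finrank_matrix] at this
    simp at this
    nlinarith
  subst hn2
  obtain ⟨z, hz⟩ := e.surjective !![0, 1; 0, 0]
  have hz0 : z ≠ 0 := by
    rintro rfl
    rw [map_zero] at hz
    have := congrFun₂ hz 0 1
    simp at this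
  have hzz : z * z = 0 := by
    apply e.injective
    rw [map_mul, hz, map_zero]
    ext i j
    fin_cases i <;> fin_cases j <;> simp
  refine exists_eq_norm_of_isotropic (x := z.re) (y := z.imI) (z := z.imJ) (w := z.imK) hb ?_ ?_
  · rintro ⟨h1, h2, h3, h4⟩
    exact hz0 (QuaternionAlgebra.ext h1 h2 h3 h4)
  · have h2 : star z * z * z = 0 := by rw [mul_assoc, hzz, mul_zero]
    rw [star_mul_symbolAlgebra, ← Algebra.smul_def, smul_eq_zero] at h2
    exact h2.resolve_right hz0

/-- The norm equation for b is solved for a instead: q is nonzero because b is not a square, and one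
divides by q². In this form the vanishing of a symbol rewrites its left slot. -/
theorem exists_eq_of_symb_eq_zero {a b : F} (hb : ¬IsSquare b) (h : symb a b = 0) :
    ∃ u v, a = u ^ 2 + u + b * v ^ 2 := by
  have hb0 : b ≠ 0 := by rintro rfl; exact hb (IsSquare.zero)
  obtain ⟨p, q, hpq⟩ := exists_eq_norm_of_symb_eq_zero hb0 h
  have hq : q ≠ 0 := by
    rintro rfl
    exact hb ⟨p, by simpa [pow_two] using hpq⟩
  refine ⟨p / q, 1 / q, ?_⟩
  field_simp
  grind

section
variable {B : Type u} [Ring B] [Algebra F B] [Algebra.IsCentral F B] [IsSimpleRing B]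

/-- A central simple algebra of degree `2` containing a separable quadratic extension. -/
theorem exists_mk_eq_symb_of_artinSchreier [FiniteDimensional F B] (hB : Module.finrank F B = 4)
    {a : F} (ha : ∀ t : F, t * t + t ≠ a) {w : B} (hw : w * w + w = algebraMap F B a) :
    ∃ g : F, g ≠ 0 ∧ mk F B = symb a g := by
  have := charP_two_of_algebra F B
  have hN := artinSchreier_norm ha
  have hw' : w * w = (1 : F) • w + a • 1 := by
    rw [one_smul, ← Algebra.algebraMap_eq_smul_one]
    linear_combination (norm := grind) hw
  obtain ⟨x, hx⟩ := exists_not_commute_of_quadratic hw' hN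
  -- This commutator conjugates w to w + 1. Its square commutes with w, so lies in F(w), and
  -- commutes with j, so is a scalar.
  obtain ⟨j, hj⟩ : ∃ j, j = x * w + w * x := ⟨_, rfl⟩
  rw [← hj] at hx
  have hcom := Algebra.commutes (R := F) a x
  have hjw : j * w = (w + 1) * j := by
    rw [hj]
    linear_combination (norm := grind) x * hw + hw * x + hcom
  have hjz : ∀ c d : F, j ≠ c • 1 + d • w := by
    intro c d h
    refine hx ?_
    have : j * w = w * j := by
      rw [h, add_mul, mul_add]
      simp
    linear_combination (norm := grind) this + hjw
  have hjj : j * j * w = w * (j * j) := by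
    linear_combination (norm := grind) j * hjw + hjw * j
  obtain ⟨c, d, hcd⟩ := exists_eq_of_commute_quadratic hB hw' hN hjj
  have hd : d = 0 := by
    have h1 : j * (j * j) = (j * j) * j := (mul_assoc _ _ _).symm
    rw [hcd, add_mul, mul_add, smul_one_mul, mul_smul_one, add_right_inj, smul_mul_assoc,
      mul_smul_comm, ← sub_eq_zero, ← smul_sub, smul_eq_zero] at h1
    refine h1.resolve_right fun h => hx ?_
    linear_combination (norm := grind) hjw + h
  subst hd
  rw [zero_smul, add_zero, ← Algebra.algebraMap_eq_smul_one] at hcd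
  -- If j² = 0, then jBj = 0, because B is F(w) + F(w)j. The annihilator {x | jBx = 0} is then a
  -- two-sided ideal which contains j but not 1.
  have hc : c ≠ 0 := by
    rintro rfl
    rw [map_zero] at hcd
    have hjBj : ∀ y, j * y * j = 0 := by
      intro y
      obtain ⟨c₀, c₁, c₂, c₃, rfl⟩ := exists_eq_quadratic_combination hB hw' hN hjz y
      have hjwj : j * w * j = 0 := by rw [hjw, mul_assoc, hcd, mul_zero]
      simp only [mul_add, add_mul, smul_mul_assoc, mul_smul_comm, one_mul, mul_one, hjwj, hcd,
        smul_zero, add_zero, ← mul_assoc]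
    let I : TwoSidedIdeal B := TwoSidedIdeal.mk' {x | ∀ y, j * y * x = 0} (by simp)
      (fun h1 h2 y => by rw [mul_add, h1, h2, add_zero])
      (fun h y => by rw [mul_neg, h, neg_zero])
      (fun {x y} h z => by rw [← mul_assoc, mul_assoc j, h])
      (fun {x y} h z => by rw [← mul_assoc, h, zero_mul])
    have hjI : j ∈ I := by
      rw [TwoSidedIdeal.mem_mk']
      exact hjBj
    have h1 : I = ⊤ := (eq_bot_or_eq_top I).resolve_left fun h => hx (by
      rw [h] at hjI; exact (TwoSidedIdeal.mem_bot _).1 hjI)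
    have h2 : (1 : B) ∈ I := h1 ▸ trivial
    rw [TwoSidedIdeal.mem_mk'] at h2
    exact hx (by simpa using h2 1)
  exact ⟨c, hc, mk_eq_symb hB hc hw hcd hjw⟩

/-- A central simple algebra of degree `2` containing an inseparable quadratic extension. -/
theorem exists_mk_eq_symb_of_sq [FiniteDimensional F B] (hB : Module.finrank F B = 4)
    {b : F} (hb : ¬IsSquare b) {w : B} (hw : w * w = algebraMap F B b) :
    ∃ a : F, mk F B = symb a b := by
  have := charP_two_of_algebra F B
  have hN := inseparable_norm hb
  have hw' : w * w = (0 : F) • w + b • 1 := by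
    rw [zero_smul, zero_add, hw, Algebra.algebraMap_eq_smul_one]
  have hb0 : b ≠ 0 := by rintro rfl; exact hb IsSquare.zero
  obtain ⟨x, hx⟩ := exists_not_commute_of_quadratic hw' hN
  have hcom := Algebra.commutes (R := F) b x
  have hyw : (x * w + w * x) * w = w * (x * w + w * x) := by
    linear_combination (norm := grind) x * hw + hw * x + hcom
  obtain ⟨c, d, hcd⟩ := exists_eq_of_commute_quadratic hB hw' hN hyw
  have hn : c * c + b * d * d ≠ 0 := fun h => hx (by
    obtain ⟨rfl, rfl⟩ := hN c d (by linear_combination h)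
    rw [hcd, zero_smul, zero_smul, zero_add])
  set n := c * c + b * d * d
  obtain ⟨y, hy⟩ : ∃ y : B, y = n⁻¹ • (c • 1 + d • w) := ⟨_, rfl⟩
  have hyw' : y * w = w * y := by simp [hy, mul_add, add_mul]
  have hyd : y * (x * w + w * x) = 1 := by
    have : (c • 1 + d • w) * (c • 1 + d • w) = n • (1 : B) := by
      simp only [mul_add, add_mul, smul_mul_smul_comm, one_mul, mul_one, hw]
      rw [Algebra.algebraMap_eq_smul_one]
      match_scalars <;> grind
    rw [hcd, hy, smul_mul_assoc, this, smul_smul, inv_mul_cancel₀ hn, one_smul]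
  -- Here y is the inverse of xw + wx, which commutes with w, so wi + iw = wy(wx + xw) = w. Then i²
  -- + i commutes with w and with i, hence is a scalar.
  obtain ⟨i, hi⟩ : ∃ i, i = w * y * x := ⟨_, rfl⟩
  have hwi : w * i = (i + 1) * w := by
    rw [hi]
    linear_combination (norm := grind) w * hyd + w * hyw' * x
  have hc : (i * i + i) * w = w * (i * i + i) := by
    linear_combination (norm := grind) i * hwi + hwi * i
  obtain ⟨a, e, hae⟩ := exists_eq_of_commute_quadratic hB hw' hN hc
  have he : e = 0 := by
    have h1 : i * (i * i + i) = (i * i + i) * i := by noncomm_ring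
    rw [hae, add_mul, mul_add, smul_one_mul, mul_smul_one, add_right_inj, smul_mul_assoc,
      mul_smul_comm, ← sub_eq_zero, ← smul_sub, smul_eq_zero] at h1
    refine h1.resolve_right fun h => hb0 ?_
    have h2 : w = 0 := by linear_combination (norm := grind) hwi + h
    rw [h2, mul_zero, eq_comm] at hw
    exact (map_eq_zero _).1 hw
  subst he
  rw [zero_smul, add_zero, ← Algebra.algebraMap_eq_smul_one] at hae
  exact ⟨a, mk_eq_symb hB hb0 hae hw hwi⟩
end

section
variable {E : Type u} [Field E] [Algebra F E]

omit [CharP F 2] in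
theorem exists_algHom_of_map_eq_zero (h2 : Module.finrank F E = 2) {x : Br F}
    (hx : map (algebraMap F E) x = 0) :
    ∃ (B : Type u) (_ : Ring B) (_ : Algebra F B) (_ : Algebra.IsCentral F B) (_ : IsSimpleRing B)
      (_ : FiniteDimensional F B), mk F B = x ∧ Nonempty (E →ₐ[F] B) ∧
        Module.finrank F B = 4 := by
  have : FiniteDimensional F E := Module.finite_of_finrank_pos (by omega)
  obtain ⟨B, i1, i2, i3, i4, i5, h, h', h''⟩ := exists_algHom_of_map_eq E x hx
  rw [h2, Module.finrank_self] at h''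
  exact ⟨B, i1, i2, i3, i4, i5, h, h', h''⟩

/-- A class split by a separable quadratic extension is a symbol. -/
theorem exists_eq_symb_of_map_artinSchreier_eq_zero (h2 : Module.finrank F E = 2) {a : F} {α : E}
    (hα : α * α + α = algebraMap F E a) (ha : ∀ t : F, t * t + t ≠ a) {x : Br F}
    (hx : map (algebraMap F E) x = 0) : ∃ g : F, g ≠ 0 ∧ x = symb a g := by
  obtain ⟨B, i1, i2, i3, i4, i5, rfl, ⟨f⟩, h4⟩ := exists_algHom_of_map_eq_zero h2 hx
  exact exists_mk_eq_symb_of_artinSchreier h4 ha (w := f α)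
    (by rw [← map_mul, ← map_add, hα, f.commutes])

/-- A class split by an inseparable quadratic extension is a symbol. -/
theorem exists_eq_symb_of_map_sq_eq_zero (h2 : Module.finrank F E = 2) {b : F} {w : E}
    (hw : w * w = algebraMap F E b) (hb : ¬IsSquare b) {x : Br F}
    (hx : map (algebraMap F E) x = 0) : ∃ a : F, x = symb a b := by
  obtain ⟨B, i1, i2, i3, i4, i5, rfl, ⟨f⟩, h4⟩ := exists_algHom_of_map_eq_zero h2 hx
  exact exists_mk_eq_symb_of_sq h4 hb (w := f w)
    (by rw [← map_mul, hw, f.commutes])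
end

theorem add_self_symb (a b : F) : symb a b + symb a b = 0 := by
  rw [← symb_add_left, CharTwo.add_self_eq_zero, symb_zero_left]

theorem symb_sq_left (a b : F) : symb (a ^ 2) b = symb a b := by
  have h := symb_artinSchreier a b
  rw [symb_add_left] at h
  exact add_right_cancel (h.trans (add_self_symb a b).symm)

/-- The symbol `[x y, y)` is symmetric in `x` and `y`. -/
theorem symb_mul_comm (x y : F) : symb (x * y) y = symb (x * y) x := by
  by_cases hy : y = 0
  · simp [hy]
  by_cases hx : x = 0
  · simp [hx]
  have h := symb_self (x * y)
  rw [symb_mul_right _ hx hy] at h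
  exact add_left_cancel (h.trans (add_self_symb _ _).symm)

/-- [xy, y) behaves like the differential form x dy, and this is d(y+z) = dy + dz. After exchanging
the roles of the factors by `symb_mul_comm`, it is additivity in the left slot. -/
theorem symb_mul_add (x y z : F) :
    symb (x * (y + z)) (y + z) = symb (x * y) y + symb (x * z) z := by
  rw [symb_mul_comm, symb_mul_comm x y, symb_mul_comm x z, mul_add, symb_add_left]

end Br

end

/-! ### The Goldman element, and the vanishing of Frobenius on 2-torsion -/

section

section symmetric
variable {F : Type u} [Field F] {V : Type v} [AddCommGroup V] [Module F V]

/-- Symmetric tensors are sums of squares and of symmetrized tensors. -/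
theorem TensorProduct.symmetric_induction [FiniteDimensional F V] {p : V ⊗[F] V → Prop}
    (add : ∀ s t, p s → p t → p (s + t)) (sq : ∀ (c : F) (a : V), p (c • (a ⊗ₜ a)))
    (symm : ∀ s, p (s + TensorProduct.comm F V V s)) (t : V ⊗[F] V)
    (ht : TensorProduct.comm F V V t = t) : p t := by
  let b := Module.finBasis F V
  let c := (b.tensorProduct b).repr t
  have hc : ∀ i j, c (i, j) = c (j, i) := by
    intro i j
    have h1 : ∀ s : V ⊗[F] V, (b.tensorProduct b).repr (TensorProduct.comm F V V s) (i, j) =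
        (b.tensorProduct b).repr s (j, i) := by
      intro s
      induction s with
      | zero => simp
      | tmul x y => simp [mul_comm]
      | add x y hx hy => simp only [map_add, Finsupp.add_apply, hx, hy]
    have := h1 t
    rwa [ht] at this
  have ht' : t = ∑ i, ∑ j, c (i, j) • (b i ⊗ₜ[F] b j) := by
    conv_lhs => rw [← (b.tensorProduct b).sum_repr t, Fintype.sum_prod_type]
    simp [c]
  let s := ∑ i, ∑ j, if i < j then c (i, j) • (b i ⊗ₜ[F] b j) else 0
  have hs : TensorProduct.comm F V V s =
      ∑ i, ∑ j, if j < i then c (i, j) • (b i ⊗ₜ[F] b j) else 0 := by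
    simp only [s, map_sum, apply_ite (TensorProduct.comm F V V), map_smul,
      TensorProduct.comm_tmul, map_zero]
    rw [Finset.sum_comm]
    simp only [hc]
  have hd : t = (∑ i, c (i, i) • (b i ⊗ₜ[F] b i)) + (s + TensorProduct.comm F V V s) := by
    rw [hs, ht', ← Finset.sum_add_distrib, ← Finset.sum_add_distrib]
    refine Finset.sum_congr rfl fun i _ => ?_
    have hi : c (i, i) • (b i ⊗ₜ[F] b i) =
        ∑ j, if i = j then c (i, j) • (b i ⊗ₜ[F] b j) else 0 := by simp
    rw [← Finset.sum_add_distrib, hi, ← Finset.sum_add_distrib]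
    refine Finset.sum_congr rfl fun j _ => ?_
    rcases lt_trichotomy i j with h | h | h
    · simp [h, h.ne, h.not_gt]
    · simp [h]
    · simp [h, h.ne', h.not_gt]
  rw [hd]
  refine add _ _ ?_ (symm s)
  have h0 : p 0 := by simpa using sq 0 0
  exact Finset.sum_induction _ p add h0 fun i _ => sq _ _

end symmetric

section goldman
variable {F : Type u} [Field F] {B : Type v} [Ring B] [Algebra F B]

/-- The map `a ⊗ b ↦ (z ↦ a z b)`. -/
noncomputable def sandwich (F : Type u) [Field F] (B : Type v) [Ring B] [Algebra F B] :
    B ⊗[F] B →ₗ[F] B →ₗ[F] B :=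
  TensorProduct.lift (LinearMap.mk₂ F (fun a b => LinearMap.mulLeft F a ∘ₗ LinearMap.mulRight F b)
    (fun a a' b => by ext; simp [add_mul]) (fun c a b => by ext; simp)
    (fun a b b' => by ext; simp [mul_add]) (fun c a b => by ext; simp))

@[simp] theorem sandwich_tmul (a b z : B) : sandwich F B (a ⊗ₜ b) z = a * z * b := by
  simp [sandwich, mul_assoc]

theorem sandwich_mul_tmul (t : B ⊗[F] B) (x y z : B) :
    sandwich F B (t * x ⊗ₜ y) z = sandwich F B t (x * z) * y := by
  induction t with
  | zero => simp
  | tmul a b => simp [mul_assoc]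
  | add s t hs ht => simp only [add_mul, map_add, LinearMap.add_apply, hs, ht]

theorem sandwich_tmul_mul (t : B ⊗[F] B) (x y z : B) :
    sandwich F B (x ⊗ₜ y * t) z = x * sandwich F B t (z * y) := by
  induction t with
  | zero => simp
  | tmul a b => simp [mul_assoc]
  | add s t hs ht => simp only [mul_add, map_add, LinearMap.add_apply, hs, ht]

variable [Algebra.IsCentral F B]

/-- An element g that implements the swap defines a trace: the intertwining relation makes its
sandwich map take central values and vanish on commutators. -/
theorem exists_functional_of_swap {g : B ⊗[F] B} [Nontrivial B]
    (hg : ∀ x y : B, g * x ⊗ₜ y = y ⊗ₜ x * g) : ∃ T : B →ₗ[F] F,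
      (∀ z, sandwich F B g z = algebraMap F B (T z)) ∧ ∀ x y, T (x * y) = T (y * x) := by
  obtain ⟨l, hl⟩ := (Algebra.linearMap F B).exists_leftInverse_of_injective
    (LinearMap.ker_eq_bot.2 (algebraMap F B).injective)
  have h1 : ∀ x y z, sandwich F B g (x * z) * y = y * sandwich F B g (z * x) := fun x y z => by
    rw [← sandwich_mul_tmul, hg, sandwich_tmul_mul]
  refine ⟨l ∘ₗ sandwich F B g, fun z => ?_, fun x y => ?_⟩
  · have hc : sandwich F B g z ∈ Subalgebra.center F B := by
      rw [Subalgebra.mem_center_iff]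
      intro y
      have := h1 1 y z
      rw [one_mul, mul_one] at this
      exact this.symm
    obtain ⟨c, hc⟩ := Algebra.mem_bot.1 (Algebra.IsCentral.center_eq_bot F B ▸ hc)
    rw [LinearMap.comp_apply, ← hc]
    congr 1
    exact (LinearMap.congr_fun hl c).symm
  · have := h1 x 1 y
    rw [mul_one, one_mul] at this
    simp only [LinearMap.comp_apply, this]

variable [CharP F 2] [FiniteDimensional F B]

/-- This makes it possible to rescale g to have square 1. The trace `T` attached to g satisfies
T(x²) = μT(x)², as traces do up to normalization in characteristic 2; evaluating this on the
symmetric tensor g gives μ²λ = 1. -/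
theorem exists_goldman_of_sq {g : B ⊗[F] B} [Nontrivial B] {lam : F} (hlam : lam ≠ 0)
    (hg : ∀ x y : B, g * x ⊗ₜ y = y ⊗ₜ x * g) (hgg : g * g = lam • 1)
    (hcomm : TensorProduct.comm F B B g = g) : ∃ μ : F, μ * μ * lam = 1 := by
  have := charP_two_of_algebra F B
  obtain ⟨T, hT, hTc⟩ := exists_functional_of_swap hg
  let con : B → B ⊗[F] B →ₗ[F] B := fun u => TensorProduct.lift (LinearMap.mk₂ F
    (fun a b => T (u * b) • a) (by simp) (by intros; rw [smul_comm])
    (by intros; rw [mul_add, map_add, add_smul])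
    (by intros; rw [mul_smul_comm, map_smul, smul_assoc]))
  have hcon : ∀ u a b, con u (a ⊗ₜ b) = T (u * b) • a := fun u a b => rfl
  have hcon1 : ∀ u t, sandwich F B (t * g) u = con u t := by
    intro u t
    induction t with
    | zero => simp
    | tmul a b => rw [sandwich_tmul_mul, hT, hcon, ← Algebra.commutes, Algebra.smul_def]
    | add s t hs ht => simp only [add_mul, map_add, LinearMap.add_apply, hs, ht]
  have hcong : ∀ u, con u g = lam • u := fun u => by
    rw [← hcon1, hgg, Algebra.TensorProduct.one_def, map_smul, LinearMap.smul_apply]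
    simp
  have hnd : ∀ u, (∀ b, T (u * b) = 0) → u = 0 := by
    intro u hu
    have h0 : con u = 0 := by
      ext a b
      change T (u * b) • a = 0
      rw [hu, zero_smul]
    have := hcong u
    rw [h0, LinearMap.zero_apply, eq_comm, smul_eq_zero] at this
    exact this.resolve_left hlam
  obtain ⟨x₀, hx₀⟩ : ∃ x, T x = 1 := by
    by_contra! h
    refine one_ne_zero (hnd 1 fun b => ?_)
    by_contra hb
    exact h ((T (1 * b))⁻¹ • (1 * b)) (by rw [map_smul, smul_eq_mul, inv_mul_cancel₀ hb])
  -- `T` is nondegenerate, so its kernel is the span of the commutators. It also vanishes on squares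
  -- of elements of that span, so T(x²) depends only on T(x).
  let C : Submodule F B := Submodule.span F {z | ∃ x y, z = x * y + y * x}
  have hsurj : ∀ f : B →ₗ[F] F, ∃ u, ∀ x, f x = T (u * x) := by
    let Φ : B →ₗ[F] Module.Dual F B := LinearMap.mk₂ F (fun u x => T (u * x))
      (by intros; rw [add_mul, map_add]) (by intros; rw [smul_mul_assoc, map_smul])
      (by intros; rw [mul_add, map_add]) (by intros; rw [mul_smul_comm, map_smul])
    have hinj : Function.Injective Φ := by
      rw [← LinearMap.ker_eq_bot, LinearMap.ker_eq_bot']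
      intro u hu
      exact hnd u fun b => LinearMap.congr_fun hu b
    have hs := (LinearMap.injective_iff_surjective_of_finrank_eq_finrank
      (Subspace.dual_finrank_eq (K := F) (V := B)).symm).1 hinj
    intro f
    obtain ⟨u, hu⟩ := hs f
    exact ⟨u, fun x => (LinearMap.congr_fun hu x).symm⟩
  have hker : ∀ x, T x = 0 → x ∈ C := by
    intro x hx
    by_contra hxC
    obtain ⟨f, hfx, hfC⟩ := Submodule.exists_le_ker_of_notMem hxC
    obtain ⟨u, hu⟩ := hsurj f
    have huc : u ∈ Subalgebra.center F B := by
      rw [Subalgebra.mem_center_iff]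
      intro y
      rw [← sub_eq_zero]
      refine hnd _ fun z => ?_
      have h1 := hfC (Submodule.subset_span ⟨y, z, rfl⟩)
      rw [LinearMap.mem_ker, hu, mul_add, map_add, hTc u (z * y), CharTwo.add_eq_zero] at h1
      rw [sub_mul, map_sub, mul_assoc u, h1, hTc (y * u), mul_assoc, sub_self]
    obtain ⟨c, rfl⟩ := Algebra.mem_bot.1 (Algebra.IsCentral.center_eq_bot F B ▸ huc)
    rw [hu, ← Algebra.smul_def, map_smul, hx, smul_zero] at hfx
    exact hfx rfl
  have hCsq : ∀ x ∈ C, T (x * x) = 0 := by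
    intro x hx
    induction hx using Submodule.span_induction with
    | zero => simp
    | mem z hz =>
      obtain ⟨x, y, rfl⟩ := hz
      have h1 : T (x * y * (x * y)) = T (y * x * (y * x)) := by
        rw [mul_assoc, hTc]; simp only [mul_assoc]
      have h2 : T (x * y * (y * x)) = T (y * x * (x * y)) := by
        rw [hTc]
      simp only [mul_add, add_mul, map_add, h1, h2]
      grind
    | add x y _ _ hx hy =>
      have := hTc x y
      simp only [mul_add, add_mul, map_add, hx, hy]
      grind
    | smul c x _ hx => simp [hx]
  obtain ⟨μ, hμ⟩ : ∃ μ, μ = T (x₀ * x₀) := ⟨_, rfl⟩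
  have hsq : ∀ x, T (x * x) = μ * T x * T x := by
    intro x
    obtain ⟨y, hy⟩ : ∃ y, y = x - T x • x₀ := ⟨_, rfl⟩
    have hyC : T y = 0 := by rw [hy, map_sub, map_smul, hx₀, smul_eq_mul, mul_one, sub_self]
    have hyy := hCsq y (hker y hyC)
    have hx : x = T x • x₀ + y := by rw [hy]; abel
    have h1 := hTc x₀ y
    conv_lhs => rw [hx]
    simp only [mul_add, add_mul, map_add, hyy, smul_mul_assoc, mul_smul_comm, map_smul, h1, ← hμ,
      smul_eq_mul]
    grind
  refine ⟨μ, ?_⟩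
  -- `P` and μ`R` agree on tensors a ⊗ a by `hsq`, and both vanish on symmetrized tensors, so they
  -- agree on g. Their values there are 1 and μ·λμ.
  let P : B ⊗[F] B →ₗ[F] F := T ∘ₗ LinearMap.mulRight F x₀ ∘ₗ (sandwich F B).flip x₀
  let R : B ⊗[F] B →ₗ[F] F := T ∘ₗ LinearMap.mulRight F x₀ ∘ₗ con x₀
  have hP : ∀ a b, P (a ⊗ₜ b) = T (a * x₀ * b * x₀) := fun a b => by simp [P]
  have hR : ∀ a b, R (a ⊗ₜ b) = T (b * x₀) * T (a * x₀) := fun a b => by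
    simp [R, hcon, hTc x₀]
  have hPc : ∀ s, P (TensorProduct.comm F B B s) = P s := by
    intro s
    induction s with
    | zero => simp
    | tmul a b => rw [TensorProduct.comm_tmul, hP, hP, mul_assoc, hTc, ← mul_assoc]
    | add s t hs ht => simp only [map_add, hs, ht]
  have hRc : ∀ s, R (TensorProduct.comm F B B s) = R s := by
    intro s
    induction s with
    | zero => simp
    | tmul a b => rw [TensorProduct.comm_tmul, hR, hR, mul_comm]
    | add s t hs ht => simp only [map_add, hs, ht]
  have key : P g = μ * R g := by
    refine TensorProduct.symmetric_induction (p := fun t => P t = μ * R t) ?_ ?_ ?_ g hcomm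
    · intro s t hs ht
      rw [map_add, map_add, hs, ht, mul_add]
    · intro c a
      rw [map_smul, map_smul, hP, hR, mul_assoc, hsq, smul_eq_mul, smul_eq_mul]
      ring
    · intro s
      rw [map_add, map_add, hPc, hRc, CharTwo.add_self_eq_zero, CharTwo.add_self_eq_zero, mul_zero]
  have h1 : P g = 1 := by
    simp [P, hT, hx₀]
  have h2 : R g = lam * μ := by
    simp [R, hcong, hμ]
  rw [h1, h2] at key
  rw [key]; ring

end goldman

section homology
variable {F : Type u} [Field F] {V : Type v} [AddCommGroup V] [Module F V] (ν : Module.End F V)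

/-- The homology of an endomorphism of square zero. -/
abbrev Homology : Type v := LinearMap.ker ν ⧸ (LinearMap.range ν).comap (LinearMap.ker ν).subtype

namespace Homology

theorem mem_ker_of_commute {f : Module.End F V} (hf : f * ν = ν * f) (v : V)
    (hv : v ∈ LinearMap.ker ν) : f v ∈ LinearMap.ker ν := by
  rw [LinearMap.mem_ker] at hv ⊢
  rw [← Module.End.mul_apply, ← hf, Module.End.mul_apply, hv, map_zero]

/-- The action of an endomorphism commuting with `ν` on the homology of `ν`. -/
def map {f : Module.End F V} (hf : f * ν = ν * f) : Module.End F (Homology ν) :=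
  Submodule.mapQ _ _ (f.restrict (mem_ker_of_commute ν hf)) (by
    rintro ⟨_, hv⟩ ⟨w, rfl⟩
    exact ⟨f w, (LinearMap.congr_fun hf w).symm⟩)

theorem map_mk {f : Module.End F V} (hf : f * ν = ν * f) (v : LinearMap.ker ν) :
    map ν hf (Submodule.Quotient.mk v) =
      Submodule.Quotient.mk ⟨f v, mem_ker_of_commute ν hf v v.2⟩ := rfl

variable {ν}

theorem end_ext {φ ψ : Module.End F (Homology ν)}
    (h : ∀ v : LinearMap.ker ν, φ (Submodule.Quotient.mk v) = ψ (Submodule.Quotient.mk v)) :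
    φ = ψ := by
  refine LinearMap.ext fun x => ?_
  obtain ⟨v, rfl⟩ := Submodule.Quotient.mk_surjective _ x
  exact h v

variable {f f' : Module.End F V} (hf : f * ν = ν * f) (hf' : f' * ν = ν * f')

theorem map_add (h : (f + f') * ν = ν * (f + f')) : map ν h = map ν hf + map ν hf' :=
  end_ext fun _ => rfl

theorem map_mul (h : (f * f') * ν = ν * (f * f')) : map ν h = map ν hf * map ν hf' :=
  end_ext fun _ => rfl

theorem map_smul (c : F) (h : (c • f) * ν = ν * (c • f)) : map ν h = c • map ν hf :=
  end_ext fun _ => rfl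

theorem map_one (h : 1 * ν = ν * 1) : map ν h = 1 :=
  end_ext fun _ => rfl

theorem map_eq_zero (h : ∀ v ∈ LinearMap.ker ν, f v ∈ LinearMap.range ν) : map ν hf = 0 :=
  end_ext fun v => by
    rw [map_mk, LinearMap.zero_apply, Submodule.Quotient.mk_eq_zero]
    exact h v v.2

/-- Linear splittings of the kernel in `V` and of the homology in the kernel give a lift that is
annihilated by ν on both sides, so in particular commutes with it. -/
theorem map_surjective (hν : ∀ v, ν (ν v) = 0) (φ : Module.End F (Homology ν)) :
    ∃ (f : Module.End F V) (hf : f * ν = ν * f), map ν hf = φ := by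
  obtain ⟨p, hp⟩ := (LinearMap.ker ν).subtype.exists_leftInverse_of_injective
    (Submodule.ker_subtype _)
  let N := (LinearMap.range ν).comap (LinearMap.ker ν).subtype
  obtain ⟨σ, hσ⟩ := N.mkQ.exists_rightInverse_of_surjective (Submodule.range_mkQ N)
  let f : Module.End F V := (LinearMap.ker ν).subtype ∘ₗ σ ∘ₗ φ ∘ₗ N.mkQ ∘ₗ p
  have hp' : ∀ v : LinearMap.ker ν, p v = v := fun v => LinearMap.congr_fun hp v
  have h1 : f * ν = 0 := by
    ext v
    have h2 : p (ν v) = ⟨ν v, hν v⟩ := hp' ⟨ν v, hν v⟩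
    have h3 : N.mkQ ⟨ν v, hν v⟩ = 0 := (Submodule.Quotient.mk_eq_zero N).2 ⟨v, rfl⟩
    simp only [f, Module.End.mul_apply, LinearMap.comp_apply, h2, h3, _root_.map_zero,
      LinearMap.zero_apply]
  have h2 : ν * f = 0 := by
    ext v
    exact (σ (φ (N.mkQ (p v)))).2
  refine ⟨f, h1.trans h2.symm, end_ext fun v => ?_⟩
  rw [map_mk]
  have h3 : (⟨f v, mem_ker_of_commute ν (h1.trans h2.symm) v v.2⟩ : LinearMap.ker ν) =
      σ (φ (N.mkQ v)) := by
    ext1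
    change ((σ (φ (N.mkQ (p v))) : LinearMap.ker ν) : V) = _
    rw [hp']
  rw [h3]
  exact LinearMap.congr_fun hσ _

end Homology
end homology

section frobenius
variable {F : Type u} [Field F] [CharP F 2] {B : Type u} [Ring B] [Algebra F B]
  [Algebra.IsCentral F B] [IsSimpleRing B] [FiniteDimensional F B]

/-- The Goldman element of an algebra whose square is split. -/
theorem exists_goldman {V : Type v} [AddCommGroup V] [Module F V] [FiniteDimensional F V]
    (e : (B ⊗[F] B) ≃ₐ[F] Module.End F V) : ∃ g : B ⊗[F] B, g * g = 1 ∧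
      ∀ t, g * t = TensorProduct.comm F B B t * g := by
  let σ : (B ⊗[F] B) ≃ₐ[F] B ⊗[F] B := Algebra.TensorProduct.comm F B B
  have hσ : ∀ t, σ (σ t) = t := by
    intro t
    exact (Algebra.TensorProduct.comm F B B).symm_apply_apply t
  -- Skolem–Noether: transported to End(V), the swap is conjugation by some `T`, and g is the
  -- preimage of `T`. Its square is central, and is a scalar that can be normalized to 1.
  obtain ⟨T, hT⟩ := AlgEquiv.eq_linearEquivConjAlgEquiv ((e.symm.trans σ).trans e)
  let G : Module.End F V := T.toLinearMap
  let G' : Module.End F V := T.symm.toLinearMap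
  have hG1 : G * G' = 1 := by ext; simp [G, G']
  have hG2 : G' * G = 1 := by ext; simp [G, G']
  have hG : ∀ t, e (σ t) = G * e t * G' := by
    intro t
    have := congrArg (fun f => f (e t)) hT
    simp only [AlgEquiv.trans_apply, AlgEquiv.symm_apply_apply] at this
    rw [this]
    rfl
  obtain ⟨g, hg⟩ := e.surjective G
  obtain ⟨g', hg'⟩ := e.surjective G'
  have h1 : g * g' = 1 := e.injective (by rw [map_mul, hg, hg', hG1, map_one])
  have h2 : g' * g = 1 := e.injective (by rw [map_mul, hg, hg', hG2, map_one])
  have h3 : ∀ t, g * t = σ t * g := by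
    intro t
    have : σ t = g * t * g' := e.injective (by rw [hG, map_mul, map_mul, hg, hg'])
    rw [this, mul_assoc, h2, mul_one]
  have hgc : σ g = g := by
    have := h3 g
    have h4 := congrArg (· * g') this
    simpa only [mul_assoc, h1, mul_one] using h4.symm
  have hc : g * g ∈ Subalgebra.center F (B ⊗[F] B) := by
    rw [Subalgebra.mem_center_iff]
    intro t
    rw [mul_assoc g g t, h3 t, ← mul_assoc g, h3 (σ t), hσ, mul_assoc]
  obtain ⟨lam, hlam⟩ := Algebra.mem_bot.1 (Algebra.IsCentral.center_eq_bot F (B ⊗[F] B) ▸ hc)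
  have hl0 : lam ≠ 0 := by
    rintro rfl
    rw [map_zero] at hlam
    have h5 : g' * (g' * (g * g)) = 1 := by
      rw [← mul_assoc g' g, h2, one_mul, h2]
    rw [← hlam, mul_zero, mul_zero] at h5
    exact zero_ne_one h5
  obtain ⟨μ, hμ⟩ := exists_goldman_of_sq hl0 (fun x y => h3 _)
    (by rw [← Algebra.algebraMap_eq_smul_one, hlam]) hgc
  refine ⟨μ • g, ?_, fun t => ?_⟩
  · rw [smul_mul_smul_comm, ← hlam, Algebra.algebraMap_eq_smul_one, smul_smul, hμ, one_smul]
  · rw [smul_mul_assoc, mul_smul_comm, h3]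
    rfl



omit [CharP F 2] in
/-- A class is killed by a field homomorphism if the algebra has a suitable semilinear
representation. -/
theorem Br.map_mk_eq_zero {E : Type u} [Field E] (f : F →+* E) {H : Type u} [AddCommGroup H]
    [Module E H] [FiniteDimensional E H] [Nontrivial H] (ψ : B →+* Module.End E H)
    (hψ : ∀ (c : F) (a : B), ψ (algebraMap F B c * a) = f c • ψ a)
    (hspan : ∀ φ, φ ∈ Submodule.span E (Set.range ψ)) : Br.map f (Br.mk F B) = 0 := by
  let _ := f.toAlgebra
  let _ : Algebra F (Module.End E H) := ((algebraMap E (Module.End E H)).comp f).toAlgebra'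
    fun c φ => Algebra.commutes (f c) φ
  have : IsScalarTower F E (Module.End E H) := IsScalarTower.of_algebraMap_eq fun _ => rfl
  let ψ' : B →ₐ[F] Module.End E H :=
    { ψ with
      commutes' := fun c => by
        have := hψ c 1
        rw [mul_one, map_one, ← Algebra.algebraMap_eq_smul_one] at this
        exact this }
  let Ψ : E ⊗[F] B →ₐ[E] Module.End E H :=
    Algebra.TensorProduct.lift (Algebra.ofId E _) ψ' fun c b => Algebra.commutes c (ψ' b)
  have hΨ : ∀ b, Ψ (1 ⊗ₜ b) = ψ b := fun b => by
    refine (Algebra.TensorProduct.lift_tmul _ ψ' _ (1 : E) b).trans ?_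
    rw [map_one, one_mul]
    rfl
  have hsurj : Function.Surjective Ψ := by
    intro φ
    have : Submodule.span E (Set.range ψ) ≤ LinearMap.range Ψ.toLinearMap := by
      rw [Submodule.span_le]
      rintro _ ⟨b, rfl⟩
      exact ⟨1 ⊗ₜ b, hΨ b⟩
    exact this (hspan φ)
  have hinj : Function.Injective Ψ := Ψ.toRingHom.injective
  change Br.map (algebraMap F E) _ = 0
  rw [Br.map_mk, Br.mk_eq_of_algEquiv (AlgEquiv.ofBijective Ψ ⟨hinj, hsurj⟩), Br.mk_end]

/-- The Frobenius endomorphism annihilates the `2`-torsion of the Brauer group. -/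
theorem Br.map_frobenius_eq_zero {x : Br F} (hx : x + x = 0) : Br.map (frobenius F 2) x = 0 := by
  induction x using Br.ind with | h B => ?_
  rw [Br.mk_add_mk, Br.mk_eq_zero_iff] at hx
  obtain ⟨n, hn, ⟨e₀⟩⟩ := hx
  let V := Fin n → F
  let e : (B ⊗[F] B) ≃ₐ[F] Module.End F V := e₀.trans Matrix.toLinAlgEquiv'
  have : Nontrivial V := by
    have : Nonempty (Fin n) := ⟨⟨0, Nat.pos_of_ne_zero hn⟩⟩
    infer_instance
  have hadd : ∀ v : V, v + v = 0 := fun v => by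
    rw [← two_smul F, CharTwo.two_eq_zero, zero_smul]
  obtain ⟨g, hgg, hg⟩ := exists_goldman e
  -- Since g² = 1, ν² = 0. The tensors fixed by the swap are those commuting with g; they act on the
  -- homology of ν, where symmetrized tensors act as zero. Hence a ↦ a ⊗ a becomes additive there
  -- and is a Frobenius-semilinear representation of `B`.
  let ν : Module.End F V := 1 + e g
  have hν : ∀ v, ν v = v + e g v := fun v => rfl
  have hegg : ∀ v, e g (e g v) = v := fun v => by
    rw [← Module.End.mul_apply, ← map_mul, hgg, map_one, Module.End.one_apply]
  have hνν : ∀ v, ν (ν v) = 0 := fun v => by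
    rw [hν, hν, map_add, hegg, add_comm (e g v) v, hadd]
  have hker : ∀ v, v ∈ LinearMap.ker ν ↔ e g v = v := fun v => by
    rw [LinearMap.mem_ker, hν]
    constructor
    · intro h
      exact add_left_cancel (h.trans (hadd v).symm)
    · intro h
      rw [h, hadd]
  let σ := TensorProduct.comm F B B
  have hσσ : ∀ t, σ (σ t) = t := fun t => (TensorProduct.comm F B B).symm_apply_apply t
  have hσ : ∀ t, σ t = g * t * g := fun t => by rw [hg, mul_assoc, hgg, mul_one]
  have hmem : ∀ {t}, σ t = t → e t * ν = ν * e t := by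
    intro t ht
    simp only [ν, mul_add, add_mul, mul_one, one_mul, ← map_mul, hg]
    rw [show TensorProduct.comm F B B t = t from ht]
  have hmem' : ∀ {t}, e t * ν = ν * e t → σ t = t := by
    intro t ht
    simp only [ν, mul_add, add_mul, mul_one, one_mul, ← map_mul, add_right_inj] at ht
    rw [hσ, ← e.injective ht, mul_assoc, hgg, mul_one]
  let A : ∀ t, σ t = t → Module.End F (Homology ν) := fun t ht => Homology.map ν (hmem ht)
  have hAadd : ∀ s t hs ht hst, A (s + t) hst = A s hs + A t ht := by
    intro s t hs ht hst
    simp only [A, _root_.map_add]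
    exact Homology.map_add (hmem hs) (hmem ht) _
  have hAmul : ∀ s t hs ht hst, A (s * t) hst = A s hs * A t ht := by
    intro s t hs ht hst
    simp only [A, _root_.map_mul]
    exact Homology.map_mul (hmem hs) (hmem ht) _
  have hAsmul : ∀ (c : F) s hs hst, A (c • s) hst = c • A s hs := by
    intro c s hs hst
    simp only [A, _root_.map_smul]
    exact Homology.map_smul (hmem hs) c _
  have hAsymm : ∀ s hs, A (s + σ s) hs = 0 := by
    intro s hs
    refine Homology.map_eq_zero _ fun v hv => ⟨e s v, ?_⟩
    rw [hν, map_add, hσ, map_mul, map_mul]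
    change _ = e s v + e g (e s (e g v))
    rw [(hker v).1 hv]
  have hAone : ∀ h, A 1 h = 1 := by
    intro h
    simp only [A, _root_.map_one]
    exact Homology.map_one _
  have hsq : ∀ a : B, σ (a ⊗ₜ a) = a ⊗ₜ a := fun a => TensorProduct.comm_tmul ..
  let ψ₀ : B →* Module.End F (Homology ν) :=
    { toFun := fun a => A (a ⊗ₜ a) (hsq a)
      map_one' := hAone (hsq 1)
      map_mul' := fun a b => by
        have : (a * b) ⊗ₜ[F] (a * b) = a ⊗ₜ[F] a * b ⊗ₜ[F] b := by simp
        simp only [this]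
        exact hAmul _ _ (hsq a) (hsq b) (by rw [← this, hsq]) }
  let ψ : B →+* Module.End F (Homology ν) := RingHom.mk' ψ₀ fun a b => by
    have h1 : (a + b) ⊗ₜ[F] (a + b) = (a ⊗ₜ[F] a + b ⊗ₜ[F] b) + (a ⊗ₜ b + σ (a ⊗ₜ b)) := by
      simp only [TensorProduct.add_tmul, TensorProduct.tmul_add, σ, TensorProduct.comm_tmul]
      abel
    have h2 : σ (a ⊗ₜ[F] a + b ⊗ₜ[F] b) = a ⊗ₜ[F] a + b ⊗ₜ[F] b := by
      rw [map_add, hsq, hsq]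
    have h3 : σ (a ⊗ₜ[F] b + σ (a ⊗ₜ[F] b)) = a ⊗ₜ b + σ (a ⊗ₜ b) := by
      rw [map_add, hσσ, add_comm]
    change A _ (hsq (a + b)) = A _ (hsq a) + A _ (hsq b)
    simp only [h1]
    rw [hAadd _ _ h2 h3 (by rw [map_add, h2, h3]), hAsymm _ h3, add_zero,
      hAadd _ _ (hsq a) (hsq b) h2]
  have hψ : ∀ a, ψ a = A (a ⊗ₜ a) (hsq a) := fun a => rfl
  -- If the homology vanished, a contraction would give s with s + σ(s) = 1. But l ⊗ l takes the
  -- same value at s and σ(s), and takes the value 1 at 1 when l(1) = 1.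
  have hnt : Nontrivial (Homology ν) := by
    by_contra hnt
    rw [not_nontrivial_iff_subsingleton, Submodule.Quotient.subsingleton_iff] at hnt
    have hle : ∀ v, ν v = 0 → v ∈ LinearMap.range ν := fun v hv => by
      have : (⟨v, hv⟩ : LinearMap.ker ν) ∈
        (LinearMap.range ν).comap (LinearMap.ker ν).subtype := hnt ▸ trivial
      exact this
    let ν' : V →ₗ[F] LinearMap.ker ν := ν.codRestrict _ hνν
    obtain ⟨r, hr⟩ := ν'.exists_rightInverse_of_surjective (LinearMap.range_eq_top.2 fun v => by
      obtain ⟨w, hw⟩ := hle v v.2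
      exact ⟨w, Subtype.ext hw⟩)
    have hr' : ∀ v : LinearMap.ker ν, ν (r v) = v := fun v =>
      congrArg Subtype.val (LinearMap.congr_fun hr v)
    have hrν : ∀ v, ν (r (ν' v)) = ν v := fun v => hr' _
    let q : V →ₗ[F] LinearMap.ker ν :=
      (LinearMap.id + (LinearMap.ker ν).subtype ∘ₗ ν' + r ∘ₗ ν').codRestrict _ fun v => by
        rw [LinearMap.mem_ker]
        change ν (v + ν v + r (ν' v)) = 0
        rw [map_add, map_add, hνν, hrν, add_zero, hadd]
    have hq : ∀ v, (q v : V) = v + ν v + r (ν' v) := fun v => rfl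
    have hqν : ∀ v, q (ν v) = ν' v := fun v => by
      ext1
      rw [hq, hνν, show ν' (ν v) = 0 from Subtype.ext (hνν v), map_zero, add_zero, add_zero]
      rfl
    obtain ⟨s, hs⟩ := e.surjective (r ∘ₗ q)
    have hs' : ∀ v, e s v = r (q v) := fun v => LinearMap.congr_fun hs v
    have h1 : s + σ s = 1 := by
      apply e.injective
      refine LinearMap.ext fun v => ?_
      have hgv : ∀ v, e g v = v + ν v := fun v => by rw [hν, ← add_assoc, hadd, zero_add]
      rw [map_add, hσ, map_mul, map_mul, map_one]
      change e s v + e g (e s (e g v)) = v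
      rw [hgv v, hgv, map_add (e s), hs', hs', hqν, map_add ν, hr', hrν, hq]
      have a1 := hadd (r (q v))
      have a2 := hadd (r (ν' v))
      have a3 := hadd (ν v)
      linear_combination (norm := module) a1 + a2 + a3
    obtain ⟨l, hl⟩ := Module.Projective.exists_dual_eq_one F (one_ne_zero (α := B))
    let L : B ⊗[F] B →ₗ[F] F := LinearMap.mul' F F ∘ₗ TensorProduct.map l l
    have hL : ∀ s, L (σ s) = L s := by
      intro s
      induction s with
      | zero => simp
      | tmul a b => simp [L, σ, mul_comm]
      | add s t hs ht => simp only [map_add, hs, ht]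
    have h2 := congrArg L h1
    rw [map_add, hL, CharTwo.add_self_eq_zero, Algebra.TensorProduct.one_def] at h2
    simp [L, hl] at h2
  refine Br.map_mk_eq_zero (frobenius F 2) ψ (fun c a => ?_) fun φ => ?_
  · have h1 : (algebraMap F B c * a) ⊗ₜ[F] (algebraMap F B c * a) = (frobenius F 2 c) • (a ⊗ₜ[F] a) := by
      rw [← Algebra.smul_def, TensorProduct.smul_tmul_smul, frobenius_def, pow_two]
    rw [hψ, hψ]
    simp only [h1]
    exact hAsmul _ _ (hsq a) (by rw [map_smul, hsq])
  -- A lift commuting with ν is a symmetric tensor, and modulo symmetrized tensors these are spanned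
  -- by the a ⊗ a.
  · obtain ⟨f, hf, rfl⟩ := Homology.map_surjective hνν φ
    obtain ⟨t, rfl⟩ := e.surjective f
    have key : ∃ ht, A t ht ∈ Submodule.span F (Set.range ψ) := by
      refine TensorProduct.symmetric_induction
        (p := fun t => ∃ ht, A t ht ∈ Submodule.span F (Set.range ψ)) ?_ ?_ ?_ t (hmem' hf)
      · rintro s t ⟨hs, hs'⟩ ⟨ht, ht'⟩
        have hst : σ (s + t) = s + t := by rw [map_add, hs, ht]
        refine ⟨hst, ?_⟩
        rw [hAadd s t hs ht hst]
        exact add_mem hs' ht'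
      · intro c a
        have hst : σ (c • a ⊗ₜ[F] a) = c • a ⊗ₜ[F] a := by rw [map_smul, hsq]
        refine ⟨hst, ?_⟩
        rw [hAsmul c _ (hsq a) hst]
        exact Submodule.smul_mem _ _ (Submodule.subset_span ⟨a, rfl⟩)
      · intro s
        have hst : σ (s + σ s) = s + σ s := by rw [map_add, hσσ, add_comm]
        refine ⟨hst, ?_⟩
        rw [hAsymm s hst]
        exact zero_mem _
    exact key.2
end frobenius

end

/-! ### Involutions of the second kind -/

section

section involution
variable {F : Type u} [Field F] [CharP F 2] {B : Type u} [Ring B] [Algebra F B]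
  [Algebra.IsCentral F B] [IsSimpleRing B] [FiniteDimensional F B]
  {V : Type v} [AddCommGroup V] [Module F V] [FiniteDimensional F V]
  {D : Type w} [Ring D] [Algebra F D]

omit [CharP F 2] [Algebra.IsCentral F B] [FiniteDimensional F B] in
-- A functional separating x from the span, tensored with the identity. It serves to show that
-- tensors such as w ⊗ 1 + 1 ⊗ w are nonzero.
theorem exists_dual_of_notMem_span {s : Set B} {x : B} (hx : x ∉ Submodule.span F s) :
    ∃ l : B ⊗[F] B →ₗ[F] B, (∀ y ∈ s, ∀ z, l (y ⊗ₜ z) = 0) ∧ l (x ⊗ₜ 1) ≠ 0 := by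
  obtain ⟨l, hlx, hl⟩ := Submodule.exists_le_ker_of_notMem hx
  have : Nontrivial B := inferInstance
  refine ⟨TensorProduct.lid F B ∘ₗ TensorProduct.map l LinearMap.id, fun y hy z => ?_, ?_⟩
  · have := LinearMap.mem_ker.1 (hl (Submodule.subset_span hy))
    simp [this]
  · simpa using hlx

omit [Algebra.IsCentral F B] in
/-- A central simple algebra `B` with `B ⊗ B` split that contains a division algebra `D` of half
its dimension, whose center contains a separable quadratic extension: every suitable symmetric
vector determines an involution of `D`. -/
theorem exists_involution_of_vector (Φ : (B ⊗[F] B) ≃ₐ[F] Module.End F V)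
    (hD : ∀ y : D, y ≠ 0 → ∃ y', y' * y = 1)
    (hdim : Module.finrank F B = 2 * Module.finrank F D)
    (f : D →ₐ[F] B) {w : D} {a : F} (hw : w * w + w = algebraMap F D a)
    (hwc : ∀ y, w * y = y * w) (hw1 : f w ∉ Submodule.span F {1}) {g : B ⊗[F] B}
    (hg : ∀ t, g * t = TensorProduct.comm F B B t * g) {v : V} (hv : v ≠ 0)
    (hgv : Φ g v = v) (hev : Φ (f w ⊗ₜ 1 + 1 ⊗ₜ f w) v = v) :
    ∃ τ : D → D, (∀ y, Φ (1 ⊗ₜ f y) v = Φ (f (τ y) ⊗ₜ 1) v) ∧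
      (∀ x y, Φ (f x ⊗ₜ 1) v = Φ (f y ⊗ₜ 1) v → x = y) ∧ (∀ y, τ (τ y) = y) := by
  have := charP_two_of_algebra F (B ⊗[F] B)
  have hinj : ∀ v, v ≠ 0 → ∀ y, Φ (f y ⊗ₜ 1) v = 0 → y = 0 := by
    intro v hv y hy
    by_contra hy0
    obtain ⟨y', hy'⟩ := hD y hy0
    refine hv ?_
    have h1 : Φ (f y' ⊗ₜ 1) (Φ (f y ⊗ₜ 1) v) = v := by
      rw [← Module.End.mul_apply, ← map_mul, Algebra.TensorProduct.tmul_mul_tmul, ← map_mul, hy',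
        map_one, one_mul, ← Algebra.TensorProduct.one_def, map_one, Module.End.one_apply]
    rw [← h1, hy, map_zero]
  let L : V → D →ₗ[F] V := fun v =>
    { toFun := fun y => Φ (f y ⊗ₜ 1) v
      map_add' := fun x y => by
        rw [map_add, TensorProduct.add_tmul, map_add, LinearMap.add_apply]
      map_smul' := fun c y => by
        rw [map_smul, ← TensorProduct.smul_tmul', map_smul]; rfl }
  have hLinj : ∀ v, v ≠ 0 → Function.Injective (L v) := fun v hv => by
    rw [← LinearMap.ker_eq_bot, LinearMap.ker_eq_bot']
    exact hinj v hv
  -- The idempotent e commutes with `D` on both sides. Its image and its kernel contain Dv and Dv'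
  -- with v, v' nonzero, each of dimension dim D, and dim V = 2 dim D. So the image is exactly Dv;
  -- it contains (1 ⊗ y)v, which defines τ(y). Since g fixes v and exchanges the sides, τ has order
  -- dividing 2.
  obtain ⟨e, he⟩ : ∃ e : B ⊗[F] B, e = f w ⊗ₜ 1 + 1 ⊗ₜ f w := ⟨_, rfl⟩
  have hwf : f w * f w + f w = algebraMap F B a := by rw [← map_mul, ← map_add, hw, f.commutes]
  have hee : e * e = e := by
    have h1 : (f w * f w + f w) ⊗ₜ[F] (1 : B) = 1 ⊗ₜ (f w * f w + f w) := by
      rw [hwf, Algebra.algebraMap_eq_smul_one, TensorProduct.smul_tmul]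
    rw [he]
    simp only [add_mul, mul_add, Algebra.TensorProduct.tmul_mul_tmul, one_mul, mul_one]
    rw [TensorProduct.add_tmul, TensorProduct.tmul_add] at h1
    linear_combination (norm := grind) h1
  have hcomm : ∀ y, f w * f y = f y * f w := fun y => by rw [← map_mul, hwc, map_mul]
  have hel : ∀ y, e * (f y ⊗ₜ 1) = (f y ⊗ₜ 1) * e := fun y => by
    rw [he]
    simp only [add_mul, mul_add, Algebra.TensorProduct.tmul_mul_tmul, one_mul, mul_one, hcomm]
  have her : ∀ y, e * (1 ⊗ₜ f y) = (1 ⊗ₜ f y) * e := fun y => by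
    rw [he]
    simp only [add_mul, mul_add, Algebra.TensorProduct.tmul_mul_tmul, one_mul, mul_one, hcomm]
  obtain ⟨l, hl1, hlw⟩ := exists_dual_of_notMem_span hw1
  have hle : l e ≠ 0 := by
    rw [he, map_add, hl1 1 rfl, add_zero]
    exact hlw
  have hl1' : l 1 = 0 := hl1 1 rfl 1
  have hΦe : ∀ v, Φ e (Φ e v) = Φ e v := fun v => by
    rw [← Module.End.mul_apply, ← map_mul, hee]
  obtain ⟨v', hv', hv'0⟩ : ∃ v', Φ e v' = 0 ∧ v' ≠ 0 := by
    have h1 : Φ (1 + e) ≠ 0 := by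
      rw [Ne, EmbeddingLike.map_eq_zero_iff]
      intro h
      rw [add_eq_zero_iff_eq_neg] at h
      rw [← neg_eq_iff_eq_neg] at h
      rw [← h, map_neg, hl1', neg_zero] at hle
      exact hle rfl
    obtain ⟨x, hx⟩ : ∃ x, Φ (1 + e) x ≠ 0 := by
      by_contra! h
      exact h1 (LinearMap.ext h)
    refine ⟨_, ?_, hx⟩
    rw [← Module.End.mul_apply, ← map_mul, mul_add, hee, mul_one, CharTwo.add_self_eq_zero,
      map_zero, LinearMap.zero_apply]
  have hmem : ∀ v, Φ e v = v → v ∈ LinearMap.range (Φ e) := fun v hv => ⟨v, hv⟩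
  have hLe : ∀ v y, Φ e (L v y) = L (Φ e v) y := fun v y => by
    change Φ e (Φ _ v) = Φ _ (Φ e v)
    rw [← Module.End.mul_apply, ← map_mul, hel, map_mul, Module.End.mul_apply]
  rw [← he] at hev
  have hr1 : LinearMap.range (L v) ≤ LinearMap.range (Φ e) := by
    rintro _ ⟨y, rfl⟩
    exact ⟨L v y, by rw [hLe, hev]⟩
  have hr2 : LinearMap.range (L v') ≤ LinearMap.ker (Φ e) := by
    rintro _ ⟨y, rfl⟩
    rw [LinearMap.mem_ker, hLe, hv']
    change Φ _ 0 = 0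
    exact map_zero _
  have hdV : Module.finrank F V = 2 * Module.finrank F D := by
    have h1 := Φ.toLinearEquiv.finrank_eq
    rw [Module.finrank_tensorProduct, Module.finrank_linearMap] at h1
    rw [← hdim]
    exact (Nat.mul_self_inj.1 h1).symm
  have hrange : LinearMap.range (L v) = LinearMap.range (Φ e) := by
    refine Submodule.eq_of_le_of_finrank_le hr1 ?_
    have h1 := LinearMap.finrank_range_add_finrank_ker (Φ e)
    have h2 := Submodule.finrank_mono hr2
    rw [LinearMap.finrank_range_of_inj (hLinj v' hv'0)] at h2
    rw [LinearMap.finrank_range_of_inj (hLinj v hv)]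
    omega
  have hτ : ∀ y, ∃ y', Φ (1 ⊗ₜ f y) v = Φ (f y' ⊗ₜ 1) v := by
    intro y
    have h1 : Φ (1 ⊗ₜ f y) v ∈ LinearMap.range (Φ e) := by
      refine hmem _ ?_
      rw [← Module.End.mul_apply, ← map_mul, her, map_mul, Module.End.mul_apply, hev]
    rw [← hrange] at h1
    obtain ⟨y', hy'⟩ := h1
    exact ⟨y', hy'.symm⟩
  choose τ hτ using hτ
  have huniq : ∀ x y, Φ (f x ⊗ₜ 1) v = Φ (f y ⊗ₜ 1) v → x = y := fun x y h => hLinj v hv h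
  refine ⟨τ, hτ, huniq, fun y => huniq _ _ ?_⟩
  have hswap : ∀ s t : B, Φ g (Φ (s ⊗ₜ t) v) = Φ (t ⊗ₜ s) v := fun s t => by
    rw [← Module.End.mul_apply, ← map_mul, hg, TensorProduct.comm_tmul, map_mul,
      Module.End.mul_apply, hgv]
  rw [← hτ, ← hswap, ← hτ, hswap]

omit [Algebra.IsCentral F B] [IsSimpleRing B] [FiniteDimensional F B] [FiniteDimensional F V] in
-- The operators g and E commute, so the image of E is stable under g. If Ex is not fixed by g, then
-- Ex + gEx is fixed, and it is nonzero in characteristic 2.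
theorem exists_symmetric_vector (Φ : (B ⊗[F] B) ≃ₐ[F] Module.End F V) {g E : B ⊗[F] B}
    (hgg : g * g = 1) (hg : ∀ t, g * t = TensorProduct.comm F B B t * g) (hE0 : E ≠ 0)
    (hE : TensorProduct.comm F B B E = E) : ∃ v, Φ E v ≠ 0 ∧ Φ g (Φ E v) = Φ E v := by
  obtain ⟨x, hx⟩ : ∃ x, Φ E x ≠ 0 := by
    by_contra! h
    exact hE0 ((map_eq_zero_iff Φ Φ.injective).1 (LinearMap.ext h))
  have hgE : ∀ v, Φ g (Φ E v) = Φ E (Φ g v) := fun v => by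
    rw [← Module.End.mul_apply, ← map_mul, hg, hE, map_mul, Module.End.mul_apply]
  have hgg' : ∀ v, Φ g (Φ g v) = v := fun v => by
    rw [← Module.End.mul_apply, ← map_mul, hgg, map_one, Module.End.one_apply]
  by_cases h : Φ g (Φ E x) = Φ E x
  · exact ⟨x, hx, h⟩
  · refine ⟨x + Φ g x, fun h0 => h ?_, ?_⟩
    · rw [map_add, ← hgE] at h0
      have h2 : Φ E x + Φ E x = 0 := by rw [← two_smul F, CharTwo.two_eq_zero, zero_smul]
      exact add_left_cancel (h0.trans h2.symm)
    · rw [hgE, map_add, hgg', add_comm]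

/-- Existence of an involution of the second kind. -/
theorem exists_involution (hBB : Br.mk F B + Br.mk F B = 0)
    (hD : ∀ y : D, y ≠ 0 → ∃ y', y' * y = 1)
    (hdim : Module.finrank F B = 2 * Module.finrank F D)
    (f : D →ₐ[F] B) {w i : D} {a : F} (hw : w * w + w = algebraMap F D a)
    (hwc : ∀ y, w * y = y * w) (hw1 : f w ∉ Submodule.span F {1})
    (hwi : f (w * i) ∉ Submodule.span F {1, f w, f i}) :
    ∃ τ : D → D, (∀ x y, τ (x + y) = τ x + τ y) ∧ (∀ x y, τ (x * y) = τ y * τ x) ∧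
      (∀ c, τ (algebraMap F D c) = algebraMap F D c) ∧ (∀ y, τ (τ y) = y) ∧
      τ w = w + 1 ∧ ((∃ r, i * i + i = algebraMap F D r) → τ i = i + 1) := by
  have := charP_two_of_algebra F (B ⊗[F] B)
  rw [Br.mk_add_mk, Br.mk_eq_zero_iff] at hBB
  obtain ⟨n, hn, ⟨e₀⟩⟩ := hBB
  let V := Fin n → F
  let Φ : (B ⊗[F] B) ≃ₐ[F] Module.End F V := e₀.trans Matrix.toLinAlgEquiv'
  obtain ⟨g, hgg, hg⟩ := exists_goldman Φ
  let δ : D → B ⊗[F] B := fun y => f y ⊗ₜ 1 + 1 ⊗ₜ f y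
  have hδ : ∀ y, (∃ r, y * y + y = algebraMap F D r) → δ y * δ y = δ y := by
    rintro y ⟨r, hr⟩
    have h1 : (f y * f y + f y) ⊗ₜ[F] (1 : B) = 1 ⊗ₜ (f y * f y + f y) := by
      rw [← map_mul, ← map_add, hr, f.commutes, Algebra.algebraMap_eq_smul_one,
        TensorProduct.smul_tmul]
    simp only [δ, add_mul, mul_add, Algebra.TensorProduct.tmul_mul_tmul, one_mul, mul_one]
    rw [TensorProduct.add_tmul, TensorProduct.tmul_add] at h1
    linear_combination (norm := grind) h1
  have hδc : ∀ y, TensorProduct.comm F B B (δ y) = δ y := fun y => by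
    simp only [δ, map_add, TensorProduct.comm_tmul]
    rw [add_comm]
  have hcomm : f w * f i = f i * f w := by rw [← map_mul, hwc, map_mul]
  have hδwi : δ w * δ i = δ i * δ w := by
    simp only [δ, add_mul, mul_add, Algebra.TensorProduct.tmul_mul_tmul, one_mul, mul_one, hcomm]
    abel
  have hfix : ∀ E : B ⊗[F] B, ∀ v y, δ y * E = E → Φ (δ y) (Φ E v) = Φ E v := fun E v y h => by
    rw [← Module.End.mul_apply, ← map_mul, h]
  -- That `δ y` fixes v will mean τ(y) = y + 1. If i² + i is in F, both conditions are imposed by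
  -- taking v in the image of `δ w * δ i`, which is nonzero by `hwi`; otherwise only the condition
  -- on w is imposed.
  obtain ⟨v, hv, hgv, hwv, hiv⟩ : ∃ v, v ≠ 0 ∧ Φ g v = v ∧ Φ (δ w) v = v ∧
      ((∃ r, i * i + i = algebraMap F D r) → Φ (δ i) v = v) := by
    by_cases hr : ∃ r, i * i + i = algebraMap F D r
    · obtain ⟨v, hv, hgv⟩ := exists_symmetric_vector Φ hgg hg (E := δ w * δ i) (by
        obtain ⟨l, hl, hl'⟩ := exists_dual_of_notMem_span hwi
        intro h
        apply hl'
        have h2 := congrArg l h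
        simp only [δ, add_mul, mul_add, Algebra.TensorProduct.tmul_mul_tmul, one_mul, mul_one,
          map_add, map_zero] at h2
        rw [hl (f w) (by simp), hl (f i) (by simp), hl 1 (by simp), ← map_mul] at h2
        simpa using h2) (by
        rw [hδwi]
        conv_rhs => rw [← hδc i, ← hδc w]
        have : ∀ s t : B ⊗[F] B, TensorProduct.comm F B B (s * t) =
            TensorProduct.comm F B B s * TensorProduct.comm F B B t := fun s t =>
          map_mul (Algebra.TensorProduct.comm F B B) s t
        rw [this])
      refine ⟨_, hv, hgv, hfix _ _ _ ?_, fun _ => hfix _ _ _ ?_⟩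
      · rw [← mul_assoc, hδ w ⟨a, hw⟩]
      · rw [hδwi, ← mul_assoc, hδ i hr]
    · obtain ⟨v, hv, hgv⟩ := exists_symmetric_vector Φ hgg hg (E := δ w) (by
        obtain ⟨l, hl, hl'⟩ := exists_dual_of_notMem_span hw1
        intro h
        apply hl'
        have h2 := congrArg l h
        simp only [δ, map_add, map_zero] at h2
        rw [hl 1 (by simp)] at h2
        simpa using h2) (hδc w)
      exact ⟨_, hv, hgv, hfix _ _ _ (hδ w ⟨a, hw⟩), fun h => absurd h hr⟩
  obtain ⟨τ, hτ, huniq, hττ⟩ := exists_involution_of_vector Φ hD hdim f hw hwc hw1 hg hv hgv hwv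
  have hδ1 : ∀ y, Φ (δ y) v = v → τ y = y + 1 := by
    intro y hy
    apply huniq
    rw [← hτ, map_add, map_one, TensorProduct.add_tmul, map_add, ← Algebra.TensorProduct.one_def,
      map_one, LinearMap.add_apply, Module.End.one_apply]
    simp only [δ, map_add, LinearMap.add_apply] at hy
    have h2 : Φ (f y ⊗ₜ 1) v + Φ (f y ⊗ₜ 1) v = 0 := by
      rw [← two_smul F, CharTwo.two_eq_zero, zero_smul]
    linear_combination (norm := module) hy - h2
  refine ⟨τ, fun x y => huniq _ _ ?_, fun x y => huniq _ _ ?_, fun c => huniq _ _ ?_, hττ,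
    hδ1 w hwv, fun h => hδ1 i (hiv h)⟩
  · rw [← hτ, map_add, map_add, TensorProduct.tmul_add, TensorProduct.add_tmul, map_add, map_add,
      LinearMap.add_apply, LinearMap.add_apply, hτ, hτ]
  · have h1 : ∀ s t : B, Φ (1 ⊗ₜ (s * t)) v = Φ (1 ⊗ₜ s) (Φ (1 ⊗ₜ t) v) := fun s t => by
      rw [← Module.End.mul_apply, ← map_mul, Algebra.TensorProduct.tmul_mul_tmul, one_mul]
    have h2 : ∀ s t : B, Φ ((s * t) ⊗ₜ 1) v = Φ (s ⊗ₜ 1) (Φ (t ⊗ₜ 1) v) := fun s t => by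
      rw [← Module.End.mul_apply, ← map_mul, Algebra.TensorProduct.tmul_mul_tmul, one_mul]
    have h3 : ∀ s t : B, Φ (1 ⊗ₜ s) (Φ (t ⊗ₜ 1) v) = Φ (t ⊗ₜ 1) (Φ (1 ⊗ₜ s) v) := fun s t => by
      rw [← Module.End.mul_apply, ← Module.End.mul_apply, ← map_mul, ← map_mul,
        Algebra.TensorProduct.tmul_mul_tmul, Algebra.TensorProduct.tmul_mul_tmul, one_mul, mul_one,
        one_mul, mul_one]
    rw [← hτ, map_mul, map_mul, h1, hτ, h3, hτ, ← h2]
  · rw [← hτ, f.commutes, Algebra.algebraMap_eq_smul_one, TensorProduct.smul_tmul]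

end involution

end

/-! ### Descent of quaternion algebras along a separable quadratic extension -/

section

section descent
variable {F : Type u} [Field F] [CharP F 2] {K : Type u} [Field K] [CharP K 2] [Algebra F K]

theorem add_star_symbolAlgebra {ρ η : K} (y : SymbolAlgebra K ρ η) :
    y + star y = algebraMap K _ y.imI := by
  rw [QuaternionAlgebra.algebraMap_eq]
  ext <;> simp [CharTwo.neg_eq, CharTwo.add_self_eq_zero]
  grind

omit [CharP K 2] in
theorem star_algebraMap_symbolAlgebra {ρ η : K} (k : K) :
    star (algebraMap K (SymbolAlgebra K ρ η) k) = algebraMap K _ k := by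
  rw [QuaternionAlgebra.algebraMap_eq, QuaternionAlgebra.star_mk]
  simp

omit [CharP F 2] in
/-- Descent of a quaternion algebra along an involution of the second kind. -/
theorem exists_descent_of_involution {Q : Type v} [Ring Q] [Nontrivial Q] [StarRing Q] [CharP Q 2] (φ : K →+* Q)
    (hφinj : Function.Injective φ) (hφc : ∀ k (y : Q), φ k * y = y * φ k)
    (hcenter : ∀ y : Q, (∀ x, x * y = y * x) → ∃ c, φ c = y)
    (star_φ : ∀ k, star (φ k) = φ k) (htrace : ∀ y : Q, ∃ k, y + star y = φ k)
    (hnorm : ∀ y : Q, ∃ k, y * star y = φ k)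
    (hD : ∀ y : Q, y ≠ 0 → ∃ y', y' * y = 1)
    {α : K} (hα : ∀ k : K, ∃ c d : F, k = algebraMap F K c + algebraMap F K d * α)
    {τ : Q → Q} (τ_add : ∀ x y, τ (x + y) = τ x + τ y)
    (τ_mul : ∀ x y, τ (x * y) = τ y * τ x)
    (τ_algebraMap : ∀ c : F, τ (φ (algebraMap F K c)) = φ (algebraMap F K c))
    (τ_τ : ∀ y, τ (τ y) = y) (τ_α : τ (φ α) = φ α + 1) {i : Q} (hti : i + star i = 1) :
    ∃ (i₀ j₀ : Q) (p q : F), q ≠ 0 ∧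
      i₀ * i₀ + i₀ = φ (algebraMap F K p) ∧ j₀ * j₀ = φ (algebraMap F K q) ∧
      j₀ * i₀ = (i₀ + 1) * j₀ ∧ (τ i = i + 1 → i₀ = i) := by
  choose t ht using htrace
  have star_eq : ∀ y : Q, star y = y + φ (t y) := fun y => by
    linear_combination (norm := grind) ht y
  have hnorm' : ∀ y : Q, ∃ k, star y * y = φ k := fun y => by
    simpa using hnorm (star y)
  have τ_φ : ∀ c d : F, τ (φ (algebraMap F K c + algebraMap F K d * α)) =
      φ (algebraMap F K c + algebraMap F K d * (α + 1)) := fun c d => by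
    rw [map_add, map_mul, τ_add, τ_mul, τ_algebraMap, τ_algebraMap, τ_α, map_add, map_mul, map_add,
      map_one, hφc]
  have τ_φ' : ∀ k, ∃ k', τ (φ k) = φ k' := fun k => by
    obtain ⟨c, d, rfl⟩ := hα k
    exact ⟨_, τ_φ c d⟩
  -- The conjugate of `star` by τ also adds a scalar to y and has a scalar product with y. The two
  -- added scalars must agree unless y is itself a scalar, a case treated directly.
  have τ_star : ∀ y, τ (star (τ y)) = star y := by
    intro y
    obtain ⟨c, hc⟩ : ∃ c, τ (star (τ y)) = y + φ c := by
      obtain ⟨c, hc⟩ := τ_φ' (t (τ y))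
      exact ⟨c, by rw [star_eq, τ_add, τ_τ, hc]⟩
    rw [hc, star_eq, add_right_inj]
    by_cases hct : c = t y
    · rw [hct]
    obtain ⟨n, hn⟩ := hnorm y
    obtain ⟨n', hn'⟩ : ∃ n', y * τ (star (τ y)) = φ n' := by
      obtain ⟨m, hm⟩ := hnorm' (τ y)
      obtain ⟨m', hm'⟩ := τ_φ' m
      refine ⟨m', ?_⟩
      rw [← hm', ← hm, τ_mul, τ_τ]
    have h1 : y * φ (c + t y) = φ (n + n') := by
      rw [map_add, map_add, ← hn, ← hn', hc, star_eq]
      have h0 := CharTwo.add_self_eq_zero (y * y)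
      rw [mul_add, mul_add, mul_add]
      linear_combination (norm := abel) -h0
    have h2 : c + t y ≠ 0 := fun h => hct (by grind)
    obtain ⟨k, rfl⟩ : ∃ k, y = φ k := ⟨(n + n') * (c + t y)⁻¹, by
      rw [map_mul, ← h1, mul_assoc, ← map_mul, mul_inv_cancel₀ h2, map_one, mul_one]⟩
    have h3 : τ (star (τ (φ k))) = φ k := by
      obtain ⟨k', hk'⟩ := τ_φ' k
      rw [hk', star_φ, ← hk', τ_τ]
    rw [h3] at hc
    have h4 := star_eq (φ k)
    rw [star_φ] at h4
    have h5 : φ k + φ c = φ k + φ (t (φ k)) := by rw [← hc, ← h4]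
    exact add_left_cancel h5
  -- A ring automorphism of order 2 with α ↦ α + 1. The descended algebra consists of its fixed
  -- points, and its generators are sought there.
  let σ : Q → Q := fun y => star (τ y)
  have σ_add : ∀ x y, σ (x + y) = σ x + σ y := fun x y => by simp only [σ, τ_add, star_add]
  have σ_mul : ∀ x y, σ (x * y) = σ x * σ y := fun x y => by simp only [σ, τ_mul, star_mul]
  have σ_σ : ∀ x, σ (σ x) = x := fun x => by simp only [σ]; rw [τ_star, star_star]
  have σ_star : ∀ x, σ (star x) = star (σ x) := fun x => by
    simp only [σ, star_star]
    have := τ_star (τ x)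
    rw [τ_τ] at this
    rw [this, star_star]
  have σ_α : σ (φ α) = φ α + 1 := by
    have : φ α + 1 = φ (α + 1) := by rw [map_add, map_one]
    simp only [σ]
    rw [show τ (φ α) = φ α + 1 from τ_α, this, star_φ]
  have σ_one : σ 1 = 1 := by
    have h1 := σ_mul (σ 1) 1
    rw [mul_one, σ_σ, one_mul] at h1
    exact h1.symm
  have σ_fix : ∀ k, σ (φ k) = φ k → ∃ c : F, k = algebraMap F K c := by
    intro k hk
    obtain ⟨c, d, rfl⟩ := hα k
    simp only [σ] at hk
    rw [τ_φ, star_φ] at hk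
    have h1 := hφinj hk
    rw [add_right_inj, mul_add, mul_one] at h1
    have h2 : algebraMap F K d = 0 := by grind
    exact ⟨c, by rw [h2, zero_mul, add_zero]⟩
  -- As σ(α) = α + 1, this element is fixed by σ for any i. It still has trace 1, and it equals i
  -- when σ fixes i.
  obtain ⟨i₀, hi₀⟩ : ∃ i₀ : Q, i₀ = i + φ α * (i + σ i) := ⟨_, rfl⟩
  have σ_i₀ : σ i₀ = i₀ := by
    rw [hi₀, σ_add, σ_mul, σ_add, σ_σ, σ_α]
    grind
  have star_i₀ : star i₀ = i₀ + 1 := by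
    have h1 : σ i + star (σ i) = 1 := by rw [← σ_star, ← σ_add, hti, σ_one]
    rw [hi₀, star_add, star_mul, star_φ, star_add, ← hφc]
    linear_combination (norm := grind) hti + φ α * hti + φ α * h1
  obtain ⟨k, hk⟩ := hnorm i₀
  have hk' : i₀ * i₀ + i₀ = φ k := by
    rw [← hk, star_i₀, mul_add, mul_one]
  obtain ⟨p, hp⟩ := σ_fix k (by rw [← hk', σ_add, σ_mul, σ_i₀])
  -- Any y is recovered from the fixed elements y + σ(y) and αy + σ(αy). If all fixed elements
  -- commuted with i₀, then i₀ would be central and fixed by `star`, but `star` sends it to i₀ + 1.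
  obtain ⟨z, hz, hzi⟩ : ∃ z, σ z = z ∧ z * i₀ + i₀ * z ≠ 0 := by
    by_contra! h
    have h1 : ∀ y : Q, y * i₀ = i₀ * y := by
      intro y
      have ha := h (y + σ y) (by rw [σ_add, σ_σ, add_comm])
      have hb := h (φ α * y + σ (φ α * y)) (by rw [σ_add, σ_σ, add_comm])
      rw [σ_mul, σ_α] at hb
      have hc := hφc α i₀
      have hs : σ y * i₀ = i₀ * σ y := by
        linear_combination (norm := grind) hb + φ α * ha + hc * (y + σ y)
      linear_combination (norm := grind) ha + hs
    obtain ⟨c, hc⟩ := hcenter i₀ h1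
    have h3 : star i₀ = i₀ := by rw [← hc]; exact star_φ c
    rw [star_i₀] at h3
    exact one_ne_zero (add_eq_left.1 h3)
  obtain ⟨j₀, hj₀⟩ : ∃ j₀ : Q, j₀ = z * i₀ + i₀ * z := ⟨_, rfl⟩
  have σ_j₀ : σ j₀ = j₀ := by rw [hj₀, σ_add, σ_mul, σ_mul, σ_i₀, hz]
  have star_j₀ : star j₀ = j₀ := by
    rw [hj₀, star_add, star_mul, star_mul, star_i₀, star_eq z]
    linear_combination (norm := grind) hφc (t z) i₀
  obtain ⟨m, hm⟩ := hnorm j₀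
  rw [star_j₀] at hm
  obtain ⟨q, hq⟩ := σ_fix m (by rw [← hm, σ_mul, σ_j₀])
  refine ⟨i₀, j₀, p, q, ?_, by rw [hk', hp], by rw [hm, hq], ?_, fun h => ?_⟩
  · rintro rfl
    rw [map_zero] at hq
    rw [hq, map_zero] at hm
    rw [← hj₀] at hzi
    obtain ⟨y', hy'⟩ := hD j₀ hzi
    have : y' * (j₀ * j₀) = j₀ := by rw [← mul_assoc, hy', one_mul]
    rw [hm, mul_zero] at this
    exact hzi this.symm
  · have hc := hφc k z
    rw [hj₀]
    linear_combination (norm := grind) z * hk' + hk' * z + hc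
  · have : σ i = i := by
      simp only [σ]
      rw [h, star_add, star_one]
      linear_combination (norm := grind) hti
    rw [hi₀, this, CharTwo.add_self_eq_zero, mul_zero, add_zero]

end descent

namespace Br
variable {F : Type u} [Field F] [CharP F 2] {K : Type u} [Field K] [Algebra F K]

omit [CharP F 2] in
theorem exists_eq_add_mul_of_finrank_eq_two (h2 : Module.finrank F K = 2) {α : K}
    (hα : ∀ c : F, algebraMap F K c ≠ α) (k : K) :
    ∃ c d : F, k = algebraMap F K c + algebraMap F K d * α := by
  have hli : LinearIndependent F ![(1 : K), α] := by
    rw [LinearIndependent.pair_iff]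
    intro s t hst
    by_cases ht : t = 0
    · subst ht
      rw [zero_smul, add_zero, smul_eq_zero] at hst
      exact ⟨hst.resolve_right one_ne_zero, rfl⟩
    · refine absurd ?_ (hα (-s / t))
      rw [Algebra.smul_def, Algebra.smul_def, mul_one] at hst
      have ht' : algebraMap F K t ≠ 0 := by simpa using ht
      rw [map_div₀, map_neg, div_eq_iff ht']
      linear_combination -hst
  have hx : k ∈ Submodule.span F (Set.range ![(1 : K), α]) := by
    rw [hli.span_eq_top_of_card_eq_finrank (by simp [h2])]
    trivial
  obtain ⟨c, rfl⟩ := (Submodule.mem_span_range_iff_exists_fun F).1 hx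
  exact ⟨c 0, c 1, by simp [Fin.sum_univ_two, Algebra.smul_def]⟩

theorem exists_mul_eq_one_of_symb_ne_zero {a b : F} (hb : b ≠ 0) (h0 : symb a b ≠ 0)
    (y : SymbolAlgebra F a b) (hy : y ≠ 0) : ∃ y', y' * y = 1 := by
  have h1 := star_mul_symbolAlgebra y
  set n := y.re ^ 2 + y.re * y.imI + a * y.imI ^ 2 +
    b * (y.imJ ^ 2 + y.imJ * y.imK + a * y.imK ^ 2) with hn
  have hn0 : n ≠ 0 := by
    intro h
    obtain ⟨p, q, hpq⟩ := exists_eq_norm_of_isotropic (a := a) (x := y.re) (y := y.imI)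
      (z := y.imJ) (w := y.imK) hb
      (fun ⟨h1, h2, h3, h4⟩ => hy (QuaternionAlgebra.ext h1 h2 h3 h4)) (hn.symm.trans h)
    exact h0 (symb_eq_zero_of_eq hpq)
  refine ⟨n⁻¹ • star y, ?_⟩
  rw [smul_mul_assoc, h1, Algebra.algebraMap_eq_smul_one, smul_smul, inv_mul_cancel₀ hn0,
    one_smul]

/-- A `2`-torsion class which becomes a symbol over a separable quadratic extension is a sum of two
symbols. -/
theorem exists_eq_symb_add_symb [CharP K 2] (h2 : Module.finrank F K = 2) {a : F} {α : K}
    (hα : α * α + α = algebraMap F K a) (ha : ∀ t : F, t * t + t ≠ a) {x : Br F} (hx : x + x = 0)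
    {ρ η : K} (hρ : map (algebraMap F K) x = symb ρ η) :
    ∃ g p q : F, x = symb a g + symb p q ∧ ∀ ρ₀, ρ = algebraMap F K ρ₀ → p = ρ₀ := by
  have hαF : ∀ c : F, algebraMap F K c ≠ α := by
    rintro c rfl
    rw [← map_mul, ← map_add] at hα
    exact ha c ((algebraMap F K).injective hα)
  by_cases h0 : symb ρ η = 0
  · rw [h0] at hρ
    obtain ⟨g, -, rfl⟩ := exists_eq_symb_of_map_artinSchreier_eq_zero h2 hα ha hρ
    by_cases h : ∃ ρ₀, ρ = algebraMap F K ρ₀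
    · obtain ⟨ρ₀, rfl⟩ := h
      -- The right slot 0 gives the zero symbol by convention, so the left slot may be prescribed.
      refine ⟨g, ρ₀, 0, by simp, fun ρ₁ h => (algebraMap F K).injective h⟩
    · exact ⟨g, 0, 0, by simp, fun ρ₀ hρ₀ => absurd ⟨ρ₀, hρ₀⟩ h⟩
  have hη : η ≠ 0 := by rintro rfl; simp at h0
  have hfd : FiniteDimensional F K := Module.finite_of_finrank_pos (by omega)
  have hsimple : IsSimpleRing (SymbolAlgebra K ρ η) := isSimpleRing_symbolAlgebra ρ hη
  have hD := exists_mul_eq_one_of_symb_ne_zero hη h0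
  have htower : ∀ c : F, algebraMap F (SymbolAlgebra K ρ η) c = algebraMap K (SymbolAlgebra K ρ η) (algebraMap F K c) := fun c =>
    IsScalarTower.algebraMap_apply F K (SymbolAlgebra K ρ η) c
  have hρ' : map (algebraMap F K) x = mk K (SymbolAlgebra K ρ η) := by rw [hρ, symb_of_ne_zero ρ hη]
  -- Here x is the class of some B of dimension 16 containing the division algebra [ρ,η) over K. An
  -- involution moving α descends the latter to [p,q) over F, and the centralizer of [p,q) in B has
  -- dimension 4 and contains w, so it is [a,g).
  obtain ⟨B, i1, i2, i3, i4, i5, rfl, ⟨f⟩, hB⟩ := exists_algHom_of_map_eq (SymbolAlgebra K ρ η) x hρ'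
  have hQ4 : Module.finrank K (SymbolAlgebra K ρ η) = 4 := finrank_symbolAlgebra ρ η
  rw [hQ4, h2] at hB
  have hQ8 : Module.finrank F (SymbolAlgebra K ρ η) = 8 := by
    rw [← Module.finrank_mul_finrank F K (SymbolAlgebra K ρ η), h2, hQ4]
  have hfinj : Function.Injective f := f.toRingHom.injective
  obtain ⟨w, hwα⟩ : ∃ w : (SymbolAlgebra K ρ η), w = algebraMap K (SymbolAlgebra K ρ η) α := ⟨_, rfl⟩
  obtain ⟨i, hi⟩ : ∃ i : (SymbolAlgebra K ρ η), i = ⟨0, 1, 0, 0⟩ := ⟨_, rfl⟩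
  have hw : w * w + w = algebraMap F (SymbolAlgebra K ρ η) a := by
    rw [htower, hwα, ← hα, map_add, map_mul]
  have hwc : ∀ y, w * y = y * w := fun y => hwα ▸ Algebra.commutes α y
  have hw1 : f w ∉ Submodule.span F {1} := by
    rw [Submodule.mem_span_singleton]
    rintro ⟨c, hc⟩
    rw [← map_one f, ← map_smul] at hc
    have h1 := hfinj hc
    rw [← Algebra.algebraMap_eq_smul_one, htower, hwα] at h1
    exact hαF c ((algebraMap K (SymbolAlgebra K ρ η)).injective h1)
  have hwi : f (w * i) ∉ Submodule.span F {1, f w, f i} := by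
    rw [Submodule.mem_span_triple]
    rintro ⟨c₀, c₁, c₂, hc⟩
    rw [← map_one f, ← map_smul, ← map_smul, ← map_smul, ← map_add, ← map_add] at hc
    have h1 := congrArg QuaternionAlgebra.imI (hfinj hc)
    refine hαF c₂ ?_
    rw [hwα, hi, QuaternionAlgebra.algebraMap_eq] at h1
    simp only [QuaternionAlgebra.imI_add, QuaternionAlgebra.imI_smul, QuaternionAlgebra.mk_mul_mk,
      QuaternionAlgebra.imI_one] at h1
    rw [Algebra.algebraMap_eq_smul_one]
    simpa using h1
  obtain ⟨τ, τ_add, τ_mul, τ_alg, τ_τ, τ_w, τ_i⟩ := 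
    exists_involution hx hD (by omega) f hw hwc hw1 hwi
  have hQ2 : CharP (SymbolAlgebra K ρ η) 2 := charP_two_of_algebra K (SymbolAlgebra K ρ η)
  obtain ⟨i₀, j₀, p, q, hq, hi₀, hj₀, hji, hii⟩ := exists_descent_of_involution (F := F)
    (algebraMap K (SymbolAlgebra K ρ η)) (algebraMap K (SymbolAlgebra K ρ η)).injective (fun k y => Algebra.commutes k y)
    (fun y hy => Algebra.mem_bot.1
      (Algebra.IsCentral.center_eq_bot K (SymbolAlgebra K ρ η) ▸ Subalgebra.mem_center_iff.2 hy))
    star_algebraMap_symbolAlgebra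
    (fun y => ⟨_, add_star_symbolAlgebra y⟩)
    (fun y => ⟨_, QuaternionAlgebra.mul_star_eq_coe y⟩) hD
    (exists_eq_add_mul_of_finrank_eq_two h2 hαF) τ_add τ_mul
    (fun c => by rw [← htower]; exact τ_alg c) τ_τ (hwα ▸ τ_w) (i := i) (by
      rw [add_star_symbolAlgebra, hi]
      exact map_one _)
  have hi' : f i₀ * f i₀ + f i₀ = algebraMap F B p := by
    rw [← map_mul, ← map_add, hi₀, ← htower, f.commutes]
  have hj' : f j₀ * f j₀ = algebraMap F B q := by rw [← map_mul, hj₀, ← htower, f.commutes]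
  have hji' : f j₀ * f i₀ = (f i₀ + 1) * f j₀ := by
    rw [← map_mul, hji, map_mul, map_add, map_one]
  have hmk := mk_eq_symb_add hq hi' hj' hji'
  have : IsSimpleRing (SymbolAlgebra F p q) := isSimpleRing_symbolAlgebra p hq
  have hfr := (symbolHom hi' hj' hji').finrank_mul_finrank_centralizer
  rw [finrank_symbolAlgebra, hB] at hfr
  obtain ⟨g, -, hg⟩ := exists_mk_eq_symb_of_artinSchreier
    (B := (symbolHom hi' hj' hji').centralizer) (by omega) ha
    (w := ⟨f w, symbolHom_mem_centralizer hi' hj' hji'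
      (by rw [← map_mul, ← map_mul, hwc]) (by rw [← map_mul, ← map_mul, hwc])⟩)
    (Subtype.ext (by
      change f w * f w + f w = algebraMap F B a
      rw [← map_mul, ← map_add, hw, f.commutes]))
  refine ⟨g, p, q, by rw [hmk, hg, add_comm], fun ρ₀ hρ₀ => ?_⟩
  have hir : i * i + i = algebraMap F (SymbolAlgebra K ρ η) ρ₀ := by
    have := (symbolAlgebra_relations ρ η).1
    rw [htower, ← hρ₀, hi, ← pow_two]
    exact this
  -- For ρ in F the involution was chosen with i ↦ i + 1, so the descended generator is i itself and
  -- p = ρ₀.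
  have h3 := hii (τ_i ⟨ρ₀, hir⟩)
  rw [h3] at hi₀
  rw [← htower] at hi₀
  exact (algebraMap F (SymbolAlgebra K ρ η)).injective (hi₀.symm.trans hir)

end Br

end

/-! ### Inseparable quadratic extensions: descent by the squaring map -/

section

namespace Br
variable {F : Type u} [Field F] [CharP F 2]

/-- `x` is a sum of `r` symbols. -/
def IsSymbolSum (r : ℕ) (x : Br F) : Prop :=
  ∃ l : List (F × F), l.length = r ∧ x = (l.map fun p => symb p.1 p.2).sum

namespace IsSymbolSum

theorem zero : IsSymbolSum 0 (0 : Br F) := ⟨[], rfl, rfl⟩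

theorem symb (a b : F) : IsSymbolSum 1 (symb a b) := ⟨[(a, b)], rfl, by simp⟩

theorem add {r s : ℕ} {x y : Br F} (hx : IsSymbolSum r x) (hy : IsSymbolSum s y) :
    IsSymbolSum (r + s) (x + y) := by
  obtain ⟨l, rfl, rfl⟩ := hx
  obtain ⟨l', rfl, rfl⟩ := hy
  exact ⟨l ++ l', by simp, by simp⟩

theorem mono {r s : ℕ} {x : Br F} (hx : IsSymbolSum r x) (h : r ≤ s) : IsSymbolSum s x := by
  obtain ⟨k, rfl⟩ := Nat.exists_eq_add_of_le h
  rw [← add_zero x]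
  exact hx.add ⟨List.replicate k (0, 0), by simp, by simp⟩

theorem eq_zero {x : Br F} (hx : IsSymbolSum 0 x) : x = 0 := by
  obtain ⟨l, hl, rfl⟩ := hx
  rw [List.length_eq_zero_iff.1 hl]
  rfl

theorem exists_of_succ {r : ℕ} {x : Br F} (hx : IsSymbolSum (r + 1) x) :
    ∃ a b y, IsSymbolSum r y ∧ x = Br.symb a b + y := by
  obtain ⟨_ | ⟨p, l⟩, hl, rfl⟩ := hx
  · simp at hl
  · exact ⟨p.1, p.2, _, ⟨l, by simpa using hl, rfl⟩, by simp⟩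

theorem add_self {r : ℕ} {x : Br F} (hx : IsSymbolSum r x) : x + x = 0 := by
  induction r generalizing x with
  | zero => rw [hx.eq_zero, add_zero]
  | succ r ih =>
    obtain ⟨a, b, y, hy, rfl⟩ := hx.exists_of_succ
    rw [add_add_add_comm, add_self_symb, ih hy, add_zero]

end IsSymbolSum

section inseparable
variable {E : Type u} [Field E] [CharP E 2] [Algebra F E]

omit [CharP F 2] in
-- Squaring is a ring homomorphism in characteristic 2. Composed with the inclusion of F on either
-- side, ϕ is Frobenius; it plays the role of a corestriction.
theorem exists_ringHom_sq (hsq : ∀ z : E, ∃ y : F, z * z = algebraMap F E y) :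
    ∃ ϕ : E →+* F, ∀ z, algebraMap F E (ϕ z) = z ^ 2 := by
  choose ϕ hϕ using hsq
  have hinj := (algebraMap F E).injective
  refine ⟨{ toFun := ϕ
            map_one' := hinj (by rw [← hϕ]; simp)
            map_mul' := fun x y => hinj (by rw [map_mul, ← hϕ, ← hϕ, ← hϕ]; ring)
            map_zero' := hinj (by rw [← hϕ]; simp)
            map_add' := fun x y => hinj (by rw [map_add, ← hϕ, ← hϕ, ← hϕ]; grind) },
    fun z => ?_⟩
  exact (hϕ z).symm.trans (pow_two z).symm

variable {ϕ : E →+* F} (hϕ : ∀ z, algebraMap F E (ϕ z) = z ^ 2)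
include hϕ

/-- [z,y) = [z²,y), and z² lies in F: a symbol descends as soon as its right slot does. -/
theorem symb_algebraMap_right (z : E) (y : F) :
    symb z (algebraMap F E y) = map (algebraMap F E) (symb (ϕ z) y) := by
  rw [map_symb, hϕ, symb_sq_left]

omit [CharP E 2] in
theorem map_map_eq_zero {x : Br F} (hx : x + x = 0) : map ϕ (map (algebraMap F E) x) = 0 := by
  have h : ϕ.comp (algebraMap F E) = frobenius F 2 := by
    ext c
    apply (algebraMap F E).injective
    rw [RingHom.comp_apply, hϕ, frobenius_def, map_pow]
  rw [map_map, h, map_frobenius_eq_zero hx]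

omit [CharP F 2] in
theorem not_isSquare_of_notMem {w : E} (hw : ∀ c, algebraMap F E c ≠ w) : ¬IsSquare (ϕ w) := by
  rintro ⟨c, hc⟩
  have h := hϕ w
  rw [hc, map_mul, ← pow_two] at h
  exact hw c (CharTwo.sq_injective h)

/-- Classes over `F(√b)` that come from `F` up to a symbol whose slot is `√b`. -/
theorem exists_map_eq_of_eq_add_symb {w : E} (hw : ∀ c, algebraMap F E c ≠ w) {x Y : Br F}
    (hx : x + x = 0) (hY : Y + Y = 0) {Z C : F} (h : map (algebraMap F E) x =
      map (algebraMap F E) Y + symb (algebraMap F E Z + algebraMap F E C * w) w) :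
    ∃ p v, map (algebraMap F E) x = map (algebraMap F E) (Y + symb p v) := by
  have hϕF : ∀ c, ϕ (algebraMap F E c) = c ^ 2 := fun c =>
    (algebraMap F E).injective (by rw [hϕ, map_pow])
  -- Under ϕ only [Z, ϕw) survives, because [C²ϕw, ϕw) = [C²ϕw, C²) = 0. So [Z, ϕw) = 0 and Z = u² +
  -- u + ϕ(w)v². Hence [Z+Cw, w) = [(C+v)w, w) = [(C+v)w, C+v), whose right slot is in F.
  have h1 := congrArg (map ϕ) h
  rw [map_add, map_map_eq_zero hϕ hx, map_map_eq_zero hϕ hY, zero_add, map_symb, map_add, map_mul,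
    hϕF, hϕF, symb_add_left, symb_sq_left, symb_mul_comm, symb_sq_right, add_zero] at h1
  obtain ⟨u, v, huv⟩ := exists_eq_of_symb_eq_zero (not_isSquare_of_notMem hϕ hw) h1.symm
  refine ⟨ϕ w * (C + v) ^ 2, C + v, ?_⟩
  have h2 : algebraMap F E Z + algebraMap F E C * w =
      (algebraMap F E u ^ 2 + algebraMap F E u) + ((algebraMap F E v * w) ^ 2 +
        algebraMap F E C * w) := by
    rw [huv, map_add, map_add, map_mul, map_pow, map_pow, hϕ]
    ring
  rw [h, map_add, h2, symb_add_left, symb_artinSchreier, zero_add, symb_add_left, symb_sq_left,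
    ← symb_add_left, ← add_mul, symb_mul_comm, ← map_add, symb_algebraMap_right hϕ, map_mul, hϕF,
    add_comm v C, mul_comm]

/-- With e = c/(w+t), `symb_mul_add` gives [c, w+t) = [ew, w) + [et, t). The second term descends,
and Z + Cw is ew with its denominator made rational. -/
theorem exists_symb_eq_of_linear {w : E} (hw : ∀ c, algebraMap F E c ≠ w) (c t : F) :
    ∃ d Z C : F, symb (algebraMap F E c) (w + algebraMap F E t) =
      map (algebraMap F E) (symb d t) + symb (algebraMap F E Z + algebraMap F E C * w) w := by
  have hn : w + algebraMap F E t ≠ 0 := fun h => hw t (by grind)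
  have hn' : ϕ w + t ^ 2 ≠ 0 := fun h => by
    have h2 := congrArg (algebraMap F E) h
    rw [map_add, hϕ, map_pow, map_zero] at h2
    exact hn (pow_eq_zero_iff two_ne_zero |>.1 (by rw [add_pow_two]; grind))
  obtain ⟨e, he⟩ : ∃ e, e = algebraMap F E c / (w + algebraMap F E t) := ⟨_, rfl⟩
  have hc : algebraMap F E c = e * (w + algebraMap F E t) := by
    rw [he, div_mul_cancel₀ _ hn]
  refine ⟨ϕ (e * algebraMap F E t), c * ϕ w / (ϕ w + t ^ 2), c * t / (ϕ w + t ^ 2), ?_⟩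
  rw [← symb_algebraMap_right hϕ, hc, symb_mul_add, add_comm]
  congr 2
  have hn2 : w ^ 2 + algebraMap F E t ^ 2 ≠ 0 := by
    rw [← hϕ, ← map_pow, ← map_add]
    exact (map_ne_zero _).2 hn'
  rw [he]
  simp only [map_div₀, map_add, map_mul, map_pow, hϕ]
  field_simp
  grind

theorem exists_symb_eq_of_mul {w : E} (hw : ∀ c, algebraMap F E c ≠ w) (c : F) {s : F}
    (hs : s ≠ 0) (t : F) : ∃ d Z C : F,
    symb (algebraMap F E c) (algebraMap F E s * (w + algebraMap F E t)) =
      map (algebraMap F E) (symb c s + symb d t) +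
        symb (algebraMap F E Z + algebraMap F E C * w) w := by
  have hn : w + algebraMap F E t ≠ 0 := fun h => hw t (by grind)
  obtain ⟨d, Z, C, h⟩ := exists_symb_eq_of_linear hϕ hw c t
  exact ⟨d, Z, C, by rw [symb_mul_right _ (by simpa using hs) hn, h, map_add, map_symb _ c s, add_assoc]⟩

theorem exists_symb_eq (h2 : Module.finrank F E = 2) {w : E} (hw : ∀ c, algebraMap F E c ≠ w)
    (x y : E) : ∃ Y, IsSymbolSum 2 Y ∧ ∃ Z C : F, symb x y = map (algebraMap F E) Y +
      symb (algebraMap F E Z + algebraMap F E C * w) w := by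
  obtain ⟨c, d, rfl⟩ := exists_eq_add_mul_of_finrank_eq_two h2 hw y
  by_cases hd : d = 0
  · subst hd
    refine ⟨symb (ϕ x) c, (IsSymbolSum.symb _ _).mono (by norm_num), 0, 0, ?_⟩
    rw [← symb_algebraMap_right hϕ]
    simp
  · obtain ⟨e, Z, C, h⟩ := exists_symb_eq_of_mul hϕ hw (ϕ x) hd (c / d)
    refine ⟨symb (ϕ x) d + symb e (c / d), (IsSymbolSum.symb _ _).add (IsSymbolSum.symb _ _), Z, C, ?_⟩
    rw [← h, hϕ, symb_sq_left]
    congr 1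
    have hd' : algebraMap F E d ≠ 0 := by simpa using hd
    rw [map_div₀]
    field_simp
    ring

theorem exists_isSymbolSum_eq (h2 : Module.finrank F E = 2) {w : E}
    (hw : ∀ c, algebraMap F E c ≠ w) {r : ℕ} {y : Br E} (hy : IsSymbolSum r y) :
    ∃ Y, IsSymbolSum (2 * r) Y ∧ ∃ Z C : F, y = map (algebraMap F E) Y +
      symb (algebraMap F E Z + algebraMap F E C * w) w := by
  induction r generalizing y with
  | zero => exact ⟨0, IsSymbolSum.zero, 0, 0, by rw [hy.eq_zero]; simp⟩
  | succ r ih =>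
    obtain ⟨a, b, y', hy', rfl⟩ := hy.exists_of_succ
    obtain ⟨Y, hY, Z, C, rfl⟩ := ih hy'
    obtain ⟨Y', hY', Z', C', h⟩ := exists_symb_eq hϕ h2 hw a b
    refine ⟨Y' + Y, by rw [mul_add, add_comm]; exact hY'.add hY, Z' + Z, C' + C, ?_⟩
    rw [h, map_add, add_add_add_comm, ← symb_add_left, map_add, map_add]
    congr 2
    ring

omit hϕ [CharP F 2] [CharP E 2] in
/-- The choice of a generator adapted to two elements. -/
theorem exists_adapted_generator (h2 : Module.finrank F E = 2) {w : E}
    (hw : ∀ c, algebraMap F E c ≠ w) (g y : E) : ∃ w' : E, (∀ c, algebraMap F E c ≠ w') ∧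
      ((∃ c, algebraMap F E c = g) ∨ ∃ s t : F, s ≠ 0 ∧ (t = 0 ∨ t = 1) ∧
        g = algebraMap F E s * (w' + algebraMap F E t)) ∧
      ((∃ c, algebraMap F E c = y) ∨ ∃ s : F, s ≠ 0 ∧ y = algebraMap F E s * w') := by
  by_cases hy : ∃ c, algebraMap F E c = y
  · by_cases hg : ∃ c, algebraMap F E c = g
    · exact ⟨w, hw, Or.inl hg, Or.inl hy⟩
    · push Not at hg
      exact ⟨g, hg, Or.inr ⟨1, 0, one_ne_zero, Or.inl rfl, by simp⟩, Or.inl hy⟩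
  · push Not at hy
    obtain ⟨c, d, rfl⟩ := exists_eq_add_mul_of_finrank_eq_two h2 hy g
    by_cases hd : d = 0
    · subst hd
      exact ⟨y, hy, Or.inl ⟨c, by simp⟩, Or.inr ⟨1, one_ne_zero, by simp⟩⟩
    by_cases hc : c = 0
    · subst hc
      exact ⟨y, hy, Or.inr ⟨d, 0, hd, Or.inl rfl, by simp⟩, Or.inr ⟨1, one_ne_zero, by simp⟩⟩
    have hd' : algebraMap F E d ≠ 0 := by simpa using hd
    have hc' : algebraMap F E c ≠ 0 := by simpa using hc
    -- With w' = (d/c)y, g = c + dy becomes c(w' + 1). Having t in {0,1} matters because then [d,t)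
    -- = 0, which saves a symbol.
    refine ⟨algebraMap F E (d / c) * y, fun e he => hy (e * c / d) ?_,
      Or.inr ⟨c, 1, hc, Or.inr rfl, ?_⟩, Or.inr ⟨c / d, div_ne_zero hc hd, ?_⟩⟩
    · rw [map_div₀, map_mul, he, map_div₀]
      field_simp
    · rw [map_div₀, map_one]
      field_simp
      ring
    · rw [map_div₀, map_div₀]
      field_simp

/-- A class that becomes `[c, g)` plus `r` symbols over `F(√b)` comes from `[c, g')` plus `2r`
symbols. -/
theorem exists_map_eq_symb_add (h2 : Module.finrank F E = 2) {w : E}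
    (hw : ∀ c, algebraMap F E c ≠ w) {x : Br F} (hx : x + x = 0) {c : F} {g : E} {r : ℕ}
    {y : Br E} (hy : IsSymbolSum r y)
    (h : map (algebraMap F E) x = symb (algebraMap F E c) g + y) :
    ∃ g' Y, IsSymbolSum (2 * r) Y ∧
      map (algebraMap F E) x = map (algebraMap F E) (symb c g' + Y) := by
  obtain _ | r := r
  · rw [hy.eq_zero, add_zero] at h
    suffices ∃ g', map (algebraMap F E) x = map (algebraMap F E) (symb c g') by
      obtain ⟨g', hg'⟩ := this
      exact ⟨g', 0, IsSymbolSum.zero, by rw [hg', add_zero]⟩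
    by_cases hg : ∃ d, algebraMap F E d = g
    · obtain ⟨d, rfl⟩ := hg
      exact ⟨d, by rw [h, map_symb]⟩
    push Not at hg
    have h1 := congrArg (map ϕ) h
    have hϕF : ϕ (algebraMap F E c) = c ^ 2 := (algebraMap F E).injective (by rw [hϕ, map_pow])
    rw [map_map_eq_zero hϕ hx, map_symb, hϕF, symb_sq_left] at h1
    -- Since c = u² + u + ϕ(g)v², over E the left slots c and vg give the same symbols, so [c,g) =
    -- [vg,g) = [vg,v) = [c,v).
    obtain ⟨u, v, huv⟩ := exists_eq_of_symb_eq_zero (not_isSquare_of_notMem hϕ hg) h1.symm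
    refine ⟨v, ?_⟩
    have h3 : algebraMap F E c = (algebraMap F E u ^ 2 + algebraMap F E u) +
        (algebraMap F E v * g) ^ 2 := by
      rw [huv, map_add, map_add, map_mul, map_pow, map_pow, hϕ]
      ring
    have h4 : ∀ z, symb (algebraMap F E c) z = symb (algebraMap F E v * g) z := fun z => by
      rw [h3, symb_add_left, symb_artinSchreier, zero_add, symb_sq_left]
    rw [h, map_symb, h4, h4, symb_mul_comm]
  · obtain ⟨a, b, y', hy', rfl⟩ := hy.exists_of_succ
    -- The count: with this generator [c,g) leaves just [c,g') and [a,b) leaves one symbol, besides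
    -- terms in w'. The other r symbols leave 2r, and absorbing the terms in w' costs one more: 1 +
    -- 2r + 1 = 2(r+1).
    obtain ⟨w', hw', hg, hb⟩ := exists_adapted_generator h2 hw g b
    obtain ⟨g', Z, C, hgZ⟩ : ∃ g' Z C, symb (algebraMap F E c) g =
        map (algebraMap F E) (symb c g') + symb (algebraMap F E Z + algebraMap F E C * w') w' := by
      obtain ⟨d, rfl⟩ | ⟨s, t, hs, ht, rfl⟩ := hg
      · exact ⟨d, 0, 0, by simp [map_symb]⟩
      · obtain ⟨d, Z, C, h⟩ := exists_symb_eq_of_mul hϕ hw' c hs t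
        refine ⟨s, Z, C, ?_⟩
        have ht' : symb d t = 0 := by
          obtain rfl | rfl := ht
          · simp
          · rw [← one_pow 2, symb_sq_right]
        rw [h, ht', add_zero]
    obtain ⟨e, f, Z', C', hbZ⟩ : ∃ e f Z' C', symb a b =
        map (algebraMap F E) (symb e f) + symb (algebraMap F E Z' + algebraMap F E C' * w') w' := by
      obtain ⟨d, rfl⟩ | ⟨s, hs, rfl⟩ := hb
      · exact ⟨ϕ a, d, 0, 0, by rw [symb_algebraMap_right hϕ]; simp⟩
      · obtain ⟨d, Z, C, h⟩ := exists_symb_eq_of_mul hϕ hw' (ϕ a) hs 0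
        refine ⟨ϕ a, s, Z, C, ?_⟩
        rw [symb_zero_right, add_zero, map_zero, add_zero, hϕ, symb_sq_left] at h
        exact h
    obtain ⟨Y, hY, Z'', C'', rfl⟩ := exists_isSymbolSum_eq hϕ h2 hw' hy'
    have hYs : IsSymbolSum (1 + (1 + 2 * r)) (symb c g' + (symb e f + Y)) :=
      (IsSymbolSum.symb _ _).add ((IsSymbolSum.symb _ _).add hY)
    obtain ⟨p, v, hpv⟩ := exists_map_eq_of_eq_add_symb hϕ hw' hx hYs.add_self
      (Z := Z + (Z' + Z'')) (C := C + (C' + C'')) (by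
        rw [h, hgZ, hbZ]
        have h3 : algebraMap F E (Z + (Z' + Z'')) + algebraMap F E (C + (C' + C'')) * w' =
            (algebraMap F E Z + algebraMap F E C * w') +
            ((algebraMap F E Z' + algebraMap F E C' * w') +
            (algebraMap F E Z'' + algebraMap F E C'' * w')) := by
          simp only [map_add]; ring
        rw [h3, symb_add_left (algebraMap F E Z + algebraMap F E C * w'),
          symb_add_left (algebraMap F E Z' + algebraMap F E C' * w'),
          map_add (map (algebraMap F E)) (symb c g'), map_add (map (algebraMap F E)) (symb e f)]
        abel)
    refine ⟨g', symb e f + Y + symb p v, ?_, ?_⟩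
    · have := ((IsSymbolSum.symb e f).add hY).add (IsSymbolSum.symb p v)
      rwa [show 1 + 2 * r + 1 = 2 * (r + 1) by ring] at this
    · rw [hpv]
      congr 1
      abel

omit hϕ [CharP E 2] in
theorem exists_ringHom_sq_of_finrank_eq_two (h2 : Module.finrank F E = 2) {b : F} {w : E}
    (hw : w * w = algebraMap F E b) (hw' : ∀ d, algebraMap F E d ≠ w) :
    ∃ ϕ : E →+* F, ∀ z, algebraMap F E (ϕ z) = z ^ 2 := by
  have : CharP E 2 := charP_of_injective_algebraMap (algebraMap F E).injective 2
  refine exists_ringHom_sq fun z => ?_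
  obtain ⟨c, d, rfl⟩ := exists_eq_add_mul_of_finrank_eq_two h2 hw' z
  refine ⟨c * c + d * d * b, ?_⟩
  rw [map_add, map_mul, map_mul, map_mul, ← hw]
  grind

omit hϕ in
theorem exists_eq_symb_add_symb_add (h2 : Module.finrank F E = 2) {b : F} {w : E}
    (hw : w * w = algebraMap F E b) (hb : ¬IsSquare b) {x : Br F} (hx : x + x = 0) {c : F} {g : E}
    {r : ℕ} {y : Br E} (hy : IsSymbolSum r y)
    (h : map (algebraMap F E) x = symb (algebraMap F E c) g + y) :
    ∃ a g' Y, IsSymbolSum (2 * r) Y ∧ x = symb a b + symb c g' + Y := by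
  have hw' : ∀ d, algebraMap F E d ≠ w := by
    rintro d rfl
    exact hb ⟨d, (algebraMap F E).injective (by rw [← hw, map_mul])⟩
  obtain ⟨ϕ, hϕ⟩ := exists_ringHom_sq_of_finrank_eq_two h2 hw hw'
  obtain ⟨g', Y, hY, hxY⟩ := exists_map_eq_symb_add hϕ h2 hw' hx hy h
  obtain ⟨a, ha⟩ := exists_eq_symb_of_map_sq_eq_zero h2 hw hb (x := x - (symb c g' + Y)) (by
    rw [map_sub, hxY, sub_self])
  exact ⟨a, g', Y, hY, by rw [add_assoc, ← ha, sub_add_cancel]⟩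

end inseparable
end Br

end

/-! ### Fields generated by Artin–Schreier elements and square roots -/

section

section adjoin
variable {F : Type u} [Field F] {L : Type v} [Field L] [Algebra F L]

open Polynomial in
theorem finrank_adjoin_simple_eq_two {e f : F} (h : ∀ t : F, t * t + e * t + f ≠ 0) {α : L}
    (hα : α * α + algebraMap F L e * α + algebraMap F L f = 0) :
    Module.finrank F (IntermediateField.adjoin F {α}) = 2 := by
  have hp : (X ^ 2 + C e * X + C f : F[X]) = C 1 * X ^ 2 + C e * X + C f := by simp
  have hdeg : (X ^ 2 + C e * X + C f : F[X]).natDegree = 2 := by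
    rw [hp]; exact natDegree_quadratic one_ne_zero
  have hmonic : (X ^ 2 + C e * X + C f : F[X]).Monic := by
    rw [hp, Monic, leadingCoeff_quadratic one_ne_zero]
  have hirr : Irreducible (X ^ 2 + C e * X + C f : F[X]) := by
    rw [hmonic.irreducible_iff_roots_eq_zero_of_degree_le_three hdeg.ge (by omega)]
    refine Multiset.eq_zero_of_forall_notMem fun t ht => h t ?_
    have := (mem_roots'.1 ht).2
    simpa [IsRoot.def, pow_two] using this
  have hroot : aeval α (X ^ 2 + C e * X + C f : F[X]) = 0 := by
    simpa [pow_two] using hα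
  have hint : IsIntegral F α := ⟨_, hmonic, by simpa [aeval_def] using hroot⟩
  rw [IntermediateField.adjoin.finrank hint, ← minpoly.eq_of_irreducible_of_monic hirr hroot hmonic,
    hdeg]

theorem adjoin_eq_top_of_insert {y : L} {S : Set L} (hy : y ∈ Set.range (algebraMap F L))
    (h : IntermediateField.adjoin F (insert y S) = ⊤) : IntermediateField.adjoin F S = ⊤ := by
  rw [eq_top_iff, ← h, IntermediateField.adjoin_le_iff, Set.insert_subset_iff]
  obtain ⟨c, rfl⟩ := hy
  exact ⟨(IntermediateField.adjoin F S).algebraMap_mem c, IntermediateField.subset_adjoin F S⟩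

theorem adjoin_adjoin_simple_eq_top {y : L} {S : Set L}
    (h : IntermediateField.adjoin F (insert y S) = ⊤) :
    IntermediateField.adjoin (IntermediateField.adjoin F {y}) S = ⊤ := by
  rw [← IntermediateField.restrictScalars_eq_top_iff (K := F),
    IntermediateField.adjoin_adjoin_left, ← Set.insert_eq, h]

end adjoin

namespace Br
variable {F : Type u} [Field F] {L : Type u} [Field L] [Algebra F L]

theorem map_map_tower {E : Type u} [Field E] [Algebra F E] [Algebra E L] [IsScalarTower F E L]
    (x : Br F) : map (algebraMap E L) (map (algebraMap F E) x) = map (algebraMap F L) x := by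
  rw [map_map, ← IsScalarTower.algebraMap_eq]

theorem eq_zero_of_adjoin_empty (hL : IntermediateField.adjoin F (∅ : Set L) = ⊤) {x : Br F}
    (hx : map (algebraMap F L) x = 0) : x = 0 := by
  rw [IntermediateField.adjoin_empty] at hL
  have hb : Function.Bijective (algebraMap F L) := by
    refine ⟨(algebraMap F L).injective, fun z => ?_⟩
    have hz : z ∈ (⊤ : IntermediateField F L) := trivial
    rw [← hL] at hz
    exact IntermediateField.mem_bot.1 hz
  have h := congrArg (map (RingEquiv.ofBijective _ hb).symm.toRingHom) hx
  rw [map_map, map_zero] at h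
  rw [← h]
  convert (map_id x).symm
  ext c
  exact (RingEquiv.ofBijective _ hb).symm_apply_apply c

variable [CharP F 2]

theorem mem_range_or_finrank_eq_two_of_artinSchreier {a : F} {α : L}
    (hα : α * α + α = algebraMap F L a) : α ∈ Set.range (algebraMap F L) ∨
      Module.finrank F (IntermediateField.adjoin F {α}) = 2 ∧ ∀ t : F, t * t + t ≠ a := by
  have : CharP L 2 := charP_of_injective_algebraMap (algebraMap F L).injective 2
  by_cases h : ∃ t : F, t * t + t = a
  · obtain ⟨t, rfl⟩ := h
    left
    have h0 : (α + algebraMap F L t) * (α + algebraMap F L (t + 1)) = 0 := by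
      rw [map_add, map_mul] at hα
      rw [map_add, map_one]
      grind
    obtain h0 | h0 := mul_eq_zero.1 h0
    · exact ⟨t, by grind⟩
    · exact ⟨t + 1, by grind⟩
  · push Not at h
    refine Or.inr ⟨finrank_adjoin_simple_eq_two (e := 1) (f := a) (fun t ht => h t ?_) ?_, h⟩
    · grind
    · rw [map_one, one_mul, hα]
      grind

theorem mem_range_or_finrank_eq_two_of_sq {b : F} {w : L}
    (hw : w * w = algebraMap F L b) : w ∈ Set.range (algebraMap F L) ∨
      Module.finrank F (IntermediateField.adjoin F {w}) = 2 ∧ ¬IsSquare b := by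
  have : CharP L 2 := charP_of_injective_algebraMap (algebraMap F L).injective 2
  by_cases h : IsSquare b
  · obtain ⟨t, rfl⟩ := h
    left
    rw [map_mul, ← pow_two, ← pow_two] at hw
    exact ⟨t, (CharTwo.sq_injective hw).symm⟩
  · refine Or.inr ⟨finrank_adjoin_simple_eq_two (e := 0) (f := b) (fun t ht => h ⟨t, ?_⟩) ?_, h⟩
    · grind
    · rw [map_zero, zero_mul, hw]
      grind

theorem exists_eq_symb_of_adjoin_singleton {a : F} {α : L} (hα : α * α + α = algebraMap F L a)
    (hL : IntermediateField.adjoin F {α} = ⊤) {x : Br F} (hx : map (algebraMap F L) x = 0) :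
    ∃ g, x = symb a g := by
  obtain h | ⟨h2, ha⟩ := mem_range_or_finrank_eq_two_of_artinSchreier hα
  · rw [← insert_empty_eq] at hL
    exact ⟨0, by rw [eq_zero_of_adjoin_empty (adjoin_eq_top_of_insert h hL) hx, symb_zero_right]⟩
  · rw [hL, IntermediateField.finrank_top'] at h2
    obtain ⟨g, -, hg⟩ := exists_eq_symb_of_map_artinSchreier_eq_zero h2 hα ha hx
    exact ⟨g, hg⟩

/-- Over F(α₁) the class is a symbol with left slot a₂, already in F, and the descent of one symbol
keeps such a slot. -/
theorem exists_eq_symb_add_symb_of_adjoin_pair {a₁ a₂ : F} {α₁ α₂ : L}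
    (h₁ : α₁ * α₁ + α₁ = algebraMap F L a₁) (h₂ : α₂ * α₂ + α₂ = algebraMap F L a₂)
    (hL : IntermediateField.adjoin F {α₁, α₂} = ⊤) {x : Br F} (hxx : x + x = 0)
    (hx : map (algebraMap F L) x = 0) : ∃ g h, x = symb a₁ g + symb a₂ h := by
  obtain h | ⟨hd, ha⟩ := mem_range_or_finrank_eq_two_of_artinSchreier h₁
  · obtain ⟨g, hg⟩ := exists_eq_symb_of_adjoin_singleton h₂ (adjoin_eq_top_of_insert h hL) hx
    exact ⟨0, g, by rw [hg, symb_zero_right, zero_add]⟩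
  · let E := IntermediateField.adjoin F {α₁}
    have : CharP E 2 := charP_of_injective_algebraMap (algebraMap F E).injective 2
    obtain ⟨g, hg⟩ := exists_eq_symb_of_adjoin_singleton (F := E) (a := algebraMap F E a₂) h₂
      (adjoin_adjoin_simple_eq_top hL) (x := map (algebraMap F E) x) (by rw [map_map_tower, hx])
    obtain ⟨g', p, q, hpq, hp⟩ := exists_eq_symb_add_symb hd (a := a₁)
      (α := IntermediateField.AdjoinSimple.gen F α₁) (Subtype.ext h₁) ha hxx hg
    exact ⟨g', q, by rw [hpq, hp a₂ rfl]⟩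

omit [CharP F 2] in
-- For e = (a₁+a₂)/s, the elements a₁ + eθ and a₂ + e(θ+s) coincide. As [y,y) = 0, adding its right
-- slot to a left slot changes nothing; so both symbols acquire this common left slot and their
-- right slots multiply.
theorem exists_symb_add_symb_eq_symb {E : Type u} [Field E] [CharP E 2] [Algebra F E]
    (a₁ a₂ s : F) (θ : E) :
    ∃ e : F, e ≠ 0 ∧ ∃ p q, symb (algebraMap F E a₁) (algebraMap F E e * θ) +
      symb (algebraMap F E a₂) (algebraMap F E e * (θ + algebraMap F E s)) = symb p q := by
  by_cases hθ : θ = 0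
  · exact ⟨1, one_ne_zero, algebraMap F E a₂, _, by rw [hθ, mul_zero, symb_zero_right, zero_add]⟩
  by_cases hθs : θ + algebraMap F E s = 0
  · exact ⟨1, one_ne_zero, algebraMap F E a₁, _, by rw [hθs, mul_zero, symb_zero_right, add_zero]⟩
  by_cases hs : s = 0
  · exact ⟨1, one_ne_zero, algebraMap F E a₁ + algebraMap F E a₂, algebraMap F E 1 * θ,
      by rw [hs, map_zero, add_zero, symb_add_left]⟩
  by_cases ha : a₁ = a₂
  · subst ha
    have h1 : algebraMap F E 1 ≠ 0 := by simp
    exact ⟨1, one_ne_zero, algebraMap F E a₁, _,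
      (symb_mul_right _ (mul_ne_zero h1 hθ) (mul_ne_zero h1 hθs)).symm⟩
  have : CharP F 2 := (RingHom.charP_iff_charP (algebraMap F E) 2).2 ‹_›
  have hc : (a₁ + a₂) / s ≠ 0 := div_ne_zero (by grind) hs
  refine ⟨(a₁ + a₂) / s, hc, ?_⟩
  obtain ⟨c, hcdef⟩ : ∃ c, c = (a₁ + a₂) / s := ⟨_, rfl⟩
  rw [← hcdef] at hc ⊢
  have hc' : algebraMap F E c ≠ 0 := by simpa using hc
  have hcs : algebraMap F E c * algebraMap F E s = algebraMap F E a₁ + algebraMap F E a₂ := by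
    rw [← map_mul, ← map_add, hcdef, div_mul_cancel₀ _ hs]
  refine ⟨algebraMap F E a₁ + algebraMap F E c * θ, (algebraMap F E c * θ) *
    (algebraMap F E c * (θ + algebraMap F E s)), ?_⟩
  rw [symb_mul_right _ (mul_ne_zero hc' hθ) (mul_ne_zero hc' hθs), symb_add_left, symb_self,
    add_zero]
  congr 1
  rw [show algebraMap F E a₁ + algebraMap F E c * θ = algebraMap F E a₂ +
    algebraMap F E c * (θ + algebraMap F E s) by grind, symb_add_left, symb_self, add_zero]

theorem exists_eq_symb_add_of_map_eq_symb_add_symb {E : Type u} [Field E] [CharP E 2]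
    [Algebra F E] (hE : Module.finrank F E = 2) {a : F} {α : E}
    (hα : α * α + α = algebraMap F E a) (ha : ∀ t : F, t * t + t ≠ a) {x : Br F} (hx : x + x = 0)
    {a₂ a₃ : F} {g h : E}
    (hgh : map (algebraMap F E) x = symb (algebraMap F E a₂) g + symb (algebraMap F E a₃) h) :
    ∃ g' Y, IsSymbolSum 3 Y ∧ x = symb a g' + Y := by
  -- Once x minus at most two symbols over F becomes a single symbol over E, descent gives [a,g')
  -- and one further symbol, hence three besides [a,g').
  have key : ∀ (r : ℕ) (z : Br F), IsSymbolSum r z → r ≤ 2 →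
      (∃ p q, map (algebraMap F E) x = map (algebraMap F E) z + symb p q) →
      ∃ g' Y, IsSymbolSum 3 Y ∧ x = symb a g' + Y := by
    rintro r z hz hr ⟨p, q, h⟩
    obtain ⟨g', p', q', h', -⟩ := exists_eq_symb_add_symb hE hα ha (x := x - z) (ρ := p) (η := q)
      (by rw [sub_add_sub_comm, hx, hz.add_self, sub_zero]) (by rw [map_sub, h, add_sub_cancel_left])
    exact ⟨g', symb p' q' + z, ((IsSymbolSum.symb p' q').add hz).mono (by omega), by
      rw [← add_assoc, ← h', sub_add_cancel]⟩
  by_cases hg : ∃ g₀, algebraMap F E g₀ = g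
  · obtain ⟨g₀, rfl⟩ := hg
    exact key 1 (symb a₂ g₀) (.symb _ _) (by omega) ⟨_, _, by rw [hgh, map_symb]⟩
  by_cases hh : ∃ h₀, algebraMap F E h₀ = h
  · obtain ⟨h₀, rfl⟩ := hh
    exact key 1 (symb a₃ h₀) (.symb _ _) (by omega) ⟨_, _, by rw [hgh, map_symb, add_comm]⟩
  push Not at hg hh
  obtain ⟨c, d, rfl⟩ := exists_eq_add_mul_of_finrank_eq_two hE hg h
  have hd : d ≠ 0 := by
    rintro rfl
    exact hh c (by simp)
  have hd' : algebraMap F E d ≠ 0 := by simpa using hd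
  have hc : algebraMap F E c + algebraMap F E d * g =
      algebraMap F E d * (g + algebraMap F E (c / d)) := by
    rw [map_div₀]
    field_simp
    ring
  -- Since h = d(g + c/d), multiplying the right slots by e and e/d changes the sum only by symbols
  -- over F and makes it a single symbol.
  obtain ⟨e, he, p, q, hpq⟩ := exists_symb_add_symb_eq_symb a₂ a₃ (c / d) g
  have he' : algebraMap F E e ≠ 0 := by simpa using he
  have hg0 : g ≠ 0 := fun h => hg 0 (by rw [h, map_zero])
  have hgs : g + algebraMap F E (c / d) ≠ 0 := fun h => hg (c / d) (by grind)
  refine key 2 (symb a₂ e⁻¹ + symb a₃ (d / e)) ((IsSymbolSum.symb _ _).add (.symb _ _)) le_rfl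
    ⟨p, q, ?_⟩
  rw [hgh, ← hpq, hc, map_add, map_symb, map_symb, add_add_add_comm,
    ← symb_mul_right _ (by simpa using he) (mul_ne_zero he' hg0),
    ← symb_mul_right _ (by simp [he, hd]) (mul_ne_zero he' hgs)]
  congr 2
  · rw [map_inv₀, inv_mul_cancel_left₀ he']
  · rw [map_div₀ (algebraMap F E) d e, ← mul_assoc, div_mul_cancel₀ _ he']

theorem exists_eq_symb_add_of_adjoin_triple {a₁ a₂ a₃ : F} {α₁ α₂ α₃ : L}
    (h₁ : α₁ * α₁ + α₁ = algebraMap F L a₁) (h₂ : α₂ * α₂ + α₂ = algebraMap F L a₂)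
    (h₃ : α₃ * α₃ + α₃ = algebraMap F L a₃)
    (hL : IntermediateField.adjoin F {α₁, α₂, α₃} = ⊤) {x : Br F} (hxx : x + x = 0)
    (hx : map (algebraMap F L) x = 0) : ∃ g Y, IsSymbolSum 3 Y ∧ x = symb a₁ g + Y := by
  obtain h | ⟨hd, ha⟩ := mem_range_or_finrank_eq_two_of_artinSchreier h₁
  · obtain ⟨g, h, hg⟩ := exists_eq_symb_add_symb_of_adjoin_pair h₂ h₃
      (adjoin_eq_top_of_insert h hL) hxx hx
    exact ⟨0, _, ((IsSymbolSum.symb a₂ g).add (.symb a₃ h)).mono (by omega), by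
      rw [hg, symb_zero_right, zero_add]⟩
  · let E := IntermediateField.adjoin F {α₁}
    have : CharP E 2 := charP_of_injective_algebraMap (algebraMap F E).injective 2
    obtain ⟨g, h, hg⟩ := exists_eq_symb_add_symb_of_adjoin_pair (F := E) (a₁ := algebraMap F E a₂)
      (a₂ := algebraMap F E a₃) h₂ h₃ (adjoin_adjoin_simple_eq_top hL)
      (x := map (algebraMap F E) x) (by rw [← map_add, hxx, map_zero]) (by rw [map_map_tower, hx])
    exact exists_eq_symb_add_of_map_eq_symb_add_symb hd (a := a₁)
      (α := IntermediateField.AdjoinSimple.gen F α₁) (Subtype.ext h₁) ha hxx hg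

/-- Adjoining square roots: if classes over fields `F` split by `F(S)` decompose as `[c, g)` plus
`r` symbols, then classes split by `F(S, √b₁, …, √bₙ)` decompose as `[c, g)` plus `2ⁿ r` symbols
plus symbols with right slots `b₁, …, bₙ`. -/
theorem exists_eq_sum_symb_add {S : Set L} {γ : L} {r : ℕ}
    (hbase : ∀ (K : Type u) [Field K] [CharP K 2] [Algebra K L] (c : K), algebraMap K L c = γ →
      (∀ s ∈ S, s * s + s ∈ Set.range (algebraMap K L)) → IntermediateField.adjoin K S = ⊤ →
      ∀ x : Br K, x + x = 0 → map (algebraMap K L) x = 0 →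
      ∃ g Y, IsSymbolSum r Y ∧ x = symb c g + Y) {c : F} (hc : algebraMap F L c = γ)
    (hS : ∀ s ∈ S, s * s + s ∈ Set.range (algebraMap F L)) {n : ℕ} (b : Fin n → F) (β : Fin n → L)
    (hβ : ∀ j, β j * β j = algebraMap F L (b j))
    (hL : IntermediateField.adjoin F (S ∪ Set.range β) = ⊤) {x : Br F} (hxx : x + x = 0)
    (hx : map (algebraMap F L) x = 0) :
    ∃ (a : Fin n → F) (g : F) (Y : Br F), IsSymbolSum (2 ^ n * r) Y ∧
      x = ∑ j, symb (a j) (b j) + symb c g + Y := by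
  -- The base field grows by one square root at a time while L, S and γ stay fixed; this is why
  -- `hbase` ranges over all K below L and c is tracked by its image γ.
  induction n generalizing F with
  | zero =>
    rw [Set.range_eq_empty, Set.union_empty] at hL
    obtain ⟨g, Y, hY, h⟩ := hbase F c hc hS hL x hxx hx
    exact ⟨0, g, Y, by simpa using hY, by simpa using h⟩
  | succ n ih =>
    have hset : S ∪ Set.range β = insert (β 0) (S ∪ Set.range fun j : Fin n => β j.succ) := by
      rw [Fin.range_fin_succ, Set.union_insert]
      rfl
    rw [hset] at hL
    -- Over the enlarged field b₀ may have become a square. Its symbol is then taken to be [0, b₀) =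
    -- 0.
    obtain h | ⟨hd, hb⟩ := mem_range_or_finrank_eq_two_of_sq (hβ 0)
    · obtain ⟨a, g, Y, hY, h⟩ := ih hc hS (fun j => b j.succ) (fun j => β j.succ)
        (fun j => hβ j.succ) (adjoin_eq_top_of_insert h hL) hxx hx
      refine ⟨Fin.cons 0 a, g, Y, hY.mono ?_, ?_⟩
      · exact Nat.mul_le_mul_right r (Nat.pow_le_pow_right (by omega) (by omega))
      · simpa [Fin.sum_univ_succ] using h
    · let E := IntermediateField.adjoin F {β 0}
      have : CharP E 2 := charP_of_injective_algebraMap (algebraMap F E).injective 2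
      obtain ⟨w, hw⟩ : ∃ w : E, w * w = algebraMap F E (b 0) :=
        ⟨IntermediateField.AdjoinSimple.gen F (β 0), Subtype.ext (hβ 0)⟩
      obtain ⟨a, g, Y, hY, h⟩ := ih (F := E) (c := algebraMap F E c) hc
        (fun s hs => by
          obtain ⟨d, hd⟩ := hS s hs
          exact ⟨algebraMap F E d, hd⟩) (fun j => algebraMap F E (b j.succ)) (fun j => β j.succ)
        (fun j => hβ j.succ) (adjoin_adjoin_simple_eq_top hL) (x := map (algebraMap F E) x)
        (by rw [← map_add, hxx, map_zero]) (by rw [map_map_tower, hx])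
      -- The right slots lie in F, so these symbols come from F and can be subtracted from x before
      -- descending the rest.
      obtain ⟨a', ha'⟩ : ∃ a' : Fin n → F, ∑ j, symb (a j) (algebraMap F E (b j.succ)) =
          map (algebraMap F E) (∑ j, symb (a' j) (b j.succ)) := by
        have hw' : ∀ d, algebraMap F E d ≠ w := by
          rintro d rfl
          exact hb ⟨d, (algebraMap F E).injective (by rw [← hw, map_mul])⟩
        obtain ⟨ϕ, hϕ⟩ := exists_ringHom_sq_of_finrank_eq_two (E := E) hd hw hw'
        refine ⟨fun j => ϕ (a j), ?_⟩
        rw [map_sum]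
        exact Finset.sum_congr rfl fun j _ => symb_algebraMap_right hϕ _ _
      obtain ⟨a₀, g', Y', hY', h'⟩ := exists_eq_symb_add_symb_add hd hw hb (c := c) (g := g) (y := Y)
        (x := x - ∑ j, symb (a' j) (b j.succ))
        (by rw [sub_add_sub_comm, hxx, ← Finset.sum_add_distrib]; simp [add_self_symb]) hY
        (by rw [map_sub, h, ha']; abel)
      refine ⟨Fin.cons a₀ a', g', Y', ?_, ?_⟩
      · rwa [pow_succ', mul_assoc]
      · rw [Fin.sum_univ_succ, sub_eq_iff_eq_add.1 h']
        simp only [Fin.cons_zero, Fin.cons_succ]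
        abel

end Br

end

/-! ### Finite tensor products of algebras, symbol length, and the theorem -/

section

section piTensorProduct
variable {F : Type u} [Field F]

theorem finrank_piTensorProduct {ι : Type*} [Fintype ι] {M : ι → Type*} [∀ i, AddCommGroup (M i)]
    [∀ i, Module F (M i)] [∀ i, FiniteDimensional F (M i)] :
    Module.finrank F (PiTensorProduct F M) = ∏ i, Module.finrank F (M i) := by
  classical
  rw [Module.finrank_eq_card_basis (Basis.piTensorProduct fun i => Module.finBasis F (M i))]
  simp

variable {n : ℕ} (A : Fin (n + 1) → Type v) [∀ i, Ring (A i)] [∀ i, Algebra F (A i)]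

/-- Splitting off the first factor of a tensor product of algebras. -/
noncomputable def piTensorProductSuccAlgHom :
    PiTensorProduct F A →ₐ[F] A 0 ⊗[F] PiTensorProduct F fun i : Fin n => A i.succ :=
  PiTensorProduct.liftAlgHom
    (LinearMap.uncurryLeft
      { toFun := fun a => (TensorProduct.mk F (A 0) (PiTensorProduct F fun i : Fin n => A i.succ)
          a).compMultilinearMap (PiTensorProduct.tprod F)
        map_add' := fun a b => by ext; simp
        map_smul' := fun c a => by ext; simp })
    rfl fun x y => by
      change (x 0 * y 0) ⊗ₜ[F] PiTensorProduct.tprod F (fun i : Fin n => x i.succ * y i.succ) =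
        (x 0 ⊗ₜ[F] PiTensorProduct.tprod F fun i : Fin n => x i.succ) *
        (y 0 ⊗ₜ[F] PiTensorProduct.tprod F fun i : Fin n => y i.succ)
      rw [Algebra.TensorProduct.tmul_mul_tmul, PiTensorProduct.tprod_mul_tprod]
      rfl

theorem piTensorProductSuccAlgHom_tprod (x : ∀ i, A i) :
    piTensorProductSuccAlgHom (F := F) A (PiTensorProduct.tprod F x) =
      x 0 ⊗ₜ PiTensorProduct.tprod F fun i : Fin n => x i.succ :=
  PiTensorProduct.lift.tprod _

theorem piTensorProductSuccAlgHom_surjective :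
    Function.Surjective (piTensorProductSuccAlgHom (F := F) A) := by
  intro z
  change z ∈ (piTensorProductSuccAlgHom (F := F) A).range
  induction z with
  | zero => exact zero_mem _
  | add x y hx hy => exact add_mem hx hy
  | tmul a t =>
    induction t using PiTensorProduct.induction_on with
    | smul_tprod r f =>
      rw [TensorProduct.tmul_smul]
      refine Subalgebra.smul_mem _ ?_ r
      exact ⟨PiTensorProduct.tprod F (Fin.cons a f : ∀ i, A i), piTensorProductSuccAlgHom_tprod A _⟩
    | add x y hx hy =>
      rw [TensorProduct.tmul_add]
      exact add_mem hx hy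

/-- Splitting off the first factor of a tensor product of finite-dimensional algebras. -/
noncomputable def piTensorProductSuccAlgEquiv [∀ i, FiniteDimensional F (A i)] :
    PiTensorProduct F A ≃ₐ[F] A 0 ⊗[F] PiTensorProduct F fun i : Fin n => A i.succ :=
  AlgEquiv.ofBijective (piTensorProductSuccAlgHom A) <| by
    have h := piTensorProductSuccAlgHom_surjective (F := F) A
    exact ⟨(LinearMap.injective_iff_surjective_of_finrank_eq_finrank
      (f := (piTensorProductSuccAlgHom (F := F) A).toLinearMap) (by
        rw [Module.finrank_tensorProduct, finrank_piTensorProduct, finrank_piTensorProduct,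
          Fin.prod_univ_succ])).2 h, h⟩

end piTensorProduct

namespace Br
variable {F : Type u} [Field F]

theorem piTensorProduct_zero_algEquiv (A : Fin 0 → Type u) [∀ i, Ring (A i)] [∀ i, Algebra F (A i)] :
    Nonempty (F ≃ₐ[F] PiTensorProduct F A) := by
  have _ : ∀ i, FiniteDimensional F (A i) := fun i => i.elim0
  have h : Module.finrank F (PiTensorProduct F A) = 1 := by simp [finrank_piTensorProduct]
  have : Nontrivial (PiTensorProduct F A) := Module.nontrivial_of_finrank_pos (R := F) (by simp [h])
  exact ⟨AlgEquiv.ofBijective (Algebra.ofId F _) (AlgHom.bijective_of_finrank_eq _ (by simp [h]))⟩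

theorem isSimpleRing_isCentral_piTensorProduct {n : ℕ} (A : Fin n → Type u) [∀ i, Ring (A i)]
    [∀ i, Algebra F (A i)] [∀ i, Algebra.IsCentral F (A i)] [∀ i, IsSimpleRing (A i)]
    [∀ i, FiniteDimensional F (A i)] :
    IsSimpleRing (PiTensorProduct F A) ∧ Algebra.IsCentral F (PiTensorProduct F A) := by
  induction n with
  | zero =>
    obtain ⟨e⟩ := piTensorProduct_zero_algEquiv (F := F) A
    exact ⟨IsSimpleRing.of_ringEquiv e.toRingEquiv inferInstance, .of_algEquiv F _ _ e⟩
  | succ n ih =>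
    obtain ⟨_, _⟩ := ih fun i : Fin n => A i.succ
    let e := (piTensorProductSuccAlgEquiv (F := F) A).symm
    exact ⟨IsSimpleRing.of_ringEquiv e.toRingEquiv inferInstance, .of_algEquiv F _ _ e⟩

instance {n : ℕ} (A : Fin n → Type u) [∀ i, Ring (A i)]
    [∀ i, Algebra F (A i)] [∀ i, Algebra.IsCentral F (A i)] [∀ i, IsSimpleRing (A i)]
    [∀ i, FiniteDimensional F (A i)] : IsSimpleRing (PiTensorProduct F A) :=
  (isSimpleRing_isCentral_piTensorProduct A).1

instance {n : ℕ} (A : Fin n → Type u) [∀ i, Ring (A i)]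
    [∀ i, Algebra F (A i)] [∀ i, Algebra.IsCentral F (A i)] [∀ i, IsSimpleRing (A i)]
    [∀ i, FiniteDimensional F (A i)] : Algebra.IsCentral F (PiTensorProduct F A) :=
  (isSimpleRing_isCentral_piTensorProduct A).2

theorem mk_piTensorProduct {n : ℕ} (A : Fin n → Type u) [∀ i, Ring (A i)]
    [∀ i, Algebra F (A i)] [∀ i, Algebra.IsCentral F (A i)] [∀ i, IsSimpleRing (A i)]
    [∀ i, FiniteDimensional F (A i)] : mk F (PiTensorProduct F A) = ∑ i, mk F (A i) := by
  induction n with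
  | zero =>
    obtain ⟨e⟩ := piTensorProduct_zero_algEquiv (F := F) A
    exact (mk_eq_of_algEquiv e).symm
  | succ n ih =>
    rw [Fin.sum_univ_succ, ← ih, mk_add_mk, mk_eq_of_algEquiv (piTensorProductSuccAlgEquiv A)]

theorem brauerEquiv_of_mk_eq {A : Type v} [Ring A] [Algebra F A] {A' B : Type u} [Ring A']
    [Algebra F A'] [Algebra.IsCentral F A'] [IsSimpleRing A'] [FiniteDimensional F A'] [Ring B]
    [Algebra F B] [Algebra.IsCentral F B] [IsSimpleRing B] [FiniteDimensional F B]
    (e : A ≃ₐ[F] A') (h : mk F A' = mk F B) : BrauerEquiv F A B :=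
  (BrauerEquiv.of_algEquiv e).trans (mk_eq_iff.1 h)

/-- Base change of algebras in two steps. -/
noncomputable def cancelBaseChangeAlgEquiv (E : Type v) [Field E] [Algebra F E] (K : Type w)
    [Field K] [Algebra F K] [Algebra E K] [IsScalarTower F E K] (A : Type*) [Ring A]
    [Algebra F A] : K ⊗[E] (E ⊗[F] A) ≃ₐ[K] K ⊗[F] A :=
  AlgEquiv.symm <| AlgEquiv.ofLinearEquiv
    (TensorProduct.AlgebraTensorModule.cancelBaseChange F E K K A).symm
    (by simp [Algebra.TensorProduct.one_def])
    (LinearMap.map_mul_of_map_mul_tmul fun _ _ _ _ => by simp)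

theorem map_mk_eq_zero_of_isSplitAlgebra {A : Type v} [Ring A] [Algebra F A] [IsSimpleRing A] {A' : Type u}
    [Ring A'] [Algebra F A'] [Algebra.IsCentral F A'] [IsSimpleRing A'] [FiniteDimensional F A']
    (e : A ≃ₐ[F] A') {L : Type w} [Field L] [Algebra F L] {L' : Type u} [Field L'] [Algebra F L']
    (ε : L ≃ₐ[F] L') (h : IsSplitAlgebra L (L ⊗[F] A)) :
    map (algebraMap F L') (mk F A') = 0 := by
  rw [map_mk, zero_def, mk_eq_iff]
  let _ : Algebra L L' := ε.toRingHom.toAlgebra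
  have : IsScalarTower F L L' := .of_algebraMap_eq fun c => (ε.commutes c).symm
  have h1 : BrauerEquiv L' (L' ⊗[F] A') (L' ⊗[F] A) :=
    (BrauerEquiv.of_algEquiv e.symm).baseChange L'
  have h2 : BrauerEquiv L' (L' ⊗[L] (L ⊗[F] A)) (L' ⊗[L] L) := h.brauerEquiv.baseChange L'
  exact (h1.trans (.of_algEquiv (cancelBaseChangeAlgEquiv L L' A).symm)).trans
    (h2.trans (.of_algEquiv (Algebra.TensorProduct.rid L L' L')))

variable [CharP F 2]

theorem IsSymbolSum.exists_eq_sum {k : ℕ} {x : Br F} (hx : IsSymbolSum k x) :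
    ∃ a b : Fin k → F, (∀ i, b i ≠ 0) ∧ x = ∑ i, Br.symb (a i) (b i) := by
  induction k generalizing x with
  | zero => exact ⟨0, 0, fun i => i.elim0, by simpa using hx.eq_zero⟩
  | succ k ih =>
    obtain ⟨a₀, b₀, y, hy, rfl⟩ := hx.exists_of_succ
    obtain ⟨a, b, hb, rfl⟩ := ih hy
    obtain ⟨b₁, h₁, h⟩ : ∃ b₁, b₁ ≠ 0 ∧ Br.symb a₀ b₀ = Br.symb a₀ b₁ := by
      by_cases h : b₀ = 0
      -- A right slot 0 stands for no quaternion algebra, so it is replaced by 1, which also gives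
      -- the zero class.
      · refine ⟨1 ^ 2, by simp, ?_⟩
        rw [symb_sq_right, h, symb_zero_right]
      · exact ⟨b₀, h, rfl⟩
    refine ⟨Fin.cons a₀ a, Fin.cons b₁ b, fun i => ?_, ?_⟩
    · cases i using Fin.cases
      · exact h₁
      · exact hb _
    · simp [Fin.sum_univ_succ, h]

theorem isSymbolSum_sum {k : ℕ} (a b : Fin k → F) :
    IsSymbolSum k (∑ i, symb (a i) (b i)) :=
  ⟨List.ofFn fun i => (a i, b i), by simp, by simp [List.sum_ofFn, Function.comp_def]⟩

theorem symbolLength_le {A : Type v} [Ring A] [Algebra F A] {A' : Type u} [Ring A']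
    [Algebra F A'] [Algebra.IsCentral F A'] [IsSimpleRing A'] [FiniteDimensional F A']
    (e : A ≃ₐ[F] A') {k : ℕ} (h : IsSymbolSum k (mk F A')) : symbolLength F A ≤ (k : ℕ∞) := by
  refine iInf₂_le k ?_
  obtain ⟨a, b, hb, h⟩ := h.exists_eq_sum
  have hs : ∀ i, IsSimpleRing (SymbolAlgebra F (a i) (b i)) := fun i => isSimpleRing_symbolAlgebra (a i) (hb i)
  refine ⟨fun i => CSA.of F (SymbolAlgebra F (a i) (b i)), fun i => finrank_symbolAlgebra _ _, ?_⟩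
  have key : BrauerEquiv F A (PiTensorProduct F fun i => SymbolAlgebra F (a i) (b i)) := by
    refine brauerEquiv_of_mk_eq e ?_
    rw [h, mk_piTensorProduct]
    exact Finset.sum_congr rfl fun i _ => symb_of_ne_zero _ (hb i)
  exact key

/-- The decomposition of classes split by `F(α₁, …, αₘ, √b₁, …, √bₙ)`. -/
theorem exists_eq_add_sum_symb {L : Type u} [Field L] [Algebra F L] {m n : ℕ} (α : Fin m → L)
    (hα : ∀ i, α i * α i + α i ∈ Set.range (algebraMap F L)) (b : Fin n → F) (β : Fin n → L)
    (hβ : ∀ j, β j * β j = algebraMap F L (b j))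
    (hL : IntermediateField.adjoin F (Set.range α ∪ Set.range β) = ⊤) {x : Br F}
    (hxx : x + x = 0) (hx : map (algebraMap F L) x = 0) :
    ∃ (a : Fin n → F) (y : Br F), x = y + ∑ j, symb (a j) (b j) ∧
      (m = 1 → IsSymbolSum 1 y) ∧ (m = 2 → IsSymbolSum (2 ^ n + 1) y) ∧
      (m = 3 → IsSymbolSum (3 * 2 ^ n + 1) y) := by
  -- Here r counts the symbols other than [c,g) before square roots are adjoined. It will be 0, 1 or
  -- 3, and the final + 1 is [c,g) itself.
  have key : ∀ (r : ℕ) (i₀ : Fin m), (∀ (K : Type u) [Field K] [CharP K 2] [Algebra K L] (c : K),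
      algebraMap K L c = α i₀ * α i₀ + α i₀ →
      (∀ i, α i * α i + α i ∈ Set.range (algebraMap K L)) →
      IntermediateField.adjoin K (Set.range α) = ⊤ →
      ∀ x : Br K, x + x = 0 → map (algebraMap K L) x = 0 →
      ∃ g Y, IsSymbolSum r Y ∧ x = symb c g + Y) → ∃ (a : Fin n → F) (y : Br F),
      x = y + ∑ j, symb (a j) (b j) ∧ IsSymbolSum (r * 2 ^ n + 1) y := by
    intro r i₀ h
    obtain ⟨c, hc⟩ := hα i₀
    obtain ⟨a, g, Y, hY, hxY⟩ := exists_eq_sum_symb_add (S := Set.range α) (r := r)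
      (fun K _ _ _ c hc hS => h K c hc fun i => hS _ ⟨i, rfl⟩) hc
      (by rintro _ ⟨i, rfl⟩; exact hα i) b β hβ hL hxx hx
    refine ⟨a, symb c g + Y, by rw [hxY]; abel, ?_⟩
    rw [add_comm, mul_comm]
    exact (IsSymbolSum.symb c g).add hY
  by_cases h1 : m = 1
  · subst h1
    obtain ⟨a, y, hxy, hy⟩ := key 0 0 fun K _ _ _ c hc hα hL x _ hx => by
      have hr : Set.range α = {α 0} := by ext; simp [eq_comm]
      rw [hr] at hL
      obtain ⟨g, hg⟩ := exists_eq_symb_of_adjoin_singleton hc.symm hL hx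
      exact ⟨g, 0, IsSymbolSum.zero, by rw [hg, add_zero]⟩
    exact ⟨a, y, hxy, fun _ => by simpa using hy, by simp, by simp⟩
  by_cases h2 : m = 2
  · subst h2
    obtain ⟨a, y, hxy, hy⟩ := key 1 0 fun K _ _ _ c hc hα hL x hxx hx => by
      have hr : Set.range α = {α 0, α 1} := by ext; simp [eq_comm, Fin.exists_fin_two]
      rw [hr] at hL
      obtain ⟨c', hc'⟩ := hα 1
      obtain ⟨g, h, hg⟩ := exists_eq_symb_add_symb_of_adjoin_pair hc.symm hc'.symm hL hxx hx
      exact ⟨g, _, IsSymbolSum.symb c' h, hg⟩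
    exact ⟨a, y, hxy, by simp, fun _ => by simpa using hy, by simp⟩
  by_cases h3 : m = 3
  · subst h3
    obtain ⟨a, y, hxy, hy⟩ := key 3 0 fun K _ _ _ c hc hα hL x hxx hx => by
      have hr : Set.range α = {α 0, α 1, α 2} := by ext; simp [eq_comm, Fin.exists_fin_succ]
      rw [hr] at hL
      obtain ⟨c', hc'⟩ := hα 1
      obtain ⟨c'', hc''⟩ := hα 2
      exact exists_eq_symb_add_of_adjoin_triple hc.symm hc'.symm hc''.symm hL hxx hx
    exact ⟨a, y, hxy, by simp, by simp, fun _ => by simpa using hy⟩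
  -- For any other m nothing is claimed about y, and zero left slots do.
  exact ⟨0, x, by simp, fun h => absurd h h1, fun h => absurd h h2, fun h => absurd h h3⟩

end Br

theorem isCentral_of_algEquiv {F : Type u} [Field F] {A : Type v} [Ring A] [Algebra F A]
    [Algebra.IsCentral F A] {B : Type w} [Ring B] [Algebra F B] (e : A ≃ₐ[F] B) :
    Algebra.IsCentral F B where
  out z hz := by
    have h : e.symm z ∈ Subalgebra.center F A := Subalgebra.mem_center_iff.2 fun x =>
      e.injective (by simpa using Subalgebra.mem_center_iff.1 hz (e x))
    obtain ⟨c, hc⟩ := Algebra.mem_bot.1 (Algebra.IsCentral.out h)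
    exact Algebra.mem_bot.2 ⟨c, by rw [← e.commutes, hc, e.apply_symm_apply]⟩

theorem small_of_finiteDimensional {F : Type u} [Field F] (A : Type v) [Ring A]
    [Algebra F A] [FiniteDimensional F A] : Small.{u} A :=
  small_of_injective (Module.finBasis F A).equivFun.injective

theorem proposition2p6
    {F : Type u} [Field F] [CharP F 2]
    {A : Type v} [Ring A] [Algebra F A]
    [Algebra.IsCentral F A] [IsSimpleRing A] [FiniteDimensional F A]
    (hA : HasExponentTwo F A)
    {m n : ℕ}
    {L : Type w} [Field L] [Algebra F L]
    (α : Fin m → L) (hα : ∀ i, α i ^ 2 - α i ∈ Set.range (algebraMap F L))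
    (b : Fin n → F) (hb : ∀ j, b j ≠ 0 ∧ ¬ IsSquare (b j))
    (β : Fin n → L) (hβ : ∀ j, β j ^ 2 = algebraMap F L (b j))
    (hL : IntermediateField.adjoin F (Set.range α ∪ Set.range β) = ⊤)
    (hsplit : IsSplitAlgebra L (L ⊗[F] A)) :
    ∃ (a : Fin n → F) (B : CSA.{u, u} F),
      BrauerEquiv F A (B ⊗[F] PiTensorProduct F fun j => SymbolAlgebra F (a j) (b j)) ∧
      (m = 1 → symbolLength F B ≤ 1 ∧
        symbolLength F A ≤ ((n + 1 : ℕ) : ℕ∞)) ∧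
      (m = 2 → symbolLength F B ≤ ((2 ^ n + 1 : ℕ) : ℕ∞) ∧
        symbolLength F A ≤ ((2 ^ n + n + 1 : ℕ) : ℕ∞)) ∧
      (m = 3 → symbolLength F B ≤ ((3 * 2 ^ n + 1 : ℕ) : ℕ∞) ∧
        symbolLength F A ≤ ((3 * 2 ^ n + n + 1 : ℕ) : ℕ∞)) := by
  have : CharP L 2 := charP_of_injective_algebraMap (algebraMap F L).injective 2
  have hfin : FiniteDimensional F L := by
    have : FiniteDimensional F (⊤ : IntermediateField F L) := by
      rw [← hL]
      have : Finite ↑(Set.range α ∪ Set.range β) :=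
        ((Set.finite_range α).union (Set.finite_range β)).to_subtype
      refine IntermediateField.finiteDimensional_adjoin ?_
      rintro _ (⟨i, rfl⟩ | ⟨j, rfl⟩)
      · obtain ⟨c, hc⟩ := hα i
        refine ⟨.X ^ 2 - .X - .C c, by monicity!, by simp [hc]⟩
      · exact ⟨.X ^ 2 - .C (b j), by monicity!, by simp [hβ]⟩
    exact IntermediateField.topEquiv.toLinearEquiv.finiteDimensional
  have := small_of_finiteDimensional (F := F) A
  have := small_of_finiteDimensional (F := F) L
  -- Finite-dimensional algebras over F have copies in the universe of F, where `Br F` lives.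
  let A' := Shrink.{u} A
  let e : A ≃ₐ[F] A' := (Shrink.algEquiv F A).symm
  have : Algebra.IsCentral F A' := isCentral_of_algEquiv e
  have : IsSimpleRing A' := .of_ringEquiv e.toRingEquiv inferInstance
  have : FiniteDimensional F A' := e.toLinearEquiv.finiteDimensional
  let L' := Shrink.{u} L
  let ε : L ≃ₐ[F] L' := (Shrink.algEquiv F L).symm
  have hxx : Br.mk F A' + Br.mk F A' = 0 := by
    rw [Br.mk_add_mk, Br.zero_def, Br.mk_eq_iff]
    exact (BrauerEquiv.of_algEquiv (Algebra.TensorProduct.congr e e).symm).trans hA.2.brauerEquiv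
  have hx : Br.map (algebraMap F L') (Br.mk F A') = 0 := Br.map_mk_eq_zero_of_isSplitAlgebra e ε hsplit
  obtain ⟨a, y, hxy, h1, h2, h3⟩ := Br.exists_eq_add_sum_symb (L := L') (fun i => ε (α i))
    (fun i => by
      obtain ⟨c, hc⟩ := hα i
      refine ⟨c, ?_⟩
      rw [← ε.commutes, hc, ← map_mul, ← map_add, pow_two, CharTwo.sub_eq_add]) b
    (fun j => ε (β j)) (fun j => by rw [← map_mul, ← pow_two, hβ, ε.commutes]) (by
      have h := IntermediateField.adjoin_map F (Set.range α ∪ Set.range β) ε.toAlgHom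
      rw [hL, Set.image_union, ← Set.range_comp, ← Set.range_comp] at h
      refine h.symm.trans ?_
      rw [← AlgHom.fieldRange_eq_map]
      exact AlgHom.fieldRange_eq_top.2 ε.surjective) hxx hx
  have hs : ∀ j, IsSimpleRing (SymbolAlgebra F (a j) (b j)) := fun j => isSimpleRing_symbolAlgebra (a j) (hb j).1
  induction y using Br.ind with | _ B
  have hlen : ∀ k, Br.IsSymbolSum k (Br.mk F B) → symbolLength F B ≤ k ∧
      symbolLength F A ≤ ((k + n : ℕ) : ℕ∞) := fun k hk =>
    ⟨Br.symbolLength_le AlgEquiv.refl hk,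
      Br.symbolLength_le e (by rw [hxy]; exact hk.add (Br.isSymbolSum_sum a b))⟩
  have key : BrauerEquiv F A (B ⊗[F] PiTensorProduct F fun j => SymbolAlgebra F (a j) (b j)) := by
    refine Br.brauerEquiv_of_mk_eq e ?_
    rw [hxy, ← Br.mk_add_mk, Br.mk_piTensorProduct]
    congr 1
    exact Finset.sum_congr rfl fun j _ => (Br.symb_of_ne_zero _ (hb j).1)
  refine ⟨a, CSA.of F B, key, fun hm => ?_, fun hm => ?_, fun hm => ?_⟩
  · rw [add_comm n]
    exact hlen _ (h1 hm)
  · rw [add_right_comm]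
    exact hlen _ (h2 hm)
  · rw [add_right_comm]
    exact hlen _ (h3 hm)

end
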